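/- Let $n\ge 2$ and let $M$ be a nonempty smooth manifold (Hausdorff, second countable, without boundary) of dimension $n+1$. A \emph{projective structure} on $M$ is a class of smooth affine connections $\Gamma=(\Gamma^i_{jk})$ on $M$ modulo projective equivalence, where two connections are equivalent if they define the same path equation $$x^i_{tt}+\sum_{j,k}\Gamma^i_{jk}(x)\,x^j_t x^k_t=\nu\, x^i_t ,\qquad \nu=\nu(t)\ \text{arbitrary},$$ i.e. have the same unparametrized geodesics; the solutions of this equation are the \emph{paths}. The set of projective structures carries the $C^\ell$ topology, that is, the quotient of the (weak or strong) $C^\ell$ topology on connections (uniform closeness on compact subsets of charts of the Christoffel symbols and their derivatives up to order $\ell$; in the strong topology, closeness with arbitrary prescribed tolerances on locally finite families of such compact sets). A projective structure is \emph{variational} if there are an open dense set $U\subset TM$ of nonzero tangent vectors and a smooth autonomous Lagrangian $\hat L(x,x_t,x_{tt},\dots)$ of some finite order, defined for curves with velocities in $U$, whose Euler--Lagrange expressions are of order at most two and whose extremals with velocities in $U$ are precisely the (arbitrarily parametrized) paths with velocities in $U$. It is \emph{metrizable} if it contains the Levi-Civita connection of a smooth pseudo-Riemannian metric on $M$. Put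 $\ell=4$ if $n\ge 3$ and $\ell=5$ if $n=2$. Then a generic projective structure on $M$ in the $C^\ell$ topology is not variational, hence not metrizable: there is a set $\mathcal G$ of projective structures on $M$ that is open and dense in the weak $C^\ell$ topology, and also open and dense in the strong $C^\ell$ topology, such that no element of $\mathcal G$ is variational and no element of $\mathcal G$ is pseudo-Riemannian metrizable. -/

import Mathlib

open Set Bundle
open scoped Manifold ContDiff Topology

noncomputable section

namespace ProjVar

/-- The model space `ℝ^{n+1}`. -/
abbrev Model (n : ℕ) : Type := EuclideanSpace ℝ (Fin (n + 1))

section Connections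

variable (n : ℕ) (M : Type*) [TopologicalSpace M] [ChartedSpace (Model n) M]
  [IsManifold 𝓘(ℝ, Model n) ∞ M]

/-- The smooth coordinate charts of `M`: all members of the maximal smooth atlas. -/
def charts : Set (OpenPartialHomeomorph M (Model n)) :=
  IsManifold.maximalAtlas 𝓘(ℝ, Model n) ∞ M

/-- A smooth affine connection on `M`. -/
structure AffineConnection where
  /-- The covariant derivative on the tangent bundle. -/
  cov : CovariantDerivative 𝓘(ℝ, Model n) (Model n)
    (TangentSpace 𝓘(ℝ, Model n) : M → Type _)
  smooth : CovariantDerivative.ContMDiffCovariantDerivative cov ∞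

variable {n M}

/-- The coordinate vector field of the chart `e` in the constant direction `v`
(only its values on `e.source` matter). -/
def coordField (e : OpenPartialHomeomorph M (Model n)) (v : Model n) :
    Π p : M, TangentSpace 𝓘(ℝ, Model n) p :=
  VectorField.mpullback 𝓘(ℝ, Model n) 𝓘(ℝ, Model n) e (fun _ => v)

/-- The Christoffel symbols of `D` in the chart `e`, contracted with `u` and `v`: the coordinate
expression of `∇_{∂_u} ∂_v` at the point with coordinates `x`, that is `∑ Γ^i_{jk}(x) u^j v^k`. -/
def AffineConnection.christoffel (D : AffineConnection n M)
    (e : OpenPartialHomeomorph M (Model n)) (x u v : Model n) : Model n :=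
  mfderiv 𝓘(ℝ, Model n) 𝓘(ℝ, Model n) e (e.symm x)
    (D.cov (coordField e v) (e.symm x) (coordField e u (e.symm x)))

/-- The curve `c`, given in the coordinates `e`, satisfies
`x_tt + Γ(x_t, x_t) = ν x_t` at time `t`, for some number `ν`. -/
def AffineConnection.PathEqAt (D : AffineConnection n M)
    (e : OpenPartialHomeomorph M (Model n)) (c : ℝ → Model n) (t : ℝ) : Prop :=
  ∃ ν : ℝ, iteratedDeriv 2 c t + D.christoffel e (c t) (deriv c t) (deriv c t) = ν • deriv c t

variable (n M)

/-- Projective equivalence of connections: they define the same path equation, that is,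
the difference of `Γ(u, u)` and `Γ'(u, u)` is proportional to `u`. -/
def projSetoid : Setoid (AffineConnection n M) where
  r D D' := ∀ e ∈ charts n M, ∀ x ∈ e.target, ∀ u : Model n,
    ∃ a : ℝ, D.christoffel e x u u - D'.christoffel e x u u = a • u
  iseqv :=
    { refl := fun D e _ x _ u => ⟨0, by simp⟩
      symm := fun {D D'} h e he x hx u => by
        obtain ⟨a, ha⟩ := h e he x hx u
        exact ⟨-a, by rw [neg_smul, ← ha, neg_sub]⟩
      trans := fun {D D' D''} h h' e he x hx u => by
        obtain ⟨a, ha⟩ := h e he x hx u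
        obtain ⟨b, hb⟩ := h' e he x hx u
        exact ⟨a + b, by rw [add_smul, ← ha, ← hb, sub_add_sub_cancel]⟩ }

/-- Smooth projective structures on `M`: affine connections up to projective equivalence. -/
def ProjectiveStructure : Type _ := Quotient (projSetoid n M)

variable {n M}

/-- The projective class of a connection. -/
def AffineConnection.proj (D : AffineConnection n M) : ProjectiveStructure n M :=
  Quotient.mk (projSetoid n M) D

/-- The path equation of a projective structure at time `t`, for a curve in the chart `e`
(it does not depend on the connection that represents the structure). -/
def ProjectiveStructure.PathEqAt (P : ProjectiveStructure n M)
    (e : OpenPartialHomeomorph M (Model n)) (c : ℝ → Model n) (t : ℝ) : Prop :=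
  ∃ D : AffineConnection n M, D.proj = P ∧ D.PathEqAt e c t

/-! ### The `C^k` topologies -/

/-- The connections whose Christoffel symbols in the chart `e` are `ε`-close to those of `D`
on `K`, together with all their partial derivatives up to order `k`. -/
def AffineConnection.near (D : AffineConnection n M) (k : ℕ)
    (e : OpenPartialHomeomorph M (Model n)) (K : Set (Model n)) (ε : ℝ) :
    Set (AffineConnection n M) :=
  {D' | ∀ x ∈ K, ∀ i j : Fin (n + 1), ∀ m ≤ k,
    ‖iteratedFDeriv ℝ m (fun y =>
      D'.christoffel e y (EuclideanSpace.single i 1) (EuclideanSpace.single j 1) -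
      D.christoffel e y (EuclideanSpace.single i 1) (EuclideanSpace.single j 1)) x‖ < ε}

variable (n M)

/-- The weak (compact-open) `C^k` topology on connections. -/
@[reducible] def weakTopology (k : ℕ) : TopologicalSpace (AffineConnection n M) :=
  TopologicalSpace.generateFrom
    {S | ∃ (D : AffineConnection n M) (e : OpenPartialHomeomorph M (Model n))
      (K : Set (Model n)) (ε : ℝ), e ∈ charts n M ∧ IsCompact K ∧ K ⊆ e.target ∧ 0 < ε ∧
      S = D.near k e K ε}

/-- The strong (Whitney) `C^k` topology on connections: closeness is prescribed on a locally
finite family of compact sets, each contained in a chart, with an arbitrary positive tolerance on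
each of them. (On a second countable manifold countable families suffice.) -/
@[reducible] def strongTopology (k : ℕ) : TopologicalSpace (AffineConnection n M) :=
  TopologicalSpace.generateFrom
    {S | ∃ (D : AffineConnection n M) (e : ℕ → OpenPartialHomeomorph M (Model n))
      (K : ℕ → Set (Model n)) (ε : ℕ → ℝ),
      (∀ i, e i ∈ charts n M ∧ IsCompact (K i) ∧ K i ⊆ (e i).target ∧ 0 < ε i) ∧
      LocallyFinite (fun i => (e i).symm '' K i) ∧
      S = ⋂ i, D.near k (e i) (K i) (ε i)}

/-- The weak `C^k` topology on projective structures (quotient topology). -/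
@[reducible] def ProjectiveStructure.weakTopology (k : ℕ) : TopologicalSpace (ProjectiveStructure n M) :=
  TopologicalSpace.coinduced AffineConnection.proj (ProjVar.weakTopology n M k)

/-- The strong `C^k` topology on projective structures (quotient topology). -/
@[reducible] def ProjectiveStructure.strongTopology (k : ℕ) : TopologicalSpace (ProjectiveStructure n M) :=
  TopologicalSpace.coinduced AffineConnection.proj (ProjVar.strongTopology n M k)

end Connections

/-! ### Lagrangians and variationality -/

section Lagrangians

variable {n : ℕ} {M : Type*} [TopologicalSpace M] [ChartedSpace (Model n) M]
  [IsManifold 𝓘(ℝ, Model n) ∞ M]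

/-- The jet of order `r + 1` of a curve in `ℝ^{n+1}` at time `t`. -/
def jet (r : ℕ) (c : ℝ → Model n) (t : ℝ) : Fin (r + 2) → Model n :=
  fun k => iteratedDeriv k c t

/-- The tangent vector of `M` with coordinates `(x, v)` in the chart `e`. -/
def tangentVec (e : OpenPartialHomeomorph M (Model n)) (x v : Model n) :
    TangentBundle 𝓘(ℝ, Model n) M :=
  tangentMap 𝓘(ℝ, Model n) 𝓘(ℝ, Model n) e.symm ⟨x, v⟩

/-- The coordinate jets in the chart `e` whose velocity lies in `U`. -/
def jetDomain (U : Set (TangentBundle 𝓘(ℝ, Model n) M)) (r : ℕ)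
    (e : OpenPartialHomeomorph M (Model n)) : Set (Fin (r + 2) → Model n) :=
  {j | j 0 ∈ e.target ∧ tangentVec e (j 0) (j 1) ∈ U}

/-- A smooth autonomous Lagrangian of order (at most) `r + 1` for curves in `M` with velocity in
`U`: a smooth function of the `(r+1)`-jet of the curve, given by its expressions in all charts. -/
structure Lagrangian (U : Set (TangentBundle 𝓘(ℝ, Model n) M)) (r : ℕ) where
  /-- The expression of the Lagrangian in the chart `e`. -/
  toFun : OpenPartialHomeomorph M (Model n) → (Fin (r + 2) → Model n) → ℝ
  smooth : ∀ e ∈ charts n M, ContDiffOn ℝ ∞ (toFun e) (jetDomain U r e)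
  compat : ∀ e ∈ charts n M, ∀ e' ∈ charts n M, ∀ (γ : ℝ → M) (t : ℝ),
    ContMDiffAt 𝓘(ℝ, ℝ) 𝓘(ℝ, Model n) ∞ γ t → γ t ∈ e.source → γ t ∈ e'.source →
    jet r (e ∘ γ) t ∈ jetDomain U r e →
    toFun e (jet r (e ∘ γ) t) = toFun e' (jet r (e' ∘ γ) t)

/-- The Euler-Lagrange expression `∑_k (-1)^k (d/dt)^k (∂L/∂x^{(k)})` of a Lagrangian
`L(x, x_t, …)` of order `r + 1` along the curve `c` at time `t`, evaluated on the vector `w`. -/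
def eulerLagrange {r : ℕ} (L : (Fin (r + 2) → Model n) → ℝ) (c : ℝ → Model n) (t : ℝ)
    (w : Model n) : ℝ :=
  ∑ k : Fin (r + 2),
    (-1) ^ (k : ℕ) * iteratedDeriv k (fun s => fderiv ℝ L (jet r c s) (Pi.single k w)) t

/-- The Euler-Lagrange equations of `L` form a system of second order equations: the
Euler-Lagrange expressions depend only on the 2-jet of the curve. Every Lagrangian of order one
has this property. -/
def Lagrangian.SecondOrder {U : Set (TangentBundle 𝓘(ℝ, Model n) M)} {r : ℕ}
    (L : Lagrangian U r) : Prop :=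
  ∀ e ∈ charts n M, ∀ (c c' : ℝ → Model n) (t : ℝ), ContDiffAt ℝ ∞ c t → ContDiffAt ℝ ∞ c' t →
    jet r c t ∈ jetDomain U r e → (∀ k ≤ 2, iteratedDeriv k c t = iteratedDeriv k c' t) →
    ∀ w, eulerLagrange (L.toFun e) c t w = eulerLagrange (L.toFun e) c' t w

/-- The projective structure `P` is variational: there is an autonomous Lagrangian, of some order
and defined for almost all velocities (on an open dense set `U` of nonzero tangent vectors),
with Euler-Lagrange equations of second order, whose extremals are precisely the paths of `P`
with arbitrary parametrization. -/
def ProjectiveStructure.IsVariational (P : ProjectiveStructure n M) : Prop :=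
  ∃ U : Set (TangentBundle 𝓘(ℝ, Model n) M), IsOpen U ∧ Dense U ∧ (∀ p ∈ U, p.2 ≠ 0) ∧
    ∃ (r : ℕ) (L : Lagrangian U r), L.SecondOrder ∧
      ∀ e ∈ charts n M, ∀ (a b : ℝ) (c : ℝ → Model n), a < b → ContDiffOn ℝ ∞ c (Ioo a b) →
        (∀ t ∈ Ioo a b, c t ∈ e.target ∧ tangentVec e (c t) (deriv c t) ∈ U) →
        ((∀ t ∈ Ioo a b, ∀ w, eulerLagrange (L.toFun e) c t w = 0) ↔
          ∀ t ∈ Ioo a b, P.PathEqAt e c t)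

end Lagrangians

/-! ### Metrizability -/

section Metrics

variable (n : ℕ) (M : Type*) [TopologicalSpace M] [ChartedSpace (Model n) M]
  [IsManifold 𝓘(ℝ, Model n) ∞ M]

/-- A smooth pseudo-Riemannian metric on `M`, of arbitrary signature. -/
structure PseudoRiemannianMetric where
  /-- The scalar product on the tangent spaces. -/
  val (p : M) : TangentSpace 𝓘(ℝ, Model n) p →L[ℝ] TangentSpace 𝓘(ℝ, Model n) p →L[ℝ] ℝ
  symm (p : M) (u v : TangentSpace 𝓘(ℝ, Model n) p) : val p u v = val p v u
  nondegenerate (p : M) (u : TangentSpace 𝓘(ℝ, Model n) p) (hu : ∀ v, val p u v = 0) : u = 0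
  contMDiff : ContMDiff 𝓘(ℝ, Model n)
    (𝓘(ℝ, Model n).prod 𝓘(ℝ, Model n →L[ℝ] Model n →L[ℝ] ℝ)) ∞
    (fun p : M => TotalSpace.mk' (Model n →L[ℝ] Model n →L[ℝ] ℝ)
      (E := fun p : M => TangentSpace 𝓘(ℝ, Model n) p →L[ℝ]
        TangentSpace 𝓘(ℝ, Model n) p →L[ℝ] ℝ) p (val p))

variable {n M}

/-- `D` is the Levi-Civita connection of `g`: it is torsion-free and `g` is parallel. -/
def AffineConnection.IsLeviCivita (D : AffineConnection n M)
    (g : PseudoRiemannianMetric n M) : Prop :=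
  D.cov.torsion = 0 ∧
  ∀ (p : M) (X Y : Π q : M, TangentSpace 𝓘(ℝ, Model n) q),
    MDifferentiableAt 𝓘(ℝ, Model n) (𝓘(ℝ, Model n).prod 𝓘(ℝ, Model n))
      (fun q => (⟨q, X q⟩ : TangentBundle 𝓘(ℝ, Model n) M)) p →
    MDifferentiableAt 𝓘(ℝ, Model n) (𝓘(ℝ, Model n).prod 𝓘(ℝ, Model n))
      (fun q => (⟨q, Y q⟩ : TangentBundle 𝓘(ℝ, Model n) M)) p →
    ∀ u : TangentSpace 𝓘(ℝ, Model n) p,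
      mvfderiv 𝓘(ℝ, Model n) (fun q => g.val q (X q) (Y q)) p u =
        g.val p (D.cov X p u) (Y p) + g.val p (X p) (D.cov Y p u)

/-- `P` is pseudo-Riemannian metrizable: its paths are the unparametrized geodesics of a
pseudo-Riemannian metric, that is, `P` is the class of a Levi-Civita connection. -/
def ProjectiveStructure.IsMetrizable (P : ProjectiveStructure n M) : Prop :=
  ∃ (g : PseudoRiemannianMetric n M) (D : AffineConnection n M), D.IsLeviCivita g ∧ D.proj = P

end Metrics

end ProjVar

end

noncomputable section

namespace ProjVar

/-! ### Directional derivatives and parametric iterated derivatives -/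

section Directional

variable {V F F' : Type*} [NormedAddCommGroup V] [NormedSpace ℝ V]
  [NormedAddCommGroup F] [NormedSpace ℝ F] [NormedAddCommGroup F'] [NormedSpace ℝ F']

theorem two_le_infty : (2 : WithTop ℕ∞) ≤ ∞ :=
  WithTop.coe_le_coe.2 (le_top : (2 : ℕ∞) ≤ ⊤)

/-- The derivative of `h` in the constant direction `d`. -/
def dDir (d : V) (h : V → F) (z : V) : F := fderiv ℝ h z d

theorem contDiffOn_fderiv_of_isOpen {h : V → F} {O : Set V} (hO : IsOpen O)
    (hh : ContDiffOn ℝ ∞ h O) : ContDiffOn ℝ ∞ (fderiv ℝ h) O :=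
  hh.fderiv_of_isOpen hO (by simp)

theorem contDiffOn_dDir {h : V → F} {O : Set V} (hO : IsOpen O)
    (hh : ContDiffOn ℝ ∞ h O) (d : V) : ContDiffOn ℝ ∞ (dDir d h) O :=
  (contDiffOn_fderiv_of_isOpen hO hh).clm_apply contDiffOn_const

theorem contDiffOn_dDir_iterate {h : V → F} {O : Set V} (hO : IsOpen O)
    (hh : ContDiffOn ℝ ∞ h O) (d : V) (k : ℕ) : ContDiffOn ℝ ∞ ((dDir d)^[k] h) O := by
  induction k with
  | zero => exact hh
  | succ k ih => rw [Function.iterate_succ_apply']; exact contDiffOn_dDir hO ih d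

theorem ContDiffOn.differentiableAt_of_isOpen {h : V → F} {O : Set V} (hO : IsOpen O)
    (hh : ContDiffOn ℝ ∞ h O) {z : V} (hz : z ∈ O) : DifferentiableAt ℝ h z :=
  (hh.contDiffAt (hO.mem_nhds hz)).differentiableAt (by simp)

theorem dDir_congr {h h' : V → F} {O : Set V} (hO : IsOpen O) (hh : EqOn h h' O) (d : V) :
    EqOn (dDir d h) (dDir d h') O := fun z hz => by
  have : h =ᶠ[𝓝 z] h' := hh.eventuallyEq_of_mem (hO.mem_nhds hz)
  simp only [dDir, this.fderiv_eq]

theorem dDir_comm {h : V → F} {O : Set V} (hO : IsOpen O) (hh : ContDiffOn ℝ ∞ h O) (d d' : V) :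
    EqOn (dDir d (dDir d' h)) (dDir d' (dDir d h)) O := fun z hz => by
  have hs := (hh.contDiffAt (hO.mem_nhds hz)).isSymmSndFDerivAt (by simpa using two_le_infty)
  have hd := ContDiffOn.differentiableAt_of_isOpen hO (contDiffOn_fderiv_of_isOpen hO hh) hz
  have key : ∀ a b : V, dDir a (dDir b h) z = fderiv ℝ (fderiv ℝ h) z a b := fun a b => by
    have : HasFDerivAt (dDir b h) ((fderiv ℝ (fderiv ℝ h) z).flip b) z := by
      have := hd.hasFDerivAt.clm_apply (hasFDerivAt_const b z)
      simpa [dDir] using! this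
    simp [dDir, this.fderiv]
  rw [key, key]
  exact hs.eq d d'

theorem dDir_iterate_comm {h : V → F} {O : Set V} (hO : IsOpen O) (hh : ContDiffOn ℝ ∞ h O)
    (d d' : V) (k : ℕ) : EqOn (dDir d ((dDir d')^[k] h)) ((dDir d')^[k] (dDir d h)) O := by
  induction k with
  | zero => intro z _; rfl
  | succ k ih =>
    rw [Function.iterate_succ_apply', Function.iterate_succ_apply']
    exact (dDir_comm hO (contDiffOn_dDir_iterate hO hh d' k) d d').trans (dDir_congr hO ih d')

/-- Iterated derivatives in the last variable are iterated directional derivatives. -/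
theorem iteratedDeriv_slice {h : V × ℝ → F} {O : Set (V × ℝ)} (hO : IsOpen O)
    (hh : ContDiffOn ℝ ∞ h O) (k : ℕ) {p : V} {t : ℝ} (hz : (p, t) ∈ O) :
    iteratedDeriv k (fun s => h (p, s)) t = (dDir ((0 : V), (1 : ℝ)))^[k] h (p, t) := by
  induction k generalizing t with
  | zero => simp
  | succ k ih =>
    rw [iteratedDeriv_succ, Function.iterate_succ_apply']
    have hev : iteratedDeriv k (fun s => h (p, s)) =ᶠ[𝓝 t]
        fun s => (dDir ((0 : V), (1 : ℝ)))^[k] h (p, s) := by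
      have : ∀ᶠ s in 𝓝 t, (p, s) ∈ O :=
        (Continuous.prodMk_right p).continuousAt.eventually (hO.mem_nhds hz)
      filter_upwards [this] with s hs using ih hs
    rw [hev.deriv_eq]
    have hd := ContDiffOn.differentiableAt_of_isOpen hO
      (contDiffOn_dDir_iterate hO hh ((0 : V), (1 : ℝ)) k) hz
    have h2 : HasDerivAt (fun s : ℝ => (p, s)) ((0 : V), (1 : ℝ)) t :=
      (hasDerivAt_const t p).prodMk (hasDerivAt_id t)
    exact (hd.hasFDerivAt.comp_hasDerivAt t h2).deriv

theorem iteratedDeriv_clm_apply_const {H : ℝ → F →L[ℝ] F'} {I : Set ℝ} (hI : IsOpen I)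
    (hH : ContDiffOn ℝ ∞ H I) (k : ℕ) (w : F) {t : ℝ} (ht : t ∈ I) :
    iteratedDeriv k (fun s => H s w) t = iteratedDeriv k H t w := by
  have h1 := (ContinuousLinearMap.apply ℝ F' w).iteratedFDeriv_comp_left
    (hH.contDiffAt (hI.mem_nhds ht)) (i := k) (by exact_mod_cast le_top)
  have h2 : (fun s => H s w) = (ContinuousLinearMap.apply ℝ F' w) ∘ H := by ext s; simp
  rw [iteratedDeriv_eq_iteratedFDeriv, h2, h1]
  simp [iteratedDeriv_eq_iteratedFDeriv]

theorem iteratedDeriv_congr_of_eventuallyEq {f g : ℝ → F} {t : ℝ} (h : f =ᶠ[𝓝 t] g) (k : ℕ) :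
    iteratedDeriv k f t = iteratedDeriv k g t :=
  (h.iteratedDeriv_eq k)

theorem contDiffOn_iteratedDeriv {f : ℝ → F} {I : Set ℝ} (hI : IsOpen I)
    (hf : ContDiffOn ℝ ∞ f I) (k : ℕ) : ContDiffOn ℝ ∞ (iteratedDeriv k f) I := by
  induction k with
  | zero => simpa using hf
  | succ k ih => rw [iteratedDeriv_succ]; exact ih.deriv_of_isOpen hI (by simp)

end Directional

/-! ### Second order jets -/

section Jets

variable {V : Type*} [NormedAddCommGroup V] [NormedSpace ℝ V]

/-- The cubic curve with 3-jet `p` at time `0`. -/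
def cubicCurve (p : V × V × V × V) (t : ℝ) : V :=
  p.1 + t • p.2.1 + (t ^ 2 / 2) • p.2.2.1 + (t ^ 3 / 6) • p.2.2.2

theorem contDiff_cubicCurve (p : V × V × V × V) :
    ContDiff ℝ ∞ (cubicCurve p) := by
  unfold cubicCurve; fun_prop

theorem deriv_cubicCurve (p : V × V × V × V) :
    deriv (cubicCurve p) = fun t => p.2.1 + t • p.2.2.1 + (t ^ 2 / 2) • p.2.2.2 := by
  funext t
  have h1 := (((hasDerivAt_const t p.1).add ((hasDerivAt_id t).smul_const p.2.1)).add
    ((((hasDerivAt_id t).pow 2).div_const 2).smul_const p.2.2.1)).add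
    ((((hasDerivAt_id t).pow 3).div_const 6).smul_const p.2.2.2)
  refine HasDerivAt.deriv (h1.congr_deriv ?_)
  simp only [id]
  module

theorem deriv_deriv_cubicCurve (p : V × V × V × V) :
    deriv (deriv (cubicCurve p)) = fun t => p.2.2.1 + t • p.2.2.2 := by
  rw [deriv_cubicCurve]
  funext t
  have h1 := ((hasDerivAt_const t p.2.1).add ((hasDerivAt_id t).smul_const p.2.2.1)).add
    ((((hasDerivAt_id t).pow 2).div_const 2).smul_const p.2.2.2)
  refine HasDerivAt.deriv (h1.congr_deriv ?_)
  simp only [id]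
  module

/-- The 2-jet of a curve. -/
def jet2 (c : ℝ → V) (t : ℝ) : V × V × V :=
  (c t, deriv c t, deriv (deriv c) t)

/-- The 2-jets whose position and velocity lie in `W`. -/
def jets2Over (W : Set (V × V)) : Set (V × V × V) :=
  {q | (q.1, q.2.1) ∈ W}

theorem isOpen_jets2Over {W : Set (V × V)} (hW : IsOpen W) :
    IsOpen (jets2Over W) :=
  hW.preimage (continuous_fst.prodMk (continuous_fst.comp continuous_snd))

theorem contDiffOn_jet2 {c : ℝ → V} {I : Set ℝ} (hI : IsOpen I)
    (hc : ContDiffOn ℝ ∞ c I) : ContDiffOn ℝ ∞ (jet2 c) I := by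
  have h1 : ContDiffOn ℝ ∞ (deriv c) I := hc.deriv_of_isOpen hI (by simp)
  have h2 : ContDiffOn ℝ ∞ (deriv (deriv c)) I := h1.deriv_of_isOpen hI (by simp)
  exact hc.prodMk (h1.prodMk h2)

theorem jet2_smul {α : ℝ → ℝ} (hα : ContDiff ℝ ∞ α) (u : V) (t : ℝ) :
    jet2 (fun s => α s • u) t = (α t • u, deriv α t • u, deriv (deriv α) t • u) := by
  have h1 : ∀ {f : ℝ → ℝ}, ContDiff ℝ ∞ f → deriv (fun s => f s • u) = fun s => deriv f s • u :=
    fun hf => funext fun s =>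
      (((hf.differentiable (by simp)) s).hasDerivAt.smul_const u).deriv
  have h2 : ContDiff ℝ ∞ (deriv α) := contDiffOn_univ.1 (by
      simpa [iteratedDeriv_one] using contDiffOn_iteratedDeriv isOpen_univ hα.contDiffOn 1)
  simp [jet2, h1 hα, h1 h2]

theorem hasDerivAt_jet2_cubicCurve (p : V × V × V × V) :
    HasDerivAt (jet2 (cubicCurve p)) (p.2.1, p.2.2.1, p.2.2.2) 0 := by
  have h1 : HasDerivAt (cubicCurve p) p.2.1 0 := by
    have := ((contDiff_cubicCurve p).differentiable (by simp) 0).hasDerivAt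
    simpa [deriv_cubicCurve] using this
  have h2 : HasDerivAt (deriv (cubicCurve p)) p.2.2.1 0 := by
    have h : Differentiable ℝ (deriv (cubicCurve p)) := by rw [deriv_cubicCurve]; fun_prop
    have := (h 0).hasDerivAt
    simpa [deriv_deriv_cubicCurve] using this
  have h3 : HasDerivAt (deriv (deriv (cubicCurve p))) p.2.2.2 0 := by
    rw [deriv_deriv_cubicCurve]
    simpa using ((hasDerivAt_id (0 : ℝ)).smul_const p.2.2.2).const_add p.2.2.1
  exact h1.prodMk (h2.prodMk h3)

theorem jet2_cubicCurve_zero (p : V × V × V × V) :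
    jet2 (cubicCurve p) 0 = (p.1, p.2.1, p.2.2.1) := by
  simp [jet2, deriv_deriv_cubicCurve]
  simp [cubicCurve, deriv_cubicCurve]

/-- The partial derivative in the direction `ξ` of a covector valued function of 2-jets, along a
curve. -/
def jetPartial (f : V × V × V → V →L[ℝ] ℝ) (c : ℝ → V) (ξ : V × V × V) (w : V) (t : ℝ) : ℝ :=
  fderiv ℝ f (jet2 c t) ξ w

/-- The Helmholtz conditions: along every curve with velocities in `W`, the linearization of `f` is
formally self-adjoint. -/
def SatisfiesHelmholtz (f : V × V × V → V →L[ℝ] ℝ) (W : Set (V × V)) : Prop :=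
  ∀ (c : ℝ → V) (I : Set ℝ), IsOpen I → ContDiffOn ℝ ∞ c I → (∀ t ∈ I, (c t, deriv c t) ∈ W) →
    ∀ (u w : V), ∀ t ∈ I,
      jetPartial f c (0, 0, u) w t = jetPartial f c (0, 0, w) u t ∧
      jetPartial f c (0, u, 0) w t =
        2 * deriv (jetPartial f c (0, 0, w) u) t - jetPartial f c (0, w, 0) u t ∧
      jetPartial f c (u, 0, 0) w t = deriv (deriv (jetPartial f c (0, 0, w) u)) t
        - deriv (jetPartial f c (0, w, 0) u) t + jetPartial f c (w, 0, 0) u t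

end Jets

/-! ### The Euler-Lagrange expressions as functions of the 2-jet -/

section EulerLagrange

variable {n : ℕ}

/-- The jets whose position and velocity lie in `W`. -/
def jetsOver (r : ℕ) (W : Set (Model n × Model n)) : Set (Fin (r + 2) → Model n) :=
  {j | (j 0, j 1) ∈ W}

theorem isOpen_jetsOver {r : ℕ} {W : Set (Model n × Model n)} (hW : IsOpen W) :
    IsOpen (jetsOver r W) :=
  hW.preimage ((continuous_apply 0).prodMk (continuous_apply 1))

/-- The Euler-Lagrange expression as a covector, for a curve in a family `(p, t) ↦ jet`. -/
def elCovector {r : ℕ} (L : (Fin (r + 2) → Model n) → ℝ) (j : ℝ → Fin (r + 2) → Model n) (t : ℝ) :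
    Model n →L[ℝ] ℝ :=
  ∑ k : Fin (r + 2), (-1 : ℝ) ^ (k : ℕ) • iteratedDeriv k
    (fun s => (fderiv ℝ L (j s)).comp (ContinuousLinearMap.single ℝ (fun _ => Model n) k)) t

theorem contDiffOn_jet {r : ℕ} {c : ℝ → Model n} {I : Set ℝ} (hI : IsOpen I)
    (hc : ContDiffOn ℝ ∞ c I) : ContDiffOn ℝ ∞ (jet r c) I :=
  contDiffOn_pi.2 fun k => contDiffOn_iteratedDeriv hI hc k

theorem jet_mem_jetsOver {r : ℕ} {c : ℝ → Model n} {t : ℝ} {W : Set (Model n × Model n)} :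
    jet r c t ∈ jetsOver r W ↔ (c t, deriv c t) ∈ W := by
  simp [jet, jetsOver, iteratedDeriv_one]

theorem contDiffOn_partialFDeriv {r : ℕ} {L : (Fin (r + 2) → Model n) → ℝ}
    {W : Set (Model n × Model n)} (hW : IsOpen W) (hL : ContDiffOn ℝ ∞ L (jetsOver r W))
    (k : Fin (r + 2)) : ContDiffOn ℝ ∞ (fun j => (fderiv ℝ L j).comp
      (ContinuousLinearMap.single ℝ (fun _ => Model n) k)) (jetsOver r W) :=
  (contDiffOn_fderiv_of_isOpen (isOpen_jetsOver hW) hL).clm_comp contDiffOn_const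

theorem elCovector_apply {r : ℕ} {L : (Fin (r + 2) → Model n) → ℝ}
    {W : Set (Model n × Model n)} (hW : IsOpen W) (hL : ContDiffOn ℝ ∞ L (jetsOver r W))
    {c : ℝ → Model n} {I : Set ℝ} (hI : IsOpen I) (hc : ContDiffOn ℝ ∞ c I)
    (hcW : ∀ t ∈ I, (c t, deriv c t) ∈ W) {t : ℝ} (ht : t ∈ I) (w : Model n) :
    elCovector L (jet r c) t w = eulerLagrange L c t w := by
  have hsm : ∀ k : Fin (r + 2), ContDiffOn ℝ ∞ (fun s => (fderiv ℝ L (jet r c s)).comp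
      (ContinuousLinearMap.single ℝ (fun _ => Model n) k)) I := fun k =>
    (contDiffOn_partialFDeriv hW hL k).comp (contDiffOn_jet hI hc)
      fun s hs => jet_mem_jetsOver.2 (hcW s hs)
  simp only [elCovector, eulerLagrange, sum_apply,
    smul_apply, smul_eq_mul]
  refine Finset.sum_congr rfl fun k _ => ?_
  rw [← iteratedDeriv_clm_apply_const hI (hsm k) k w ht]
  rfl

/-- The Euler-Lagrange expression of `L` as a function of 2-jets, computed along a polynomial
curve. -/
def elJet {r : ℕ} (L : (Fin (r + 2) → Model n) → ℝ) (q : Model n × Model n × Model n) :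
    Model n →L[ℝ] ℝ :=
  elCovector L (jet r (cubicCurve (q.1, q.2.1, q.2.2, 0))) 0

/-- The polynomial curves through all 2-jets form one jointly smooth family in `(q, t)`. Time
derivatives along the curves are then iterated directional derivatives in the last variable, which
are smooth in `q`. -/
theorem contDiffOn_elJet {r : ℕ} {L : (Fin (r + 2) → Model n) → ℝ}
    {W : Set (Model n × Model n)} (hW : IsOpen W) (hL : ContDiffOn ℝ ∞ L (jetsOver r W)) :
    ContDiffOn ℝ ∞ (elJet L) (jets2Over W) := by
  set γ : (Model n × Model n × Model n) × ℝ → Model n := fun z => cubicCurve (z.1.1, z.1.2.1, z.1.2.2, 0) z.2 with hγ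
  have hγs : ContDiff ℝ ∞ γ := by rw [hγ]; unfold cubicCurve; fun_prop
  set J : (Model n × Model n × Model n) × ℝ → Fin (r + 2) → Model n :=
    fun z => jet r (cubicCurve (z.1.1, z.1.2.1, z.1.2.2, 0)) z.2 with hJ
  have hJs : ContDiff ℝ ∞ J := by
    refine contDiff_pi.2 fun k => ?_
    have : (fun z => J z k) = (dDir ((0 : Model n × Model n × Model n), (1 : ℝ)))^[k] γ := by
      funext z
      exact iteratedDeriv_slice isOpen_univ hγs.contDiffOn k (mem_univ _)
    rw [this, ← contDiffOn_univ]
    exact contDiffOn_dDir_iterate isOpen_univ hγs.contDiffOn _ _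
  set O : Set ((Model n × Model n × Model n) × ℝ) := J ⁻¹' jetsOver r W
  have hO : IsOpen O := (isOpen_jetsOver hW).preimage hJs.continuous
  have hmem : ∀ q ∈ jets2Over W, (q, (0 : ℝ)) ∈ O := fun q hq => by
    show jet r _ _ ∈ jetsOver r W
    rw [jet_mem_jetsOver]
    simpa [cubicCurve, deriv_cubicCurve, jets2Over] using hq
  unfold elJet elCovector
  refine ContDiffOn.sum fun k _ => ContDiffOn.const_smul _ ?_
  set h : (Model n × Model n × Model n) × ℝ → Model n →L[ℝ] ℝ := fun z => (fderiv ℝ L (J z)).comp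
    (ContinuousLinearMap.single ℝ (fun _ => Model n) k)
  have hh : ContDiffOn ℝ ∞ h O :=
    (contDiffOn_partialFDeriv hW hL k).comp hJs.contDiffOn fun z hz => hz
  have : ContDiffOn ℝ ∞ (fun q : Model n × Model n × Model n => (dDir ((0 : Model n × Model n × Model n), (1 : ℝ)))^[k] h (q, 0)) (jets2Over W) :=
    (contDiffOn_dDir_iterate hO hh _ _).comp (contDiff_prodMk_left _).contDiffOn hmem
  exact this.congr fun q hq => iteratedDeriv_slice hO hh k (hmem q hq)

/-- `L` has Euler-Lagrange equations of second order over `W`. -/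
def SecondOrderOver {r : ℕ} (L : (Fin (r + 2) → Model n) → ℝ) (W : Set (Model n × Model n)) :
    Prop :=
  ∀ (c c' : ℝ → Model n) (t : ℝ), ContDiffAt ℝ ∞ c t → ContDiffAt ℝ ∞ c' t →
    (c t, deriv c t) ∈ W → (∀ k ≤ 2, iteratedDeriv k c t = iteratedDeriv k c' t) →
    ∀ w, eulerLagrange L c t w = eulerLagrange L c' t w

/-- This is invariance under time translation, valid because the Lagrangian is autonomous. -/
theorem eulerLagrange_comp_add {r : ℕ} (L : (Fin (r + 2) → Model n) → ℝ) (c : ℝ → Model n)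
    (t : ℝ) (w : Model n) :
    eulerLagrange L (fun s => c (s + t)) 0 w = eulerLagrange L c t w := by
  have hj : ∀ s, jet r (fun s => c (s + t)) s = jet r c (s + t) := fun s => by
    funext k; simp [jet, iteratedDeriv_comp_add_const]
  simp only [eulerLagrange, hj]
  refine Finset.sum_congr rfl fun k _ => ?_
  rw [iteratedDeriv_comp_add_const (f := fun s => fderiv ℝ L (jet r c s) (Pi.single k w))]
  simp

/-- A curve may be replaced by its quadratic Taylor polynomial at `t`, since the Euler-Lagrange
expressions see only the 2-jet. -/
theorem elJet_jet2 {r : ℕ} {L : (Fin (r + 2) → Model n) → ℝ}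
    {W : Set (Model n × Model n)} (hW : IsOpen W) (hL : ContDiffOn ℝ ∞ L (jetsOver r W))
    (h2 : SecondOrderOver L W) {c : ℝ → Model n} {t : ℝ} (hc : ContDiffAt ℝ ∞ c t)
    (hcW : (c t, deriv c t) ∈ W) (w : Model n) :
    elJet L (jet2 c t) w = eulerLagrange L c t w := by
  set p : Model n × Model n × Model n × Model n := (c t, deriv c t, deriv (deriv c) t, 0) with hp
  have hcont : Continuous fun s => (cubicCurve p s, deriv (cubicCurve p) s) := by
    rw [deriv_cubicCurve]; unfold cubicCurve; fun_prop
  have h0 : (cubicCurve p 0, deriv (cubicCurve p) 0) = (c t, deriv c t) := by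
    simp [cubicCurve, deriv_cubicCurve, hp]
  have e1 : elJet L (jet2 c t) w = eulerLagrange L (cubicCurve p) 0 w :=
    elCovector_apply hW hL (hW.preimage hcont) (contDiff_cubicCurve p).contDiffOn (fun s hs => hs)
      (by rw [mem_preimage, h0]; exact hcW) w
  rw [e1, ← eulerLagrange_comp_add L c t]
  have hk : ∀ k ≤ 2, iteratedDeriv k (cubicCurve p) 0
      = iteratedDeriv k (fun s => c (s + t)) 0 := fun k hk => by
    rw [iteratedDeriv_comp_add_const]
    interval_cases k
    · simp [cubicCurve, hp]
    · simp [iteratedDeriv_one, deriv_cubicCurve, hp]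
    · simp [iteratedDeriv_succ, iteratedDeriv_zero, deriv_deriv_cubicCurve, hp]
  refine h2 _ _ 0 (contDiff_cubicCurve p).contDiffAt ?_ (by rw [h0]; exact hcW) hk w
  have : ContDiffAt ℝ ∞ c ((fun s : ℝ => s + t) 0) := by simpa using hc
  exact this.comp (0 : ℝ) (by fun_prop)

end EulerLagrange

/-! ### The linearized Euler-Lagrange operator is formally self-adjoint -/

section SelfAdjoint

variable {n : ℕ}

theorem iteratedDeriv_add_smul {c φ : ℝ → Model n} {I : Set ℝ} (hI : IsOpen I)
    (hc : ContDiffOn ℝ ∞ c I) (hφ : ContDiff ℝ ∞ φ) (σ : ℝ) (k : ℕ) {t : ℝ} (ht : t ∈ I) :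
    iteratedDeriv k (fun s => c s + σ • φ s) t
      = iteratedDeriv k c t + σ • iteratedDeriv k φ t := by
  have h1 : ContDiffAt ℝ k c t :=
    (hc.contDiffAt (hI.mem_nhds ht)).of_le (by exact_mod_cast le_top)
  have h2 : ContDiffAt ℝ k φ t := hφ.contDiffAt.of_le (by exact_mod_cast le_top)
  have h3 : ContDiffAt ℝ k (fun s => σ • φ s) t := h2.const_smul σ
  rw [iteratedDeriv_fun_add h1 h3, iteratedDeriv_fun_const_smul h2 σ]

theorem hasDerivAt_apply_const {V F : Type*} [NormedAddCommGroup V] [NormedSpace ℝ V]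
    [NormedAddCommGroup F] [NormedSpace ℝ F] {f : ℝ → V →L[ℝ] F} {f' : V →L[ℝ] F} {t : ℝ}
    (h : HasDerivAt f f' t) (w : V) : HasDerivAt (fun s => f s w) (f' w) t :=
  (ContinuousLinearMap.apply ℝ F w).hasFDerivAt.comp_hasDerivAt t h

theorem jet2_add_smul {c φ : ℝ → Model n} {I : Set ℝ} (hI : IsOpen I)
    (hc : ContDiffOn ℝ ∞ c I) (hφ : ContDiff ℝ ∞ φ) (σ : ℝ) {t : ℝ} (ht : t ∈ I) :
    jet2 (fun s => c s + σ • φ s) t = jet2 c t + σ • jet2 φ t := by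
  have h := fun k => iteratedDeriv_add_smul hI hc hφ σ k ht
  have h1 := h 1
  have h2 := h 2
  simp only [iteratedDeriv_one] at h1
  simp only [iteratedDeriv_succ, iteratedDeriv_zero] at h2
  simp [jet2, h1, h2]

/-- The linearization of the Euler-Lagrange operator in terms of the Hessian of the Lagrangian. -/
theorem fderiv_elJet_jet2 {r : ℕ} {L : (Fin (r + 2) → Model n) → ℝ}
    {W : Set (Model n × Model n)} (hW : IsOpen W) (hL : ContDiffOn ℝ ∞ L (jetsOver r W))
    (h2 : SecondOrderOver L W) {c φ : ℝ → Model n} {I : Set ℝ} (hI : IsOpen I)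
    (hc : ContDiffOn ℝ ∞ c I) (hcW : ∀ t ∈ I, (c t, deriv c t) ∈ W) (hφ : ContDiff ℝ ∞ φ)
    {t : ℝ} (ht : t ∈ I) (w : Model n) :
    fderiv ℝ (elJet L) (jet2 c t) (jet2 φ t) w = ∑ k : Fin (r + 2), (-1) ^ (k : ℕ) *
      iteratedDeriv k (fun s => fderiv ℝ (fderiv ℝ L) (jet r c s) (jet r φ s) (Pi.single k w)) t := by
  -- `J (σ, s)` is the jet at time `s` of the varied curve `c + σ φ`. The claim comes from
  -- differentiating the Euler-Lagrange expression of this curve at `σ = 0`.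
  set J : ℝ × ℝ → Fin (r + 2) → Model n := fun z => jet r c z.2 + z.1 • jet r φ z.2 with hJdef
  have hJ : ContDiffOn ℝ ∞ J (univ ×ˢ I) := by
    have e1 : ContDiffOn ℝ ∞ (fun z : ℝ × ℝ => jet r c z.2) (univ ×ˢ I) :=
      (contDiffOn_jet hI hc).comp contDiff_snd.contDiffOn fun z hz => hz.2
    have e2 : ContDiffOn ℝ ∞ (fun z : ℝ × ℝ => jet r φ z.2) (univ ×ˢ I) :=
      (contDiffOn_jet isOpen_univ hφ.contDiffOn).comp contDiff_snd.contDiffOn fun z _ => mem_univ _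
    exact e1.add (contDiff_fst.contDiffOn.smul e2)
  set O : Set (ℝ × ℝ) := (univ ×ˢ I) ∩ J ⁻¹' jetsOver r W
  have hO : IsOpen O := hJ.continuousOn.isOpen_inter_preimage (isOpen_univ.prod hI)
    (isOpen_jetsOver hW)
  have hmem : ∀ s ∈ I, ((0 : ℝ), s) ∈ O := fun s hs =>
    ⟨⟨mem_univ _, hs⟩, by
      show J (0, s) ∈ jetsOver r W
      simpa [hJdef] using jet_mem_jetsOver.2 (hcW s hs)⟩
  set h : Fin (r + 2) → ℝ × ℝ → ℝ := fun k z => fderiv ℝ L (J z) (Pi.single k w) with hh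
  have hL' := contDiffOn_fderiv_of_isOpen (isOpen_jetsOver hW) hL
  have hhs : ∀ k, ContDiffOn ℝ ∞ (h k) O := fun k =>
    (hL'.comp (hJ.mono inter_subset_left) fun z hz => hz.2).clm_apply contDiffOn_const
  have hjet : ∀ (σ s : ℝ), s ∈ I → jet r (fun s => c s + σ • φ s) s = J (σ, s) := fun σ s hs => by
    funext k
    exact iteratedDeriv_add_smul hI hc hφ σ k hs
  have hev : ∀ᶠ σ in 𝓝 (0 : ℝ), elJet L (jet2 c t + σ • jet2 φ t) w
      = ∑ k : Fin (r + 2), (-1) ^ (k : ℕ) * (dDir ((0 : ℝ), (1 : ℝ)))^[k] (h k) (σ, t) := by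
    have : ∀ᶠ σ in 𝓝 (0 : ℝ), (σ, t) ∈ O :=
      (Continuous.prodMk_left t).continuousAt.eventually (hO.mem_nhds (hmem t ht))
    filter_upwards [this] with σ hσ
    have hcσ : ContDiffOn ℝ ∞ (fun s => c s + σ • φ s) I :=
      hc.add ((hφ.const_smul σ).contDiffOn)
    rw [← jet2_add_smul hI hc hφ σ ht, elJet_jet2 hW hL h2 (hcσ.contDiffAt (hI.mem_nhds ht))]
    · unfold eulerLagrange
      refine Finset.sum_congr rfl fun k _ => ?_
      rw [← iteratedDeriv_slice hO (hhs k) k hσ]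
      congr 1
      refine iteratedDeriv_congr_of_eventuallyEq ?_ k
      filter_upwards [hI.mem_nhds ht] with s hs
      rw [hjet σ s hs]
    · refine (jet_mem_jetsOver (r := r) (c := fun s => c s + σ • φ s)).1 ?_
      rw [hjet σ t ht]
      exact hσ.2
  have hjet2 : jet2 c t ∈ jets2Over W := hcW t ht
  have hd1 : HasDerivAt (fun σ : ℝ => elJet L (jet2 c t + σ • jet2 φ t) w)
      (fderiv ℝ (elJet L) (jet2 c t) (jet2 φ t) w) 0 := by
    have hd := ContDiffOn.differentiableAt_of_isOpen (isOpen_jets2Over hW)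
      (contDiffOn_elJet hW hL) hjet2
    exact hasDerivAt_apply_const (hd.hasFDerivAt.hasLineDerivAt (jet2 φ t)) w
  have hd2 : HasDerivAt (fun σ : ℝ => ∑ k : Fin (r + 2), (-1) ^ (k : ℕ) *
      (dDir ((0 : ℝ), (1 : ℝ)))^[k] (h k) (σ, t))
      (∑ k : Fin (r + 2), (-1) ^ (k : ℕ) *
        dDir ((1 : ℝ), (0 : ℝ)) ((dDir ((0 : ℝ), (1 : ℝ)))^[k] (h k)) (0, t)) 0 := by
    refine HasDerivAt.fun_sum fun k _ => HasDerivAt.const_mul _ ?_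
    have hd := ContDiffOn.differentiableAt_of_isOpen hO
      (contDiffOn_dDir_iterate hO (hhs k) ((0 : ℝ), (1 : ℝ)) k) (hmem t ht)
    have hl : HasDerivAt (fun σ : ℝ => (σ, t)) ((1 : ℝ), (0 : ℝ)) 0 :=
      (hasDerivAt_id (0 : ℝ)).prodMk (hasDerivAt_const _ t)
    exact hd.hasFDerivAt.comp_hasDerivAt (0 : ℝ) hl
  rw [hd1.unique (hd2.congr_of_eventuallyEq hev)]
  refine Finset.sum_congr rfl fun k _ => ?_
  -- The variation derivative in `σ` is moved inside the `k` time derivatives, where it turns the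
  -- gradient of `L` into its Hessian.
  rw [dDir_iterate_comm hO (hhs k) _ _ k (hmem t ht),
    ← iteratedDeriv_slice hO (contDiffOn_dDir hO (hhs k) _) k (hmem t ht)]
  congr 1
  refine iteratedDeriv_congr_of_eventuallyEq ?_ k
  filter_upwards [hI.mem_nhds ht] with s hs
  have hjs : jet r c s ∈ jetsOver r W := jet_mem_jetsOver.2 (hcW s hs)
  have hd := ContDiffOn.differentiableAt_of_isOpen (isOpen_jetsOver hW) hL' hjs
  have e1 : HasDerivAt (fun σ : ℝ => h k (σ, s))
      (fderiv ℝ (fderiv ℝ L) (jet r c s) (jet r φ s) (Pi.single k w)) 0 :=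
    hasDerivAt_apply_const (hd.hasFDerivAt.hasLineDerivAt (jet r φ s)) (Pi.single k w)
  have hdh := ContDiffOn.differentiableAt_of_isOpen hO (hhs k) (hmem s hs)
  have hl2 : HasDerivAt (fun σ : ℝ => (σ, s)) ((1 : ℝ), (0 : ℝ)) 0 :=
    (hasDerivAt_id (0 : ℝ)).prodMk (hasDerivAt_const _ s)
  have e2 := hdh.hasFDerivAt.comp_hasDerivAt (0 : ℝ) hl2
  exact e2.unique e1

theorem integral_iteratedDeriv_mul {f β : ℝ → ℝ} (hf : ContDiff ℝ ∞ f) (hfc : HasCompactSupport f)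
    (hβ : ContDiff ℝ ∞ β) (k : ℕ) :
    ∫ t, iteratedDeriv k f t * β t = (-1) ^ k * ∫ t, f t * iteratedDeriv k β t := by
  have hcs : ∀ k, HasCompactSupport (iteratedDeriv k f) := fun k => by
    induction k with
    | zero => simpa using hfc
    | succ k ih => rw [iteratedDeriv_succ]; exact ih.deriv
  have hsm : ∀ {g : ℝ → ℝ}, ContDiff ℝ ∞ g → ∀ k, ContDiff ℝ ∞ (iteratedDeriv k g) :=
    fun hg k => contDiffOn_univ.1 (contDiffOn_iteratedDeriv isOpen_univ hg.contDiffOn k)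
  have hint : ∀ {g b : ℝ → ℝ}, ContDiff ℝ ∞ g → HasCompactSupport g → ContDiff ℝ ∞ b →
      MeasureTheory.Integrable (g * b) := fun hg hgc hb =>
    (hg.continuous.mul hb.continuous).integrable_of_hasCompactSupport hgc.mul_right
  have hder : ∀ {g : ℝ → ℝ}, ContDiff ℝ ∞ g → ∀ k t,
      HasDerivAt (iteratedDeriv k g) (iteratedDeriv (k + 1) g t) t := fun hg k t => by
    rw [iteratedDeriv_succ]
    exact ((hsm hg k).differentiable (by simp)).differentiableAt.hasDerivAt
  induction k generalizing β with
  | zero => simp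
  | succ k ih =>
    have h1 := MeasureTheory.integral_mul_deriv_eq_deriv_mul_of_integrable
      (u := iteratedDeriv k f) (v := β) (u' := iteratedDeriv (k + 1) f)
      (v' := iteratedDeriv 1 β) (fun t _ => hder hf k t) (fun t _ => by simpa using hder hβ 0 t)
      (hint (hsm hf k) (hcs k) (hsm hβ 1)) (hint (hsm hf (k + 1)) (hcs (k + 1)) hβ)
      (hint (hsm hf k) (hcs k) hβ)
    have h2 := ih (hsm hβ 1)
    have h3 : ∀ t, iteratedDeriv k (iteratedDeriv 1 β) t = iteratedDeriv (k + 1) β t := fun t => by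
      simp only [iteratedDeriv_one, ← iteratedDeriv_succ']
    simp only [h3] at h2
    rw [h2] at h1
    rw [pow_succ]
    linarith

theorem eventually_jet_smul_eq_zero {r : ℕ} {α : ℝ → ℝ} {t : ℝ} (ht : t ∉ tsupport α) (u : Model n) :
    ∀ᶠ s in 𝓝 t, jet r (fun s => α s • u) s = 0 := by
  have h0 : α =ᶠ[𝓝 t] 0 := notMem_tsupport_iff_eventuallyEq.1 ht
  filter_upwards [h0.eventuallyEq_nhds] with s hs
  funext k
  have : (fun s => α s • u) =ᶠ[𝓝 s] fun _ => (0 : Model n) := by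
    filter_upwards [hs] with x hx; simp [hx]
  show iteratedDeriv _ _ _ = _
  rw [iteratedDeriv_congr_of_eventuallyEq this]
  simp

theorem jet_smul_apply {r : ℕ} {α : ℝ → ℝ} (hα : ContDiff ℝ ∞ α) (u : Model n) (t : ℝ) :
    jet r (fun s => α s • u) t = ∑ k : Fin (r + 2), Pi.single k (iteratedDeriv k α t • u) := by
  have : ∀ k : ℕ, iteratedDeriv k (fun s => α s • u) t = iteratedDeriv k α t • u := fun k => by
    have h2 : (fun s => α s • u) = ((ContinuousLinearMap.id ℝ ℝ).smulRight u) ∘ α := by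
      ext s; simp
    rw [iteratedDeriv_eq_iteratedFDeriv, h2, ContinuousLinearMap.iteratedFDeriv_comp_left _
      hα.contDiffAt (i := k) (by exact_mod_cast le_top)]
    simp [iteratedDeriv_eq_iteratedFDeriv]
  rw [Finset.univ_sum_single]
  funext k
  exact this k

/-- Formal self-adjointness of the linearized Euler-Lagrange operator along a curve. -/
theorem integral_fderiv_elJet_symm {r : ℕ} {L : (Fin (r + 2) → Model n) → ℝ}
    {W : Set (Model n × Model n)} (hW : IsOpen W) (hL : ContDiffOn ℝ ∞ L (jetsOver r W))
    (h2 : SecondOrderOver L W) {c : ℝ → Model n} {I : Set ℝ} (hI : IsOpen I)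
    (hc : ContDiffOn ℝ ∞ c I) (hcW : ∀ t ∈ I, (c t, deriv c t) ∈ W) {α β : ℝ → ℝ}
    (hα : ContDiff ℝ ∞ α) (hαc : HasCompactSupport α) (hαI : tsupport α ⊆ I)
    (hβ : ContDiff ℝ ∞ β) (hβc : HasCompactSupport β) (hβI : tsupport β ⊆ I) (u w : Model n) :
    ∫ t, fderiv ℝ (elJet L) (jet2 c t) (jet2 (fun s => α s • u) t) w * β t =
      ∫ t, fderiv ℝ (elJet L) (jet2 c t) (jet2 (fun s => β s • w) t) u * α t := by
  -- Integrating the `k`-th term by parts `k` times moves the time derivatives onto `β` and cancels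
  -- the sign `(-1)^k`. What remains is the integral of the Hessian of `L` on the jets of `α u` and
  -- `β w`, which is symmetric.
  have key : ∀ {α β : ℝ → ℝ}, ContDiff ℝ ∞ α → HasCompactSupport α → tsupport α ⊆ I →
      ContDiff ℝ ∞ β → tsupport β ⊆ I → ∀ u w : Model n,
      ∫ t, fderiv ℝ (elJet L) (jet2 c t) (jet2 (fun s => α s • u) t) w * β t =
      ∫ t, fderiv ℝ (fderiv ℝ L) (jet r c t) (jet r (fun s => α s • u) t)
        (jet r (fun s => β s • w) t) := by
    clear hα hαc hαI hβ hβc hβI u w α β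
    intro α β hα hαc hαI hβ hβI u w
    set m : Fin (r + 2) → ℝ → ℝ := fun k t =>
      fderiv ℝ (fderiv ℝ L) (jet r c t) (jet r (fun s => α s • u) t) (Pi.single k w) with hm
    have hφ : ContDiff ℝ ∞ fun s => α s • u := hα.smul contDiff_const
    have hms : ∀ k, ContDiff ℝ ∞ (m k) := fun k => by
      refine contDiff_iff_contDiffAt.2 fun t => ?_
      by_cases ht : t ∈ tsupport α
      · have hL'' := contDiffOn_fderiv_of_isOpen (isOpen_jetsOver hW)
          (contDiffOn_fderiv_of_isOpen (isOpen_jetsOver hW) hL)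
        have e1 := hL''.comp (contDiffOn_jet hI hc) fun s hs => jet_mem_jetsOver.2 (hcW s hs)
        have e2 := (contDiffOn_jet (r := r) isOpen_univ hφ.contDiffOn).mono (subset_univ I)
        exact ((e1.clm_apply e2).clm_apply contDiffOn_const).contDiffAt (hI.mem_nhds (hαI ht))
      · refine (contDiffAt_const (c := (0 : ℝ))).congr_of_eventuallyEq ?_
        filter_upwards [eventually_jet_smul_eq_zero (r := r) ht u] with s hs
        simp [hm, hs]
    have hmc : ∀ k, HasCompactSupport (m k) := fun k => by
      refine HasCompactSupport.intro hαc fun t ht => ?_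
      have := (eventually_jet_smul_eq_zero (r := r) ht u).self_of_nhds
      simp [hm, this]
    have hint : ∀ k : Fin (r + 2), MeasureTheory.Integrable
        (fun t => iteratedDeriv k (m k) t * β t) := fun k => by
      have hs := contDiffOn_univ.1 (contDiffOn_iteratedDeriv isOpen_univ (hms k).contDiffOn k)
      have hcs : HasCompactSupport (iteratedDeriv k (m k)) := by
        generalize (k : ℕ) = i
        induction i with
        | zero => simpa using hmc k
        | succ i ih => rw [iteratedDeriv_succ]; exact ih.deriv
      exact (hs.continuous.mul hβ.continuous).integrable_of_hasCompactSupport hcs.mul_right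
    have hint2 : ∀ k : Fin (r + 2), MeasureTheory.Integrable
        (fun t => m k t * iteratedDeriv k β t) := fun k => by
      have hs := contDiffOn_univ.1 (contDiffOn_iteratedDeriv isOpen_univ hβ.contDiffOn k)
      exact ((hms k).continuous.mul hs.continuous).integrable_of_hasCompactSupport
        (hmc k).mul_right
    calc ∫ t, fderiv ℝ (elJet L) (jet2 c t) (jet2 (fun s => α s • u) t) w * β t
        = ∫ t, ∑ k : Fin (r + 2), (-1) ^ (k : ℕ) * (iteratedDeriv k (m k) t * β t) := by
          refine MeasureTheory.integral_congr_ae (Filter.Eventually.of_forall fun t => ?_)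
          by_cases ht : t ∈ tsupport β
          · simp only [fderiv_elJet_jet2 hW hL h2 hI hc hcW hφ (hβI ht) w, Finset.sum_mul, hm,
              mul_assoc]
          · simp [image_eq_zero_of_notMem_tsupport ht]
      _ = ∑ k : Fin (r + 2), ∫ t, m k t * iteratedDeriv k β t := by
          rw [MeasureTheory.integral_finsetSum _ fun k _ => (hint k).const_mul _]
          refine Finset.sum_congr rfl fun k _ => ?_
          rw [MeasureTheory.integral_const_mul, integral_iteratedDeriv_mul (hms k) (hmc k) hβ,
            ← mul_assoc, ← mul_pow]
          simp
      _ = _ := by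
          rw [← MeasureTheory.integral_finsetSum _ fun k _ => hint2 k]
          refine MeasureTheory.integral_congr_ae (Filter.Eventually.of_forall fun t => ?_)
          simp only [hm]
          conv_rhs => rw [jet_smul_apply hβ w t, map_sum]
          refine Finset.sum_congr rfl fun k _ => ?_
          rw [Pi.single_smul, map_smul, smul_eq_mul, mul_comm]
  rw [key hα hαc hαI hβ hβI u w, key hβ hβc hβI hα hαI w u]
  refine MeasureTheory.integral_congr_ae (Filter.Eventually.of_forall fun t => ?_)
  by_cases ht : t ∈ tsupport α
  · have hj : jet r c t ∈ jetsOver r W := jet_mem_jetsOver.2 (hcW t (hαI ht))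
    exact ((hL.contDiffAt ((isOpen_jetsOver hW).mem_nhds hj)).isSymmSndFDerivAt
      (by simpa using two_le_infty)).eq _ _
  · have := (eventually_jet_smul_eq_zero (r := r) ht u).self_of_nhds
    simp [this]

end SelfAdjoint

/-! ### The Helmholtz conditions along a curve -/

section Helmholtz

theorem deriv_deriv_mul {f g : ℝ → ℝ} {t : ℝ} (hf : ContDiffAt ℝ ∞ f t) (hg : ContDiffAt ℝ ∞ g t) :
    deriv (deriv fun s => f s * g s) t =
      deriv (deriv f) t * g t + 2 * (deriv f t * deriv g t) + f t * deriv (deriv g) t := by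
  have hev : ∀ {f : ℝ → ℝ}, ContDiffAt ℝ ∞ f t → ∀ᶠ s in 𝓝 t, ContDiffAt ℝ 2 f s := fun hf =>
    (hf.of_le two_le_infty).eventually (by simp)
  have h1 : ∀ {f : ℝ → ℝ} {s : ℝ}, ContDiffAt ℝ 2 f s → DifferentiableAt ℝ f s := fun h =>
    h.differentiableAt (by simp)
  have h2 : ∀ {f : ℝ → ℝ}, ContDiffAt ℝ ∞ f t → DifferentiableAt ℝ (deriv f) t := fun {f} hf => by
    have hx : ContDiffAt ℝ ∞ (fderiv ℝ f) t := hf.fderiv_right (m := ∞) (by simp)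
    exact (hx.differentiableAt (by simp)).clm_apply (differentiableAt_const 1)
  have e : deriv (fun s => f s * g s) =ᶠ[𝓝 t] fun s => deriv f s * g s + f s * deriv g s := by
    filter_upwards [hev hf, hev hg] with s hs hs'
    exact deriv_fun_mul (h1 hs) (h1 hs')
  have hf1 : DifferentiableAt ℝ f t := hf.differentiableAt (by simp)
  have hg1 : DifferentiableAt ℝ g t := hg.differentiableAt (by simp)
  rw [e.deriv_eq]
  refine HasDerivAt.deriv ((((h2 hf).hasDerivAt.mul hg1.hasDerivAt).add
    (hf1.hasDerivAt.mul (h2 hg).hasDerivAt)).congr_deriv ?_)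
  ring

/-- These test functions realize the monomials at `t`, so that the coefficients of a differential
operator can be read off one at a time. -/
theorem exists_bump_mul_pow {I : Set ℝ} (hI : IsOpen I) {t : ℝ} (ht : t ∈ I) (i : ℕ) :
    ∃ α : ℝ → ℝ, ContDiff ℝ ∞ α ∧ HasCompactSupport α ∧ tsupport α ⊆ I ∧
      α =ᶠ[𝓝 t] fun s => (s - t) ^ i := by
  obtain ⟨δ, hδ, hball⟩ := Metric.nhds_basis_closedBall.mem_iff.1 (hI.mem_nhds ht)
  let b : ContDiffBump t := ⟨δ / 2, δ, half_pos hδ, half_lt_self hδ⟩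
  refine ⟨fun s => b s * (s - t) ^ i, b.contDiff.mul (by fun_prop), b.hasCompactSupport.mul_right,
    ((tsupport_mul_subset_left).trans (b.tsupport_eq.subset)).trans hball, ?_⟩
  filter_upwards [b.eventuallyEq_one] with s hs
  simp [hs]

/-- If a second order operator and another one are formally adjoint to each other, their
coefficients are related by the formula for the adjoint. -/
theorem coeff_eq_of_formal_adjoint {I : Set ℝ} (hI : IsOpen I) {a b c a' b' c' : ℝ → ℝ}
    (ha : ContDiffOn ℝ ∞ a I) (hb : ContDiffOn ℝ ∞ b I) (hc : ContDiffOn ℝ ∞ c I)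
    (ha' : ContDiffOn ℝ ∞ a' I) (hb' : ContDiffOn ℝ ∞ b' I) (hc' : ContDiffOn ℝ ∞ c' I)
    (h : ∀ α β : ℝ → ℝ, ContDiff ℝ ∞ α → HasCompactSupport α → tsupport α ⊆ I →
      ContDiff ℝ ∞ β → HasCompactSupport β → tsupport β ⊆ I →
      ∫ t, (a t * deriv (deriv α) t + b t * deriv α t + c t * α t) * β t =
        ∫ t, (a' t * deriv (deriv β) t + b' t * deriv β t + c' t * β t) * α t)
    {t : ℝ} (ht : t ∈ I) :
    a t = a' t ∧ b t = 2 * deriv a' t - b' t ∧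
      c t = deriv (deriv a') t - deriv b' t + c' t := by
  have hmul : ∀ {f α : ℝ → ℝ}, ContDiffOn ℝ ∞ f I → ContDiff ℝ ∞ α → tsupport α ⊆ I →
      ContDiff ℝ ∞ fun s => f s * α s := fun {f α} hf hα hs => by
    refine contDiff_iff_contDiffAt.2 fun s => ?_
    by_cases hsI : s ∈ tsupport α
    · exact (hf.contDiffAt (hI.mem_nhds (hs hsI))).mul hα.contDiffAt
    · refine (contDiffAt_const (c := (0 : ℝ))).congr_of_eventuallyEq ?_
      filter_upwards [notMem_tsupport_iff_eventuallyEq.1 hsI] with x hx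
      simp [hx]
  have hder : ∀ {α : ℝ → ℝ}, ContDiff ℝ ∞ α → ContDiff ℝ ∞ (deriv α) := fun hα =>
    contDiffOn_univ.1 (by
      simpa [iteratedDeriv_one] using contDiffOn_iteratedDeriv isOpen_univ hα.contDiffOn 1)
  have hts : ∀ {α : ℝ → ℝ}, tsupport α ⊆ I → tsupport (deriv α) ⊆ I := fun hα =>
    (closure_minimal support_deriv_subset isClosed_closure).trans hα
  have hcm : ∀ {f α : ℝ → ℝ}, HasCompactSupport α → HasCompactSupport fun s => f s * α s :=
    fun hα => hα.mul_left
  have key : ∀ α : ℝ → ℝ, ContDiff ℝ ∞ α → HasCompactSupport α → tsupport α ⊆ I →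
      (a t - a' t) * deriv (deriv α) t + (b t - 2 * deriv a' t + b' t) * deriv α t +
        (c t - deriv (deriv a') t + deriv b' t - c' t) * α t = 0 := by
    intro α hα hαc hαI
    -- `R` is the first operator applied to `α` minus the formal adjoint of the second one applied
    -- to `α`. By the fundamental lemma of the calculus of variations and continuity it vanishes on
    -- `I`.
    set R : ℝ → ℝ := fun s => a s * deriv (deriv α) s + b s * deriv α s + c s * α s
      - deriv (deriv fun x => a' x * α x) s + deriv (fun x => b' x * α x) s - c' s * α s with hR
    have hfa := hmul ha' hα hαI
    have hfb := hmul hb' hα hαI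
    have s1 := hmul ha (hder (hder hα)) (hts (hts hαI))
    have s2 := hmul hb (hder hα) (hts hαI)
    have s3 := hmul hc hα hαI
    have s4 := hder (hder hfa)
    have s5 := hder hfb
    have s6 := hmul hc' hα hαI
    have hRs : ContDiff ℝ ∞ R := ((((s1.add s2).add s3).sub s4).add s5).sub s6
    have hzero : ∀ β : ℝ → ℝ, ContDiff ℝ ∞ β → HasCompactSupport β → tsupport β ⊆ I →
        ∫ s, β s • R s = 0 := by
      intro β hβ hβc hβI
      have hint : ∀ {f g : ℝ → ℝ}, ContDiff ℝ ∞ f → ContDiff ℝ ∞ g → HasCompactSupport g →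
          MeasureTheory.Integrable fun s => f s * g s := fun hf hg hgc =>
        (hf.continuous.mul hg.continuous).integrable_of_hasCompactSupport hgc.mul_left
      have i1 := integral_iteratedDeriv_mul hfa (hcm hαc) hβ 2
      have i2 := integral_iteratedDeriv_mul hfb (hcm hαc) hβ 1
      simp only [iteratedDeriv_succ, iteratedDeriv_zero] at i1 i2
      have e := h α β hα hαc hαI hβ hβc hβI
      have hL := hint ((s1.add s2).add s3) hβ hβc
      have hA := hint s4 hβ hβc
      have hB := hint s5 hβ hβc
      have hC := hint s6 hβ hβc
      have hA' : MeasureTheory.Integrable fun s => a' s * α s * deriv (deriv β) s :=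
        hint hfa (hder (hder hβ)) hβc.deriv.deriv
      have hB' : MeasureTheory.Integrable fun s => b' s * α s * deriv β s :=
        hint hfb (hder hβ) hβc.deriv
      have e1 : ∫ s, (a' s * deriv (deriv β) s + b' s * deriv β s + c' s * β s) * α s
          = (∫ s, a' s * α s * deriv (deriv β) s) + (∫ s, b' s * α s * deriv β s)
            + ∫ s, c' s * α s * β s := by
        have hAB : MeasureTheory.Integrable fun s =>
          a' s * α s * deriv (deriv β) s + b' s * α s * deriv β s := hA'.add hB'
        rw [← MeasureTheory.integral_add hA' hB', ← MeasureTheory.integral_add hAB hC]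
        exact MeasureTheory.integral_congr_ae (Filter.Eventually.of_forall fun s => by
          ring)
      have e2 : ∫ s, β s • R s
          = (∫ s, (a s * deriv (deriv α) s + b s * deriv α s + c s * α s) * β s)
            - (∫ s, deriv (deriv fun x => a' x * α x) s * β s)
            + (∫ s, deriv (fun x => b' x * α x) s * β s) - ∫ s, c' s * α s * β s := by
        have hLA : MeasureTheory.Integrable fun s =>
          (a s * deriv (deriv α) s + b s * deriv α s + c s * α s) * β s
            - deriv (deriv fun x => a' x * α x) s * β s := hL.sub hA
        have hLB : MeasureTheory.Integrable fun s =>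
          (a s * deriv (deriv α) s + b s * deriv α s + c s * α s) * β s
            - deriv (deriv fun x => a' x * α x) s * β s
            + deriv (fun x => b' x * α x) s * β s := hLA.add hB
        rw [← MeasureTheory.integral_sub hL hA, ← MeasureTheory.integral_add hLA hB,
          ← MeasureTheory.integral_sub hLB hC]
        exact MeasureTheory.integral_congr_ae (Filter.Eventually.of_forall fun s => by
          simp only [hR, smul_eq_mul]; ring)
      rw [e2, e, e1, i1, i2]
      ring
    have hae := hI.ae_eq_zero_of_integral_contDiff_smul_eq_zero
      (hRs.continuous.locallyIntegrable.locallyIntegrableOn I) hzero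
    have hR0 : EqOn R 0 I := MeasureTheory.Measure.eqOn_open_of_ae_eq (μ := MeasureTheory.volume)
      ((MeasureTheory.ae_restrict_iff' hI.measurableSet).2 hae) hI
      hRs.continuous.continuousOn continuousOn_const
    have hRt : R t = 0 := hR0 ht
    have hat := ha'.contDiffAt (hI.mem_nhds ht)
    have hbt := hb'.contDiffAt (hI.mem_nhds ht)
    simp only [hR] at hRt
    rw [deriv_deriv_mul hat hα.contDiffAt, deriv_fun_mul (hbt.differentiableAt (by simp))
      (hα.contDiffAt.differentiableAt (by simp))] at hRt
    linarith
  have hp1 : ∀ i : ℕ, deriv (fun s : ℝ => (s - t) ^ i) = fun s => i * (s - t) ^ (i - 1) :=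
    fun i => by
      funext s
      simp
  -- Testing with `(s - t) ^ i` for `i = 0, 1, 2` isolates the three coefficients. The truncated
  -- subtractions are harmless because the factors `i` and `i - 1` vanish where they occur.
  have hval : ∀ i : ℕ, (a t - a' t) * (i * ((i - 1 : ℕ) * 0 ^ (i - 1 - 1)))
      + (b t - 2 * deriv a' t + b' t) * (i * 0 ^ (i - 1)) +
        (c t - deriv (deriv a') t + deriv b' t - c' t) * 0 ^ i = 0 := fun i => by
    obtain ⟨α, hα, hαc, hαI, hev⟩ := exists_bump_mul_pow hI ht i
    have := key α hα hαc hαI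
    rw [hev.deriv.deriv_eq, hev.deriv_eq, hev.eq_of_nhds, hp1,
      deriv_const_mul_field', hp1] at this
    simpa using this
  have h0 := hval 0
  have h1 := hval 1
  have h2 := hval 2
  norm_num at h0 h1 h2
  exact ⟨by linarith, by linarith, by linarith⟩

variable {n : ℕ}

/-- The linearization along `c`, paired with fixed vectors `u` and `w`, is a scalar operator of
order two whose coefficients are the values of `jetPartial`. Exchanging `u` and `w` gives its formal
adjoint, so comparing coefficients yields the Helmholtz conditions. -/
theorem satisfiesHelmholtz_elJet {r : ℕ} {L : (Fin (r + 2) → Model n) → ℝ}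
    {W : Set (Model n × Model n)} (hW : IsOpen W) (hL : ContDiffOn ℝ ∞ L (jetsOver r W))
    (h2 : SecondOrderOver L W) : SatisfiesHelmholtz (elJet L) W := by
  intro c I hI hc hcW u w t ht
  have hsm : ∀ ξ w, ContDiffOn ℝ ∞ (jetPartial (elJet L) c ξ w) I := fun ξ w =>
    (((contDiffOn_fderiv_of_isOpen (isOpen_jets2Over hW) (contDiffOn_elJet hW hL)).comp
      (contDiffOn_jet2 hI hc) fun s hs => hcW s hs).clm_apply contDiffOn_const).clm_apply
      contDiffOn_const
  have hexp : ∀ {α : ℝ → ℝ}, ContDiff ℝ ∞ α → ∀ u w s,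
      fderiv ℝ (elJet L) (jet2 c s) (jet2 (fun s => α s • u) s) w =
      jetPartial (elJet L) c (0, 0, u) w s * deriv (deriv α) s + jetPartial (elJet L) c (0, u, 0) w s * deriv α s
        + jetPartial (elJet L) c (u, 0, 0) w s * α s := fun {α} hα u w s => by
    have : jet2 (fun s => α s • u) s = deriv (deriv α) s • ((0, 0, u) : Model n × Model n × Model n)
        + deriv α s • ((0, u, 0) : Model n × Model n × Model n)
        + α s • ((u, 0, 0) : Model n × Model n × Model n) := by
      rw [jet2_smul hα]; simp
    rw [this]
    simp only [map_add, map_smul, add_apply, smul_apply, smul_eq_mul, jetPartial]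
    ring
  refine coeff_eq_of_formal_adjoint hI (hsm _ _) (hsm _ _) (hsm _ _) (hsm _ _) (hsm _ _)
    (hsm _ _) (fun α β hα hαc hαI hβ hβc hβI => ?_) ht
  have := integral_fderiv_elJet_symm hW hL h2 hI hc hcW hα hαc hαI hβ hβc hβI u w
  simpa only [hexp hα, hexp hβ] using this

end Helmholtz

/-! ### Second order equations and their Jacobi endomorphisms -/

section Spray

variable {V F : Type*} [NormedAddCommGroup V] [NormedSpace ℝ V]
  [NormedAddCommGroup F] [NormedSpace ℝ F]

/-- The derivative of `f` along the flow of the second order equation `x_tt = S(x, x_t)`. -/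
def flowDeriv (S : V × V → V) (f : V × V → F) (z : V × V) : F := fderiv ℝ f z (z.2, S z)

/-- The derivative of `S` with respect to the velocity. -/
def velDeriv (S : V × V → V) (z : V × V) : V →L[ℝ] V :=
  (fderiv ℝ S z).comp (ContinuousLinearMap.inr ℝ V V)

/-- The derivative of `S` with respect to the position. -/
def posDeriv (S : V × V → V) (z : V × V) : V →L[ℝ] V :=
  (fderiv ℝ S z).comp (ContinuousLinearMap.inl ℝ V V)

/-- The Jacobi endomorphism of the second order equation `x_tt = S(x, x_t)` and its covariant
derivatives along the solutions. -/
def jacobiEndo (S : V × V → V) : ℕ → V × V → V →L[ℝ] V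
  | 0 => fun z => posDeriv S z - (1 / 2 : ℝ) • flowDeriv S (velDeriv S) z
      + (1 / 4 : ℝ) • (velDeriv S z).comp (velDeriv S z)
  | k + 1 => fun z => flowDeriv S (jacobiEndo S k) z
      + (1 / 2 : ℝ) • ((jacobiEndo S k z).comp (velDeriv S z)
        - (velDeriv S z).comp (jacobiEndo S k z))

variable {S : V × V → V} {W : Set (V × V)}

theorem contDiffOn_flowDeriv (hW : IsOpen W) (hS : ContDiffOn ℝ ∞ S W) {f : V × V → F}
    (hf : ContDiffOn ℝ ∞ f W) : ContDiffOn ℝ ∞ (flowDeriv S f) W :=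
  (contDiffOn_fderiv_of_isOpen hW hf).clm_apply (contDiff_snd.contDiffOn.prodMk hS)

theorem contDiffOn_velDeriv (hW : IsOpen W) (hS : ContDiffOn ℝ ∞ S W) :
    ContDiffOn ℝ ∞ (velDeriv S) W :=
  (contDiffOn_fderiv_of_isOpen hW hS).clm_comp contDiffOn_const

theorem contDiffOn_posDeriv (hW : IsOpen W) (hS : ContDiffOn ℝ ∞ S W) :
    ContDiffOn ℝ ∞ (posDeriv S) W :=
  (contDiffOn_fderiv_of_isOpen hW hS).clm_comp contDiffOn_const

theorem contDiffOn_jacobiEndo (hW : IsOpen W) (hS : ContDiffOn ℝ ∞ S W) (k : ℕ) :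
    ContDiffOn ℝ ∞ (jacobiEndo S k) W := by
  have hB := contDiffOn_velDeriv hW hS
  induction k with
  | zero =>
    exact ((contDiffOn_posDeriv hW hS).sub ((contDiffOn_flowDeriv hW hS hB).const_smul _)).add
      ((hB.clm_comp hB).const_smul _)
  | succ k ih =>
    exact (contDiffOn_flowDeriv hW hS ih).add
      (((ih.clm_comp hB).sub (hB.clm_comp ih)).const_smul _)

theorem flowDeriv_congr (hW : IsOpen W) {f g : V × V → F} (h : EqOn f g W) :
    EqOn (flowDeriv S f) (flowDeriv S g) W := fun z hz => by
  simp only [flowDeriv, (h.eventuallyEq_of_mem (hW.mem_nhds hz)).fderiv_eq]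

/-- Local existence of smooth solutions of a second order equation. -/
theorem exists_solution [CompleteSpace V] (hW : IsOpen W) (hS : ContDiffOn ℝ ∞ S W) {z : V × V}
    (hz : z ∈ W) : ∃ ε > 0, ∃ c : ℝ → V, c 0 = z.1 ∧ deriv c 0 = z.2 ∧
      ContDiffOn ℝ ∞ c (Ioo (-ε) ε) ∧ ∀ t ∈ Ioo (-ε) ε, (c t, deriv c t) ∈ W ∧
        deriv (deriv c) t = S (c t, deriv c t) ∧
        HasDerivAt (fun s => (c s, deriv c s)) (deriv c t, S (c t, deriv c t)) t := by
  set X : V × V → V × V := fun z => (z.2, S z)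
  have hX : ContDiffOn ℝ ∞ X W := contDiff_snd.contDiffOn.prodMk hS
  obtain ⟨γ, hγ0, ε, hε, hγ⟩ :=
    ((hX.contDiffAt (hW.mem_nhds hz)).of_le (by simp :
      (1 : WithTop ℕ∞) ≤ ∞)).exists_forall_mem_closedBall_exists_eq_forall_mem_Ioo_hasDerivAt₀ 0
  simp only [zero_sub, zero_add] at hγ
  have hcont : ContinuousAt γ 0 := (hγ 0 ⟨by linarith, hε⟩).continuousAt
  have hW0 : ∀ᶠ t in 𝓝 (0 : ℝ), γ t ∈ W := hcont.eventually (hW.mem_nhds (by rwa [hγ0]))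
  obtain ⟨δ, hδ, hball⟩ := Metric.eventually_nhds_iff.1 hW0
  set η := min (ε / 2) (δ / 2)
  have hη : 0 < η := lt_min (by linarith) (by linarith)
  have hηε : η < ε := (min_le_left _ _).trans_lt (by linarith)
  have hηδ : η < δ := (min_le_right _ _).trans_lt (by linarith)
  -- The interval is shrunk so that the solution stays in `W` on a closed interval, where the
  -- regularity theorem for solutions of smooth equations applies.
  have hIcc : ∀ t ∈ Icc (-η) η, HasDerivAt γ (X (γ t)) t ∧ γ t ∈ W := fun t ht =>
    ⟨hγ t ⟨by linarith [ht.1], by linarith [ht.2]⟩, hball (by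
      rw [Real.dist_eq, sub_zero, abs_lt]; exact ⟨by linarith [ht.1], by linarith [ht.2]⟩)⟩
  have hsm : ContDiffOn ℝ ∞ γ (Icc (-η) η) :=
    ODE.contDiffOn_enat_Icc_of_hasDerivWithinAt (n := ⊤) (f := fun _ => X) (u := W)
      (hX.comp contDiff_snd.contDiffOn fun p hp => hp.2)
      (fun t ht => (hIcc t ht).1.hasDerivWithinAt) fun t ht => (hIcc t ht).2
  have hd : ∀ t ∈ Ioo (-η) η, deriv (fun s => (γ s).1) t = (γ t).2 := fun t ht =>
    ((ContinuousLinearMap.fst ℝ V V).hasFDerivAt.comp_hasDerivAt t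
      (hIcc t (Ioo_subset_Icc_self ht)).1).deriv
  have h0 : (0 : ℝ) ∈ Ioo (-η) η := ⟨by linarith, hη⟩
  refine ⟨η, hη, fun s => (γ s).1, by simp [hγ0], by rw [hd 0 h0, hγ0],
    contDiff_fst.comp_contDiffOn (hsm.mono Ioo_subset_Icc_self), fun t ht => ?_⟩
  have ht' := Ioo_subset_Icc_self ht
  have hev : (fun s => ((γ s).1, deriv (fun s => (γ s).1) s)) =ᶠ[𝓝 t] γ := by
    filter_upwards [isOpen_Ioo.mem_nhds ht] with s hs
    rw [hd s hs]
  have hev2 : deriv (fun s => (γ s).1) =ᶠ[𝓝 t] fun s => (γ s).2 := by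
    filter_upwards [isOpen_Ioo.mem_nhds ht] with s hs using hd s hs
  rw [hev2.deriv_eq, hd t ht]
  exact ⟨(hIcc t ht').2, ((ContinuousLinearMap.snd ℝ V V).hasFDerivAt.comp_hasDerivAt t
    (hIcc t ht').1).deriv, ((hIcc t ht').1).congr_of_eventuallyEq hev⟩

end Spray

/-! ### Helmholtz conditions force the multiplier to commute with the Jacobi endomorphisms -/

section Multiplier

variable {V : Type*} [NormedAddCommGroup V] [NormedSpace ℝ V]
  {S : V × V → V} {W : Set (V × V)} {G : V × V → V →L[ℝ] V →L[ℝ] ℝ}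

theorem flowDeriv_apply_apply {z : V × V} (hG : DifferentiableAt ℝ G z) (u w : V) :
    flowDeriv S (fun z => G z u w) z = flowDeriv S G z u w := by
  have h1 : HasFDerivAt (fun z => G z u) ((fderiv ℝ G z).flip u) z := by
    simpa using! hG.hasFDerivAt.clm_apply (hasFDerivAt_const u z)
  have h2 : HasFDerivAt (fun z => G z u w) (((fderiv ℝ G z).flip u).flip w) z := by
    simpa using! h1.clm_apply (hasFDerivAt_const w z)
  simp [flowDeriv, h2.fderiv]

theorem flowDeriv_apply_endo {P : V × V → V →L[ℝ] V} {z : V × V} (hG : DifferentiableAt ℝ G z)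
    (hP : DifferentiableAt ℝ P z) (u w : V) :
    flowDeriv S (fun z => G z (P z u) w) z
      = flowDeriv S G z (P z u) w + G z (flowDeriv S P z u) w := by
  have h0 : HasFDerivAt (fun z => P z u) ((fderiv ℝ P z).flip u) z := by
    simpa using! hP.hasFDerivAt.clm_apply (hasFDerivAt_const u z)
  have h1 := hG.hasFDerivAt.clm_apply h0
  have h2 := h1.clm_apply (hasFDerivAt_const w z)
  simp only [flowDeriv, h2.fderiv]
  simp [add_comm]

/-- If `G` is symmetric and satisfies the Helmholtz conditions along the flow of `S`, then all
Jacobi endomorphisms are symmetric with respect to `G`. -/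
theorem symm_jacobiEndo (hW : IsOpen W) (hS : ContDiffOn ℝ ∞ S W) (hG : ContDiffOn ℝ ∞ G W)
    (hsymm : ∀ z ∈ W, ∀ u w, G z u w = G z w u)
    (hflow : ∀ z ∈ W, ∀ u w, flowDeriv S G z w u =
      -(1 / 2) * (G z (velDeriv S z u) w + G z (velDeriv S z w) u))
    (hpos : ∀ z ∈ W, ∀ u w, -G z (posDeriv S z u) w =
      flowDeriv S (flowDeriv S fun z => G z w u) z + flowDeriv S (fun z => G z (velDeriv S z w) u) z
        - G z (posDeriv S z w) u) (k : ℕ) :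
    ∀ z ∈ W, ∀ u w, G z (jacobiEndo S k z u) w = G z (jacobiEndo S k z w) u := by
  have hGd : ∀ {z}, z ∈ W → DifferentiableAt ℝ G z := fun hz =>
    ContDiffOn.differentiableAt_of_isOpen hW hG hz
  have hB := contDiffOn_velDeriv hW hS
  have hBd : ∀ {z}, z ∈ W → DifferentiableAt ℝ (velDeriv S) z := fun hz =>
    ContDiffOn.differentiableAt_of_isOpen hW hB hz
  induction k with
  | zero =>
    intro z hz u w
    -- Write `B`, `C` for the velocity and position derivatives of `S`. Using the transport law for
    -- `G` once in the second flow derivative shows that `G (C u) w` minus half the flow derivative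
    -- of `G (B u) w` is symmetric in `u` and `w`. Using it again in that flow derivative turns this
    -- into the symmetry of the Jacobi endomorphism.
    have hTT : flowDeriv S (flowDeriv S fun z => G z w u) z =
        -(1 / 2) * (flowDeriv S (fun z => G z (velDeriv S z u) w) z
          + flowDeriv S (fun z => G z (velDeriv S z w) u) z) := by
      have e : EqOn (flowDeriv S fun z => G z w u)
          (fun z => -(1 / 2) * (G z (velDeriv S z u) w + G z (velDeriv S z w) u)) W :=
        fun z hz => by rw [flowDeriv_apply_apply (hGd hz), hflow z hz]
      rw [flowDeriv_congr hW e hz]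
      have hd : ∀ u w, DifferentiableAt ℝ (fun z => G z (velDeriv S z u) w) z := fun u w =>
        (((hGd hz).clm_apply ((hBd hz).clm_apply (differentiableAt_const u))).clm_apply
          (differentiableAt_const w))
      simp only [flowDeriv]
      rw [fderiv_const_mul ((hd u w).fun_add (hd w u)), fderiv_fun_add (hd u w) (hd w u)]
      simp
      ring
    have h1 := hpos z hz u w
    rw [hTT, flowDeriv_apply_endo (hGd hz) (hBd hz), flowDeriv_apply_endo (hGd hz) (hBd hz),
      hflow z hz, hflow z hz] at h1
    have s1 := hsymm z hz (velDeriv S z w) (velDeriv S z u)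
    simp only [jacobiEndo, add_apply, sub_apply, smul_apply,
      ContinuousLinearMap.comp_apply, map_add, map_sub, map_smul, smul_eq_mul]
    linarith
  | succ k ih =>
    intro z hz u w
    have hJd : DifferentiableAt ℝ (jacobiEndo S k) z :=
      ContDiffOn.differentiableAt_of_isOpen hW (contDiffOn_jacobiEndo hW hS k) hz
    have e : EqOn (fun z => G z (jacobiEndo S k z u) w) (fun z => G z (jacobiEndo S k z w) u) W :=
      fun z hz => ih z hz u w
    -- The symmetry at level `k` is differentiated along the flow. The terms with `G` differentiated
    -- produce half the commutator with `velDeriv S`, as in the definition of the next endomorphism.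
    have h1 := flowDeriv_congr (S := S) hW e hz
    rw [flowDeriv_apply_endo (hGd hz) hJd, flowDeriv_apply_endo (hGd hz) hJd, hflow z hz,
      hflow z hz] at h1
    have s1 := hsymm z hz (velDeriv S z w) (jacobiEndo S k z u)
    have s2 := hsymm z hz (velDeriv S z u) (jacobiEndo S k z w)
    have s3 := ih z hz u (velDeriv S z w)
    have s4 := ih z hz w (velDeriv S z u)
    simp only [jacobiEndo, add_apply, sub_apply, smul_apply,
      ContinuousLinearMap.comp_apply, map_add, map_sub, map_smul, smul_eq_mul]
    linarith [hsymm z hz (velDeriv S z w) (jacobiEndo S k z u),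
      hsymm z hz (jacobiEndo S k z (velDeriv S z w)) u]

end Multiplier

/-! ### The inverse problem for second order equations -/

section Inverse

variable {V F : Type*} [NormedAddCommGroup V] [NormedSpace ℝ V]
  [NormedAddCommGroup F] [NormedSpace ℝ F]

/-- A function of 2-jets whose second derivatives in the direction of the acceleration vanish is
affine in the acceleration. -/
theorem eq_add_of_fderiv_fderiv_acc {f : V × V × V → F} {W : Set (V × V)} (hW : IsOpen W)
    (hf : ContDiffOn ℝ ∞ f (jets2Over W)) {x v : V} (hz : (x, v) ∈ W)
    (h : ∀ a j : V, dDir (0, 0, j) (dDir (0, 0, j) f) (x, v, a) = 0) (a : V) :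
    f (x, v, a) = f (x, v, 0) + fderiv ℝ f (x, v, 0) (0, 0, a) := by
  have hO := isOpen_jets2Over hW
  have hl : ∀ s : ℝ, HasDerivAt (fun s : ℝ => ((x, v, s • a) : V × V × V)) (0, 0, a) s := fun s =>
    (hasDerivAt_const s x).prodMk ((hasDerivAt_const s v).prodMk (by
      simpa using (hasDerivAt_id s).smul_const a))
  have hg : ∀ {g : V × V × V → F}, ContDiffOn ℝ ∞ g (jets2Over W) → ∀ s : ℝ,
      HasDerivAt (fun s : ℝ => g (x, v, s • a)) (dDir (0, 0, a) g (x, v, s • a)) s := fun hg s =>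
    (ContDiffOn.differentiableAt_of_isOpen hO hg
      (show (x, v, s • a) ∈ jets2Over W from hz)).hasFDerivAt.comp_hasDerivAt s (hl s)
  have h1 := hg hf
  have h2 := hg (contDiffOn_dDir hO hf (0, 0, a))
  simp only [h] at h2
  have h3 : ∀ s : ℝ, dDir (0, 0, a) f (x, v, s • a) = fderiv ℝ f (x, v, 0) (0, 0, a) :=
    fun s => by
      have := is_const_of_deriv_eq_zero (fun s => (h2 s).differentiableAt) (fun s => (h2 s).deriv)
        s 0
      simpa [dDir] using this
  have h4 : ∀ s : ℝ, HasDerivAt (fun s : ℝ => f (x, v, s • a) - s • fderiv ℝ f (x, v, 0) (0, 0, a))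
      0 s := fun s => by
    have := (h1 s).sub ((hasDerivAt_id s).smul_const (fderiv ℝ f (x, v, 0) (0, 0, a)))
    rw [h3 s, one_smul, sub_self] at this
    exact this
  have := is_const_of_deriv_eq_zero (fun s => (h4 s).differentiableAt) (fun s => (h4 s).deriv) 1 0
  simp only [one_smul, zero_smul, sub_zero] at this
  rw [← this]
  abel

/-- On the surface `a = S z` the factor `a - S z` vanishes, so the derivatives of `G` do not
contribute. -/
theorem fderiv_multiplier_form {f : V × V × V → F} {G : V × V → V →L[ℝ] F} {S : V × V → V}
    {W : Set (V × V)} (hW : IsOpen W) (hG : ContDiffOn ℝ ∞ G W) (hS : ContDiffOn ℝ ∞ S W)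
    (hf : ∀ z ∈ W, ∀ a, f (z.1, z.2, a) = G z (a - S z)) {z : V × V} (hz : z ∈ W)
    (u u' u'' : V) :
    fderiv ℝ f (z.1, z.2, S z) (u, u', u'') = G z (u'' - fderiv ℝ S z (u, u')) := by
  obtain ⟨x, v⟩ := z
  set q : V × V × V := (x, v, S (x, v)) with hq
  have hπ : HasFDerivAt (fun q : V × V × V => (q.1, q.2.1))
      ((ContinuousLinearMap.fst ℝ V (V × V)).prod ((ContinuousLinearMap.fst ℝ V V).comp
        (ContinuousLinearMap.snd ℝ V (V × V)))) q :=
    hasFDerivAt_fst.prodMk (hasFDerivAt_fst.comp q hasFDerivAt_snd)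
  have hGd : HasFDerivAt G (fderiv ℝ G (x, v)) ((fun q : V × V × V => (q.1, q.2.1)) q) :=
    (ContDiffOn.differentiableAt_of_isOpen hW hG hz).hasFDerivAt
  have hSd : HasFDerivAt S (fderiv ℝ S (x, v)) ((fun q : V × V × V => (q.1, q.2.1)) q) :=
    (ContDiffOn.differentiableAt_of_isOpen hW hS hz).hasFDerivAt
  have haq : HasFDerivAt (fun q : V × V × V => q.2.2) ((ContinuousLinearMap.snd ℝ V V).comp
      (ContinuousLinearMap.snd ℝ V (V × V))) q := hasFDerivAt_snd.comp q hasFDerivAt_snd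
  have hmain := (hGd.comp q hπ).clm_apply (haq.sub (hSd.comp q hπ))
  have hev : f =ᶠ[𝓝 q] fun q => G (q.1, q.2.1) (q.2.2 - S (q.1, q.2.1)) := by
    filter_upwards [(isOpen_jets2Over hW).mem_nhds (show q ∈ jets2Over W from hz)] with q hq
    exact hf (q.1, q.2.1) hq q.2.2
  have h5 := hmain.congr_of_eventuallyEq (f₁ := f) hev
  rw [h5.fderiv]
  simp [hq]

theorem dDir_clm_apply_const {P : Type*} [NormedAddCommGroup P] [NormedSpace ℝ P]
    {f : P → V →L[ℝ] F} {z : P} (hf : DifferentiableAt ℝ f z) (d : P) (w : V) :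
    dDir d (fun q => f q w) z = dDir d f z w := by
  have h1 : HasFDerivAt (fun q => f q w) ((fderiv ℝ f z).flip w) z := by
    simpa using! hf.hasFDerivAt.clm_apply (hasFDerivAt_const w z)
  simp [dDir, h1.fderiv]

/-- The third derivative `j` of a curve through a given 2-jet is free. In the second Helmholtz
condition it enters only through the time derivative of the acceleration coefficient of `f`, and
there linearly. Hence its factor, a second derivative of `f` in the acceleration, must vanish. -/
theorem dDir_dDir_acc_of_helmholtz {f : V × V × V → V →L[ℝ] ℝ} {W : Set (V × V)}
    (hW : IsOpen W) (hf : ContDiffOn ℝ ∞ f (jets2Over W)) (hH : SatisfiesHelmholtz f W) {x v : V}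
    (hz : (x, v) ∈ W) (a j w : V) : dDir (0, 0, j) (dDir (0, 0, w) f) (x, v, a) = 0 := by
  have hO := isOpen_jets2Over hW
  ext u
  have hsm : ContDiffOn ℝ ∞ (fun q => dDir (0, 0, w) f q u) (jets2Over W) :=
    (contDiffOn_dDir hO hf _).clm_apply contDiffOn_const
  have hza : (x, v, a) ∈ jets2Over W := hz
  have hd0 := ContDiffOn.differentiableAt_of_isOpen hO hsm hza
  have key : ∀ j : V, 2 * dDir (v, a, j) (fun q => dDir (0, 0, w) f q u) (x, v, a) =
      fderiv ℝ f (x, v, a) (0, u, 0) w + fderiv ℝ f (x, v, a) (0, w, 0) u := by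
    intro j
    obtain ⟨c, hc⟩ : ∃ c, c = cubicCurve (x, v, a, j) := ⟨_, rfl⟩
    have hcont : Continuous fun s => (c s, deriv c s) := by
      rw [hc, deriv_cubicCurve]; unfold cubicCurve; fun_prop
    have hj0 : jet2 c 0 = (x, v, a) := by rw [hc]; exact jet2_cubicCurve_zero _
    have h0 : (0 : ℝ) ∈ (fun s => (c s, deriv c s)) ⁻¹' W := by
      have e1 : c 0 = x := congrArg Prod.fst hj0
      have e2 : deriv c 0 = v := congrArg (fun q => q.2.1) hj0
      simpa [e1, e2] using hz
    have h1 := (hH c _ (hW.preimage hcont) (by rw [hc]; exact (contDiff_cubicCurve _).contDiffOn)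
      (fun s hs => hs) u w 0 h0).2.1
    have hd : HasDerivAt (jetPartial f c (0, 0, w) u)
        (dDir (v, a, j) (fun q => dDir (0, 0, w) f q u) (x, v, a)) 0 := by
      have hcd : HasDerivAt (jet2 c) (v, a, j) 0 := by
        rw [hc]; exact hasDerivAt_jet2_cubicCurve (x, v, a, j)
      rw [← hj0] at hd0 ⊢
      exact hd0.hasFDerivAt.comp_hasDerivAt (0 : ℝ) hcd
    rw [hd.deriv] at h1
    simp only [jetPartial, hj0] at h1
    linarith
  -- Subtracting the condition for third derivative `0` from that for `j` leaves only the derivative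
  -- in the direction of `j`.
  have hs : ((0, 0, j) : V × V × V) = (v, a, j) - (v, a, 0) := by simp
  have h1 := key j
  have h0 := key 0
  rw [← dDir_clm_apply_const (ContDiffOn.differentiableAt_of_isOpen hO
    (contDiffOn_dDir hO hf _) hza), hs, zero_apply]
  simp only [dDir, map_sub] at h1 h0 ⊢
  linarith

/-- Suppose that `f` satisfies the Helmholtz conditions and vanishes on the 2-jets of the curves
`x_tt = S(x, x_t) + ν x_t`. If no nonzero symmetric bilinear form that annihilates the velocity is
compatible with the Jacobi endomorphisms of `S`, then `f` vanishes. -/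
theorem eq_zero_of_helmholtz [CompleteSpace V] {f : V × V × V → V →L[ℝ] ℝ} {W : Set (V × V)}
    (hW : IsOpen W) (hf : ContDiffOn ℝ ∞ f (jets2Over W)) (hH : SatisfiesHelmholtz f W)
    {S : V × V → V} (hS : ContDiffOn ℝ ∞ S W)
    (hzero : ∀ z ∈ W, ∀ ν : ℝ, f (z.1, z.2, S z + ν • z.2) = 0)
    (hinj : ∀ z ∈ W, ∀ G : V →L[ℝ] V →L[ℝ] ℝ, (∀ u w, G u w = G w u) → G z.2 = 0 →
      (∀ k < 3, ∀ u w, G (jacobiEndo S k z u) w = G (jacobiEndo S k z w) u) → G = 0)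
    {z : V × V} (hz : z ∈ W) (a : V) : f (z.1, z.2, a) = 0 := by
  -- `G` is the derivative of `f` in the acceleration. It depends only on position and velocity
  -- because `f` is affine in the acceleration, so evaluating at acceleration `0` loses nothing.
  obtain ⟨G, hGdef⟩ : ∃ G : V × V → V →L[ℝ] V →L[ℝ] ℝ, G = fun z =>
      (fderiv ℝ f (z.1, z.2, 0)).comp ((ContinuousLinearMap.inr ℝ V (V × V)).comp
        (ContinuousLinearMap.inr ℝ V V)) := ⟨_, rfl⟩
  have hG : ContDiffOn ℝ ∞ G W := by
    have h1 : ContDiff ℝ ∞ fun z : V × V => (z.1, z.2, (0 : V)) := by fun_prop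
    have h2 : ContDiffOn ℝ ∞ (fun z : V × V => fderiv ℝ f (z.1, z.2, 0)) W :=
      (contDiffOn_fderiv_of_isOpen (isOpen_jets2Over hW) hf).comp h1.contDiffOn fun z hz => hz
    rw [hGdef]
    exact h2.clm_comp contDiffOn_const
  have hadd : ∀ z ∈ W, ∀ a, f (z.1, z.2, a) = f (z.1, z.2, 0) + G z a := fun z hz a => by
    rw [eq_add_of_fderiv_fderiv_acc hW hf hz
      (fun a j => dDir_dDir_acc_of_helmholtz hW hf hH hz a j j) a, hGdef]
    rfl
  have hGd : ∀ {z}, z ∈ W → DifferentiableAt ℝ G z := fun hz =>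
    ContDiffOn.differentiableAt_of_isOpen hW hG hz
  have hform : ∀ z ∈ W, ∀ a, f (z.1, z.2, a) = G z (a - S z) := fun z hz a => by
    have e0 := hzero z hz 0
    rw [hadd z hz] at e0
    rw [hadd z hz, eq_neg_of_add_eq_zero_left e0, map_sub]
    simp only [zero_smul, add_zero]
    abel
  -- The freedom of reparametrization enters here: `ν = 0` gave `f = G (a - S)`, and `ν = 1` puts
  -- the velocity in the kernel of `G`.
  have hvel : ∀ z ∈ W, G z z.2 = 0 := fun z hz => by
    have := hzero z hz 1
    rw [hform z hz] at this
    simpa using this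
  suffices hG0 : G z = 0 by rw [hform z hz, hG0]; rfl
  have hpart := fun z (hz : z ∈ W) => fderiv_multiplier_form hW hG hS hform hz
  -- The Helmholtz conditions are evaluated along the solution of `x_tt = S` through `z`, where time
  -- derivatives become flow derivatives.
  have hgeo : ∀ z ∈ W, ∀ u w, G z u w = G z w u ∧
      -G z (velDeriv S z u) w = 2 * flowDeriv S (fun z => G z w u) z + G z (velDeriv S z w) u ∧
      -G z (posDeriv S z u) w = flowDeriv S (flowDeriv S fun z => G z w u) z
        + flowDeriv S (fun z => G z (velDeriv S z w) u) z - G z (posDeriv S z w) u := by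
    intro z hz u w
    obtain ⟨ε, hε, c, hc0, hc1, hcs, hc⟩ := exists_solution hW hS hz
    have h0 : (0 : ℝ) ∈ Ioo (-ε) ε := ⟨by linarith, hε⟩
    have hc' := hH c _ isOpen_Ioo hcs (fun t ht => (hc t ht).1) u w 0 h0
    obtain ⟨γ, hγ⟩ : ∃ γ : ℝ → V × V, γ = fun t => (c t, deriv c t) := ⟨_, rfl⟩
    have hγ0 : γ 0 = z := by simp only [hγ, hc0, hc1]
    have hγW : ∀ t ∈ Ioo (-ε) ε, γ t ∈ W := fun t ht => by rw [hγ]; exact (hc t ht).1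
    have hj : ∀ t ∈ Ioo (-ε) ε, jet2 c t = ((γ t).1, (γ t).2, S (γ t)) := fun t ht => by
      simp only [jet2, (hc t ht).2.1, hγ]
    have pA : ∀ u w, ∀ t ∈ Ioo (-ε) ε, jetPartial f c (0, 0, u) w t = G (γ t) u w :=
      fun u w t ht => by
        rw [jetPartial, hj t ht, hpart _ (hγW t ht), Prod.mk_zero_zero, map_zero, sub_zero]
    have pB : ∀ u w, ∀ t ∈ Ioo (-ε) ε, jetPartial f c (0, u, 0) w t =
        -G (γ t) (velDeriv S (γ t) u) w := fun u w t ht => by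
      rw [jetPartial, hj t ht, hpart _ (hγW t ht)]; simp [velDeriv]
    have pC : ∀ u w, ∀ t ∈ Ioo (-ε) ε, jetPartial f c (u, 0, 0) w t =
        -G (γ t) (posDeriv S (γ t) u) w := fun u w t ht => by
      rw [jetPartial, hj t ht, hpart _ (hγW t ht)]; simp [posDeriv]
    have hder : ∀ {h : ℝ → ℝ} {g : V × V → ℝ}, ContDiffOn ℝ ∞ g W →
        (∀ t ∈ Ioo (-ε) ε, h t = g (γ t)) →
        ∀ t ∈ Ioo (-ε) ε, deriv h t = flowDeriv S g (γ t) := fun {h g} hg hh t ht => by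
      have hev : h =ᶠ[𝓝 t] fun t => g (γ t) := by
        filter_upwards [isOpen_Ioo.mem_nhds ht] with s hs using hh s hs
      have hd := (hc t ht).2.2
      rw [← hγ] at hd
      rw [hev.deriv_eq]
      have := ((ContDiffOn.differentiableAt_of_isOpen hW hg
        (hγW t ht)).hasFDerivAt.comp_hasDerivAt t hd).deriv
      rw [flowDeriv]
      simpa [hγ] using! this
    have sA : ContDiffOn ℝ ∞ (fun z => G z w u) W :=
      (hG.clm_apply contDiffOn_const).clm_apply contDiffOn_const
    have sB : ContDiffOn ℝ ∞ (fun z => -G z (velDeriv S z w) u) W :=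
      ((hG.clm_apply ((contDiffOn_velDeriv hW hS).clm_apply contDiffOn_const)).clm_apply
        contDiffOn_const).neg
    have dA := hder sA (pA w u)
    have ddA := hder (contDiffOn_flowDeriv hW hS sA) dA
    have dB := hder sB (pB w u)
    rw [pA u w 0 h0, pA w u 0 h0, pB u w 0 h0, pB w u 0 h0, pC u w 0 h0, pC w u 0 h0, dA 0 h0,
      ddA 0 h0, dB 0 h0, hγ0] at hc'
    have hneg : flowDeriv S (fun z => -G z (velDeriv S z w) u) z =
        -flowDeriv S (fun z => G z (velDeriv S z w) u) z := by
      simp only [flowDeriv]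
      rw [fderiv_fun_neg]
      rfl
    rw [hneg] at hc'
    exact ⟨hc'.1, by linarith [hc'.2.1], by linarith [hc'.2.2]⟩
  refine hinj z hz (G z) (fun u w => (hgeo z hz u w).1) (hvel z hz) fun k _ u w =>
    symm_jacobiEndo hW hS hG (fun z hz u w => (hgeo z hz u w).1) (fun z hz u w => ?_)
      (fun z hz u w => (hgeo z hz u w).2.2) k z hz u w
  have := (hgeo z hz u w).2.1
  rw [flowDeriv_apply_apply (hGd hz)] at this
  linarith

/-- A Lagrangian with second order Euler-Lagrange equations such that the curves
`x_tt = S(x, x_t) + ν x_t` are extremal is trivial, if no nonzero symmetric bilinear form that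
annihilates the velocity is compatible with the Jacobi endomorphisms of `S`. -/
theorem elJet_eq_zero_of_extremal {n r : ℕ} {L : (Fin (r + 2) → Model n) → ℝ}
    {W : Set (Model n × Model n)} (hW : IsOpen W) (hL : ContDiffOn ℝ ∞ L (jetsOver r W))
    (h2 : SecondOrderOver L W) {S : Model n × Model n → Model n} (hS : ContDiffOn ℝ ∞ S W)
    (hext : ∀ (ν ε : ℝ) (c : ℝ → Model n), 0 < ε → ContDiffOn ℝ ∞ c (Ioo (-ε) ε) →
      (∀ t ∈ Ioo (-ε) ε, (c t, deriv c t) ∈ W ∧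
        deriv (deriv c) t = S (c t, deriv c t) + ν • deriv c t) →
      ∀ w, eulerLagrange L c 0 w = 0)
    (hinj : ∀ z ∈ W, ∀ G : Model n →L[ℝ] Model n →L[ℝ] ℝ, (∀ u w, G u w = G w u) → G z.2 = 0 →
      (∀ k < 3, ∀ u w, G (jacobiEndo S k z u) w = G (jacobiEndo S k z w) u) → G = 0)
    {z : Model n × Model n} (hz : z ∈ W) (a : Model n) : elJet L (z.1, z.2, a) = 0 := by
  refine eq_zero_of_helmholtz hW (contDiffOn_elJet hW hL) (satisfiesHelmholtz_elJet hW hL h2) hS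
    (fun z hz ν => ?_) hinj hz a
  -- Constant values of `ν` suffice: each 2-jet with acceleration `S z + ν • z.2` is the initial
  -- 2-jet of a solution, hence of an extremal.
  have hS' : ContDiffOn ℝ ∞ (fun z => S z + ν • z.2) W :=
    hS.add (contDiff_snd.contDiffOn.const_smul ν)
  obtain ⟨ε, hε, c, hc0, hc1, hcs, hc⟩ := exists_solution hW hS' hz
  have h0 : (0 : ℝ) ∈ Ioo (-ε) ε := ⟨by linarith, hε⟩
  ext w
  have := hext ν ε c hε hcs (fun t ht => ⟨(hc t ht).1, (hc t ht).2.1⟩) w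
  rw [← elJet_jet2 hW hL h2 (hcs.contDiffAt (isOpen_Ioo.mem_nhds h0)) (hc 0 h0).1] at this
  have hj : jet2 c 0 = (z.1, z.2, S z + ν • z.2) := by
    simp only [jet2, (hc 0 h0).2.1, hc0, hc1]
  rw [hj] at this
  simpa using this

end Inverse

/-! ### The algebraic genericity condition -/

section Algebra

variable {n : ℕ}

/-- The standard basis vectors. -/
abbrev stdVec (i : Fin (n + 1)) : Model n := EuclideanSpace.single i 1

/-- The matrix unit sending `stdVec j` to `stdVec i`. -/
def matUnit (i j : Fin (n + 1)) : Model n →L[ℝ] Model n :=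
  (EuclideanSpace.proj j : Model n →L[ℝ] ℝ).smulRight (stdVec i)

theorem matUnit_stdVec (i j k : Fin (n + 1)) :
    matUnit i j (stdVec k) = if j = k then stdVec i else 0 := by
  simp [matUnit]

theorem fin_val_one (hn : 2 ≤ n) : ((1 : Fin (n + 1)) : ℕ) = 1 := by
  rw [Fin.val_one']; exact Nat.mod_eq_of_lt (by omega)

theorem fin_val_two (hn : 2 ≤ n) : ((2 : Fin (n + 1)) : ℕ) = 2 :=
  Nat.mod_eq_of_lt (show 2 < n + 1 by omega)

/-- Three endomorphisms, annihilating the first basis vector, such that no nonzero symmetric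
bilinear form with this vector in its kernel is compatible with all of them. -/
def rigidEndo (n : ℕ) : Fin 3 → Model n →L[ℝ] Model n :=
  ![∑ i : Fin (n + 1), (i : ℝ) • matUnit i i, matUnit 1 2,
    ∑ i : Fin (n + 1), if 2 ≤ (i : ℕ) then matUnit i 1 else 0]

theorem rigidEndo_zero_stdVec (j : Fin (n + 1)) :
    rigidEndo n 0 (stdVec j) = (j : ℝ) • stdVec j := by
  simp only [rigidEndo, Matrix.cons_val_zero, sum_apply, smul_apply, matUnit_stdVec]
  simp

theorem rigidEndo_one_stdVec (j : Fin (n + 1)) :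
    rigidEndo n 1 (stdVec j) = if 2 = j then stdVec 1 else 0 :=
  matUnit_stdVec _ _ _

theorem rigidEndo_two_stdVec (j : Fin (n + 1)) :
    rigidEndo n 2 (stdVec j) = if 1 = j then ∑ i : Fin (n + 1),
      (if 2 ≤ (i : ℕ) then stdVec i else 0 : Model n) else 0 := by
  show (∑ i : Fin (n + 1), if 2 ≤ (i : ℕ) then matUnit i 1 else 0 : Model n →L[ℝ] Model n) _ = _
  rw [sum_apply]
  split_ifs with h
  · refine Finset.sum_congr rfl fun i _ => ?_
    split_ifs <;> simp [matUnit_stdVec, h]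
  · refine Finset.sum_eq_zero fun i _ => ?_
    split_ifs <;> simp [matUnit_stdVec, h]

theorem rigidEndo_stdVec_zero (hn : 2 ≤ n) (k : Fin 3) : rigidEndo n k (stdVec 0) = 0 := by
  have h2 : (2 : Fin (n + 1)) ≠ 0 := by
    intro h; have := congrArg Fin.val h; rw [fin_val_two hn, Fin.val_zero] at this; omega
  have h1 : (1 : Fin (n + 1)) ≠ 0 := by
    intro h; have := congrArg Fin.val h; rw [fin_val_one hn, Fin.val_zero] at this; omega
  fin_cases k
  · simpa using rigidEndo_zero_stdVec (n := n) 0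
  · simpa [h2] using rigidEndo_one_stdVec (n := n) 0
  · simpa [h1] using rigidEndo_two_stdVec (n := n) 0

/-- The first endomorphism is diagonal with distinct eigenvalues, so `G` is diagonal in the standard
basis. The second, tested on `stdVec 2` and `stdVec 1`, kills the diagonal entry at index `1`. The
third, tested on `stdVec 1` and `stdVec i`, kills those at `i ≥ 2`, and the entry at `0` vanishes
because `stdVec 0` lies in the kernel. -/
theorem eq_zero_of_compatible_rigidEndo (hn : 2 ≤ n) {G : Model n →L[ℝ] Model n →L[ℝ] ℝ}
    (hs : ∀ u w, G u w = G w u) (h0 : G (stdVec 0) = 0)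
    (h : ∀ k u w, G (rigidEndo n k u) w = G (rigidEndo n k w) u) : G = 0 := by
  have v1 := fin_val_one hn
  have v2 := fin_val_two hn
  have h12 : (2 : Fin (n + 1)) ≠ 1 := fun h => by
    have := congrArg Fin.val h; omega
  have hoff : ∀ i j : Fin (n + 1), i ≠ j → G (stdVec i) (stdVec j) = 0 := fun i j hij => by
    have := h 0 (stdVec i) (stdVec j)
    rw [rigidEndo_zero_stdVec, rigidEndo_zero_stdVec] at this
    simp only [map_smul, smul_apply, smul_eq_mul] at this
    rw [hs (stdVec j)] at this
    have hne : (i : ℝ) - (j : ℝ) ≠ 0 := by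
      rw [sub_ne_zero]; exact_mod_cast fun h => hij (Fin.ext h)
    have h2 : ((i : ℝ) - (j : ℝ)) * G (stdVec i) (stdVec j) = 0 := by linarith
    exact (mul_eq_zero.1 h2).resolve_left hne
  have hd1 : G (stdVec 1) (stdVec 1) = 0 := by
    have := h 1 (stdVec 2) (stdVec 1)
    rw [rigidEndo_one_stdVec, rigidEndo_one_stdVec, if_pos rfl, if_neg h12] at this
    simpa using this
  have hd : ∀ i : Fin (n + 1), 2 ≤ (i : ℕ) → G (stdVec i) (stdVec i) = 0 := fun i hi => by
    have h1i : (1 : Fin (n + 1)) ≠ i := fun h => by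
      have := congrArg Fin.val h; omega
    have := h 2 (stdVec 1) (stdVec i)
    rw [rigidEndo_two_stdVec, rigidEndo_two_stdVec, if_pos rfl, if_neg h1i, map_zero, map_sum,
      sum_apply, Finset.sum_eq_single i] at this
    · simpa [hi] using this
    · intro j _ hj
      split_ifs
      · exact hoff j i hj
      · simp
    · simp
  have hall : ∀ i j : Fin (n + 1), G (stdVec i) (stdVec j) = 0 := fun i j => by
    by_cases hij : i = j
    · subst hij
      rcases Nat.lt_or_ge (i : ℕ) 2 with hi | hi
      · have : i = 0 ∨ i = 1 := by
          rcases Nat.lt_or_ge (i : ℕ) 1 with hi' | hi'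
          · left; ext; rw [Fin.val_zero]; omega
          · right; ext; omega
        rcases this with rfl | rfl
        · rw [h0]; rfl
        · exact hd1
      · exact hd i hi
    · exact hoff i j hij
  have hb : ∀ j, (EuclideanSpace.basisFun (Fin (n + 1)) ℝ).toBasis j = stdVec j := fun j => by simp
  refine ContinuousLinearMap.coe_injective ((EuclideanSpace.basisFun (Fin (n + 1)) ℝ).toBasis.ext
    fun i => ContinuousLinearMap.coe_injective
      ((EuclideanSpace.basisFun (Fin (n + 1)) ℝ).toBasis.ext fun j => ?_))
  rw [hb, hb]
  exact hall i j

end Algebra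

/-! ### An analytic function that detects rigidity -/

section GenericityFunction

/-- Injectivity of a family of linear maps is detected by the nonvanishing of a function that
depends analytically on the family. -/
theorem exists_injectivity_function {B P T : Type*} [AddCommMonoid B] [Module ℝ B]
    [Module.Finite ℝ B] [NormedAddCommGroup P] [NormedSpace ℝ P] [NormedAddCommGroup T]
    [NormedSpace ℝ T] [FiniteDimensional ℝ T] (Λ : P → B →ₗ[ℝ] T)
    (hΛ : ∀ G, ContDiff ℝ ω fun p => Λ p G) {p₀ : P} (hinj : LinearMap.ker (Λ p₀) = ⊥) :
    ∃ F : P → ℝ, ContDiff ℝ ω F ∧ F p₀ = 1 ∧ ∀ p, F p ≠ 0 → LinearMap.ker (Λ p) = ⊥ := by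
  let _ : AddCommGroup B := Module.addCommMonoidToAddCommGroup ℝ
  -- With `Ψ` a left inverse of `Λ p₀`, the function is `det (Ψ ∘ Λ p)`. It equals `1` at `p₀`, and
  -- where it is nonzero the composite, hence `Λ p`, is injective.
  obtain ⟨Ψ, hΨ⟩ := LinearMap.exists_leftInverse_of_injective _ hinj
  let b := Module.finBasis ℝ B
  refine ⟨fun p => LinearMap.det (Ψ ∘ₗ Λ p), ?_, by simp only [hΨ, LinearMap.det_id],
    fun p hp => ?_⟩
  · have : (fun p => LinearMap.det (Ψ ∘ₗ Λ p)) = fun p =>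
        Matrix.det (LinearMap.toMatrix b b (Ψ ∘ₗ Λ p)) := by
      funext p; rw [LinearMap.det_toMatrix]
    rw [this]
    simp only [Matrix.det_apply]
    refine ContDiff.sum fun σ _ => ContDiff.const_smul _ (contDiff_prod fun i _ => ?_)
    simp only [LinearMap.toMatrix_apply, LinearMap.comp_apply]
    exact ((b.coord (σ i)) ∘ₗ Ψ).toContinuousLinearMap.contDiff.comp (hΛ (b i))
  · have hu : LinearMap.ker (Ψ ∘ₗ Λ p) = ⊥ := by
      by_contra hne
      exact hp (LinearMap.det_eq_zero_iff_ker_ne_bot.2 hne)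
    exact eq_bot_iff.2 ((LinearMap.ker_le_ker_comp (Λ p) Ψ).trans hu.le)

variable {V : Type*} [NormedAddCommGroup V] [NormedSpace ℝ V]

/-- The linear conditions on a bilinear form to be symmetric, to have `v` in its kernel, and to be
compatible with the endomorphisms `A`, in terms of a basis. -/
def compatMap {ι : Type*} (b : Module.Basis ι ℝ V) (p : V × (Fin 3 → V →L[ℝ] V)) :
    (V →L[ℝ] V →L[ℝ] ℝ) →ₗ[ℝ] (ι → ι → ℝ) × (ι → ℝ) × (Fin 3 → ι → ι → ℝ) where
  toFun G := (fun i j => G (b i) (b j) - G (b j) (b i), fun j => G p.1 (b j),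
    fun k i j => G (p.2 k (b i)) (b j) - G (p.2 k (b j)) (b i))
  map_add' G H := by
    refine Prod.ext ?_ (Prod.ext ?_ ?_) <;> funext <;> simp <;> ring
  map_smul' c G := by
    refine Prod.ext ?_ (Prod.ext ?_ ?_) <;> funext <;> simp <;> ring

theorem contDiff_compatMap_apply {ι : Type*} [Fintype ι] (b : Module.Basis ι ℝ V)
    (G : V →L[ℝ] V →L[ℝ] ℝ) :
    ContDiff ℝ ω fun p : V × (Fin 3 → V →L[ℝ] V) => compatMap b p G := by
  have hk : ∀ (k : Fin 3) (u w : V), ContDiff ℝ ω fun p : V × (Fin 3 → V →L[ℝ] V) =>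
      G (p.2 k u) w := fun k u w =>
    (G.contDiff.comp (((contDiff_apply ℝ _ k).comp contDiff_snd).clm_apply
      contDiff_const)).clm_apply contDiff_const
  refine contDiff_const.prodMk ((contDiff_pi.2 fun j =>
    (G.contDiff.comp contDiff_fst).clm_apply contDiff_const).prodMk (contDiff_pi.2 fun k =>
      contDiff_pi.2 fun i => contDiff_pi.2 fun j => (hk k _ _).sub (hk k _ _)))

theorem compatMap_eq_zero_iff {ι : Type*} (b : Module.Basis ι ℝ V) (p : V × (Fin 3 → V →L[ℝ] V))
    (G : V →L[ℝ] V →L[ℝ] ℝ) : compatMap b p G = 0 ↔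
      (∀ u w, G u w = G w u) ∧ G p.1 = 0 ∧ ∀ k u w, G (p.2 k u) w = G (p.2 k w) u := by
  have ext2 : ∀ (A : V →L[ℝ] V), (∀ i j, G (A (b i)) (b j) = G (A (b j)) (b i)) →
      ∀ u w, G (A u) w = G (A w) u := fun A h u w => by
    have e : (LinearMap.mk₂ ℝ (fun u w => G (A u) w) (by simp) (by simp) (by simp) (by simp) :
        V →ₗ[ℝ] V →ₗ[ℝ] ℝ) = LinearMap.mk₂ ℝ (fun u w => G (A w) u) (by simp) (by simp)
          (by simp) (by simp) :=
      b.ext fun i => b.ext fun j => by simpa using h i j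
    simpa using LinearMap.congr_fun₂ e u w
  constructor
  · intro h
    have h1 := fun i j => congrFun (congrFun (congrArg Prod.fst h) i) j
    have h2 := fun j => congrFun (congrArg (fun x => x.2.1) h) j
    have h3 := fun k i j => congrFun (congrFun (congrFun (congrArg (fun x => x.2.2) h) k) i) j
    refine ⟨ext2 (ContinuousLinearMap.id ℝ V) fun i j => sub_eq_zero.1 (h1 i j), ?_,
      fun k => ext2 (p.2 k) fun i j => sub_eq_zero.1 (h3 k i j)⟩
    exact ContinuousLinearMap.coe_injective (b.ext fun j => h2 j)
  · rintro ⟨h1, h2, h3⟩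
    refine Prod.ext (funext fun i => funext fun j => sub_eq_zero.2 (h1 _ _)) (Prod.ext (funext
      fun j => ?_) (funext fun k => funext fun i => funext fun j => sub_eq_zero.2 (h3 k _ _)))
    show G p.1 (b j) = 0
    rw [h2]; rfl

/-- There is an analytic function of a vector and three endomorphisms whose nonvanishing excludes
nonzero compatible bilinear forms, and which does not vanish identically. -/
theorem exists_genericity_function [FiniteDimensional ℝ V] {p₀ : V × (Fin 3 → V →L[ℝ] V)}
    (h₀ : ∀ G : V →L[ℝ] V →L[ℝ] ℝ, (∀ u w, G u w = G w u) → G p₀.1 = 0 →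
      (∀ k u w, G (p₀.2 k u) w = G (p₀.2 k w) u) → G = 0) :
    ∃ F : V × (Fin 3 → V →L[ℝ] V) → ℝ, ContDiff ℝ ω F ∧
      F p₀ = 1 ∧
      ∀ p, F p ≠ 0 → ∀ G : V →L[ℝ] V →L[ℝ] ℝ, (∀ u w, G u w = G w u) → G p.1 = 0 →
        (∀ k u w, G (p.2 k u) w = G (p.2 k w) u) → G = 0 := by
  let b := Module.finBasis ℝ V
  have hinj : LinearMap.ker (compatMap b p₀) = ⊥ := by
    refine LinearMap.ker_eq_bot'.2 fun G hG => ?_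
    obtain ⟨h1, h2, h3⟩ := (compatMap_eq_zero_iff b _ G).1 hG
    exact h₀ G h1 h2 h3
  obtain ⟨F, hF, hF0, hFp⟩ := exists_injectivity_function (compatMap b)
    (contDiff_compatMap_apply b) hinj
  exact ⟨F, hF, hF0, fun p hp G h1 h2 h3 =>
    LinearMap.ker_eq_bot'.1 (hFp p hp) G ((compatMap_eq_zero_iff b p G).2 ⟨h1, h2, h3⟩)⟩

end GenericityFunction

/-! ### A geodesic equation with prescribed Jacobi endomorphisms -/

section ModelSpray

variable {V : Type*} [NormedAddCommGroup V] [NormedSpace ℝ V]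

/-- A vector field vanishing along the line through `p` in the direction of a common kernel vector
of the `A k`, whose derivative along this line has the Taylor coefficients `A k`. -/
def modelField (ℓ : V →L[ℝ] ℝ) (A : Fin 3 → V →L[ℝ] V) (p x : V) : V :=
  A 0 (x - p) + ℓ (x - p) • A 1 (x - p) + (2⁻¹ * ℓ (x - p) ^ 2) • A 2 (x - p)

theorem contDiff_modelField (ℓ : V →L[ℝ] ℝ) (A : Fin 3 → V →L[ℝ] V) (p : V) :
    ContDiff ℝ ∞ (modelField ℓ A p) := by
  unfold modelField
  fun_prop

theorem modelField_line {ℓ : V →L[ℝ] ℝ} {A : Fin 3 → V →L[ℝ] V} {e : V} (hA : ∀ k, A k e = 0)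
    (p : V) (t : ℝ) : modelField ℓ A p (p + t • e) = 0 := by
  simp [modelField, hA]

/-- On the line every `A k (x - p)` vanishes, so in the product rule only the terms that
differentiate this factor survive, with `ℓ (x - p) = t` as coefficient. -/
theorem hasFDerivAt_modelField_line {ℓ : V →L[ℝ] ℝ} {A : Fin 3 → V →L[ℝ] V} {e : V}
    (hA : ∀ k, A k e = 0) (hℓ : ℓ e = 1) (p : V) (t : ℝ) :
    HasFDerivAt (modelField ℓ A p) (A 0 + t • A 1 + (t ^ 2 / 2) • A 2) (p + t • e) := by
  have hy : HasFDerivAt (fun x : V => x - p) (ContinuousLinearMap.id ℝ V) (p + t • e) :=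
    (hasFDerivAt_id _).sub_const p
  have hl := (ℓ.hasFDerivAt (x := p + t • e - p)).comp (p + t • e) hy
  have hAk := fun k => ((A k).hasFDerivAt (x := p + t • e - p)).comp (p + t • e) hy
  have h := ((hAk 0).add (hl.smul (hAk 1))).add (((hl.pow 2).const_mul 2⁻¹).smul (hAk 2))
  refine h.congr_fderiv ?_
  ext w
  simp [hA, hℓ]
  ring_nf

/-- The quadratic second order equation built from `modelField`. -/
def modelSpray (ℓ : V →L[ℝ] ℝ) (A : Fin 3 → V →L[ℝ] V) (p : V) (z : V × V) : V :=
  (ℓ z.2) ^ 2 • modelField ℓ A p z.1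

theorem contDiff_modelSpray (ℓ : V →L[ℝ] ℝ) (A : Fin 3 → V →L[ℝ] V) (p : V) :
    ContDiff ℝ ∞ (modelSpray ℓ A p) :=
  ((ℓ.contDiff.comp contDiff_snd).pow 2).smul ((contDiff_modelField ℓ A p).comp contDiff_fst)

variable {ℓ : V →L[ℝ] ℝ} {A : Fin 3 → V →L[ℝ] V} {e : V}

/-- The field vanishes on the line, so differentiating the factor `(ℓ z.2) ^ 2` contributes nothing.
In particular the velocity derivative is zero there, and no correction terms appear in the Jacobi
endomorphisms. -/
theorem fderiv_modelSpray_line (hA : ∀ k, A k e = 0) (hℓ : ℓ e = 1) (p : V) (t : ℝ) (d : V × V) :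
    fderiv ℝ (modelSpray ℓ A p) (p + t • e, e) d = (A 0 + t • A 1 + (t ^ 2 / 2) • A 2) d.1 := by
  have h1 := HasFDerivAt.comp (g := modelField ℓ A p) (p + t • e, e)
    (hasFDerivAt_modelField_line hA hℓ p t) (hasFDerivAt_fst (𝕜 := ℝ) (E := V) (F := V))
  have h2 := HasFDerivAt.comp (g := ℓ) (p + t • e, e) ℓ.hasFDerivAt
    (hasFDerivAt_snd (𝕜 := ℝ) (E := V) (F := V))
  have h : HasFDerivAt (modelSpray ℓ A p) _ (p + t • e, e) := (h2.pow 2).smul h1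
  rw [h.fderiv]
  simp [modelField_line hA, hℓ]

theorem posDeriv_modelSpray_line (hA : ∀ k, A k e = 0) (hℓ : ℓ e = 1) (p : V) (t : ℝ) :
    posDeriv (modelSpray ℓ A p) (p + t • e, e) = A 0 + t • A 1 + (t ^ 2 / 2) • A 2 := by
  ext w
  show fderiv ℝ (modelSpray ℓ A p) (p + t • e, e) (w, 0) = _
  rw [fderiv_modelSpray_line hA hℓ]

theorem velDeriv_modelSpray_line (hA : ∀ k, A k e = 0) (hℓ : ℓ e = 1) (p : V) (t : ℝ) :
    velDeriv (modelSpray ℓ A p) (p + t • e, e) = 0 := by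
  ext w
  show fderiv ℝ (modelSpray ℓ A p) (p + t • e, e) (0, w) = _
  rw [fderiv_modelSpray_line hA hℓ]; simp

/-- The line with constant velocity `e` solves the equation, since the right hand side vanishes on
it. The flow derivative is therefore the ordinary derivative along this line. -/
theorem flowDeriv_modelSpray_line {F : Type*} [NormedAddCommGroup F] [NormedSpace ℝ F]
    (hA : ∀ k, A k e = 0) (p : V) {f : V × V → F} (hf : ContDiffOn ℝ ∞ f univ) {g : ℝ → F} {g' : F}
    {t : ℝ} (hfg : ∀ s, f (p + s • e, e) = g s) (hg : HasDerivAt g g' t) :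
    flowDeriv (modelSpray ℓ A p) f (p + t • e, e) = g' := by
  have hd : HasDerivAt (fun s : ℝ => (p + s • e, e)) (e, (0 : V)) t := by
    have h1 : HasDerivAt (fun s : ℝ => p + s • e) e t := by
      simpa using ((hasDerivAt_id t).smul_const e).const_add p
    exact h1.prodMk (hasDerivAt_const t e)
  have hfd : DifferentiableAt ℝ f (p + t • e, e) :=
    ContDiffOn.differentiableAt_of_isOpen isOpen_univ hf (mem_univ _)
  have h := hfd.hasFDerivAt.comp_hasDerivAt t hd
  have h' : (f ∘ fun s : ℝ => (p + s • e, e)) = g := funext hfg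
  rw [h'] at h
  unfold flowDeriv
  rw [show modelSpray ℓ A p (p + t • e, e) = 0 by simp [modelSpray, modelField_line hA]]
  exact h.unique hg

/-- The Jacobi endomorphisms of `modelSpray`. -/
theorem jacobiEndo_modelSpray (hA : ∀ k, A k e = 0) (hℓ : ℓ e = 1) (p : V) (k : Fin 3) :
    jacobiEndo (modelSpray ℓ A p) k (p, e) = A k := by
  have hS := (contDiff_modelSpray ℓ A p).contDiffOn (s := univ)
  have hJ := contDiffOn_jacobiEndo isOpen_univ hS
  have h0 : ∀ t : ℝ, jacobiEndo (modelSpray ℓ A p) 0 (p + t • e, e) =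
      A 0 + t • A 1 + (t ^ 2 / 2) • A 2 := fun t => by
    have hf := flowDeriv_modelSpray_line (t := t) (ℓ := ℓ) hA p
      (contDiffOn_velDeriv isOpen_univ hS)
      (fun s => velDeriv_modelSpray_line hA hℓ p s) (hasDerivAt_const t 0)
    simp only [jacobiEndo]
    rw [posDeriv_modelSpray_line hA hℓ, hf, velDeriv_modelSpray_line hA hℓ]
    simp
  have hd0 : ∀ t : ℝ, HasDerivAt (fun t : ℝ => A 0 + t • A 1 + (t ^ 2 / 2) • A 2)
      (A 1 + t • A 2) t := fun t => by
    have h1 := ((hasDerivAt_id t).smul_const (A 1)).const_add (A 0)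
    have h2 := (((hasDerivAt_id t).pow 2).div_const 2).smul_const (A 2)
    refine (h1.add h2).congr_deriv ?_
    simp
  have h1 : ∀ t : ℝ, jacobiEndo (modelSpray ℓ A p) 1 (p + t • e, e) = A 1 + t • A 2 := fun t => by
    have hf := flowDeriv_modelSpray_line (t := t) (ℓ := ℓ) hA p (hJ 0) h0 (hd0 t)
    show flowDeriv _ (jacobiEndo (modelSpray ℓ A p) 0) _ + _ = _
    rw [hf, velDeriv_modelSpray_line hA hℓ]
    simp
  have hd1 : HasDerivAt (fun t : ℝ => A 1 + t • A 2) (A 2) 0 := by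
    simpa using ((hasDerivAt_id (0 : ℝ)).smul_const (A 2)).const_add (A 1)
  have h2 : jacobiEndo (modelSpray ℓ A p) 2 (p + (0 : ℝ) • e, e) = A 2 := by
    have hf := flowDeriv_modelSpray_line (ℓ := ℓ) hA p (hJ 1) h1 hd1
    show flowDeriv _ (jacobiEndo (modelSpray ℓ A p) 1) _ + _ = _
    rw [hf, velDeriv_modelSpray_line hA hℓ]
    simp
  fin_cases k
  · simpa using h0 0
  · simpa using h1 0
  · simpa using h2

end ModelSpray

/-! ### Polynomial families of second order equations -/

section PolyFamily

variable {Z F F' G : Type*} [NormedAddCommGroup Z] [NormedSpace ℝ Z] [NormedAddCommGroup F]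
  [NormedSpace ℝ F] [NormedAddCommGroup F'] [NormedSpace ℝ F'] [NormedAddCommGroup G]
  [NormedSpace ℝ G] {W : Set Z}

/-- A family of functions depending polynomially on a real parameter, with smooth coefficients. -/
def PolyFamily (W : Set Z) (f : ℝ → Z → F) : Prop :=
  ∃ (m : ℕ) (d : Fin m → ℕ) (a : Fin m → Z → F), (∀ i, ContDiffOn ℝ ∞ (a i) W) ∧
    ∀ s, ∀ z ∈ W, f s z = ∑ i, s ^ d i • a i z

theorem PolyFamily.of_fintype {ι : Type*} [Fintype ι] {f : ℝ → Z → F} (d : ι → ℕ) (a : ι → Z → F)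
    (ha : ∀ i, ContDiffOn ℝ ∞ (a i) W) (hf : ∀ s, ∀ z ∈ W, f s z = ∑ i, s ^ d i • a i z) :
    PolyFamily W f := by
  let e := (Fintype.equivFin ι).symm
  refine ⟨_, d ∘ e, fun i => a (e i), fun i => ha _, fun s z hz => ?_⟩
  rw [hf s z hz]
  exact (e.sum_comp fun i => s ^ d i • a i z).symm

theorem PolyFamily.of_const {g : Z → F} (hg : ContDiffOn ℝ ∞ g W) : PolyFamily W fun _ => g :=
  PolyFamily.of_fintype (ι := Unit) (fun _ => 0) (fun _ => g) (fun _ => hg) (by simp)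

theorem PolyFamily.add {f g : ℝ → Z → F} (hf : PolyFamily W f) (hg : PolyFamily W g) :
    PolyFamily W fun s z => f s z + g s z := by
  obtain ⟨m, d, a, ha, hfa⟩ := hf
  obtain ⟨m', d', a', ha', hga⟩ := hg
  refine PolyFamily.of_fintype (Sum.elim d d') (Sum.elim a a') (fun i => ?_) fun s z hz => ?_
  · cases i
    exacts [ha _, ha' _]
  · simp [hfa s z hz, hga s z hz]

theorem PolyFamily.bilin (B : F →L[ℝ] F' →L[ℝ] G) {f : ℝ → Z → F} {g : ℝ → Z → F'}
    (hf : PolyFamily W f) (hg : PolyFamily W g) : PolyFamily W fun s z => B (f s z) (g s z) := by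
  obtain ⟨m, d, a, ha, hfa⟩ := hf
  obtain ⟨m', d', a', ha', hga⟩ := hg
  refine PolyFamily.of_fintype (ι := Fin m × Fin m') (fun i => d i.1 + d' i.2)
    (fun i z => B (a i.1 z) (a' i.2 z)) (fun i => ?_) fun s z hz => ?_
  · exact (B.contDiff.comp_contDiffOn (ha i.1)).clm_apply (ha' i.2)
  · rw [hfa s z hz, hga s z hz, map_sum B, sum_apply, Fintype.sum_prod_type]
    refine Finset.sum_congr rfl fun i _ => ?_
    rw [map_sum]
    refine Finset.sum_congr rfl fun j _ => ?_
    rw [map_smul, map_smul, smul_apply, smul_smul, pow_add, mul_comm]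

theorem PolyFamily.clm (B : F →L[ℝ] G) {f : ℝ → Z → F} (hf : PolyFamily W f) :
    PolyFamily W fun s z => B (f s z) := by
  obtain ⟨m, d, a, ha, hfa⟩ := hf
  refine ⟨m, d, fun i z => B (a i z), fun i => B.contDiff.comp_contDiffOn (ha i), fun s z hz => ?_⟩
  simp [hfa s z hz]

theorem PolyFamily.fderiv (hW : IsOpen W) {f : ℝ → Z → F} (hf : PolyFamily W f) :
    PolyFamily W fun s z => fderiv ℝ (f s) z := by
  obtain ⟨m, d, a, ha, hfa⟩ := hf
  refine ⟨m, d, fun i => _root_.fderiv ℝ (a i), fun i => contDiffOn_fderiv_of_isOpen hW (ha i),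
    fun s z hz => ?_⟩
  have he : f s =ᶠ[𝓝 z] fun y => ∑ i, s ^ d i • a i y :=
    Filter.eventually_of_mem (hW.mem_nhds hz) fun y hy => hfa s y hy
  have hd : ∀ i, DifferentiableAt ℝ (a i) z := fun i =>
    ContDiffOn.differentiableAt_of_isOpen hW (ha i) hz
  show _root_.fderiv ℝ (f s) z = _
  rw [he.fderiv_eq]
  exact (HasFDerivAt.fun_sum fun i _ => (hd i).hasFDerivAt.const_smul (s ^ d i)).fderiv

/-- Polynomial dependence is used to obtain analyticity in the parameter, although the coefficients
are merely smooth in `z`. This is what the identity theorem needs in the proof of density. -/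
theorem PolyFamily.contDiff {f : ℝ → Z → F} (hf : PolyFamily W f) {z : Z} (hz : z ∈ W) :
    ContDiff ℝ ω fun s => f s z := by
  obtain ⟨m, d, a, ha, hfa⟩ := hf
  have : (fun s => f s z) = fun s => ∑ i, s ^ d i • a i z := funext fun s => hfa s z hz
  rw [this]
  exact ContDiff.sum fun i _ => (contDiff_id.pow _).smul contDiff_const

end PolyFamily

/-! ### Jacobi endomorphisms of polynomial families -/

section PolyJacobi

variable {V F : Type*} [NormedAddCommGroup V] [NormedSpace ℝ V]
  [NormedAddCommGroup F] [NormedSpace ℝ F] {W : Set (V × V)} {S : ℝ → V × V → V}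

theorem PolyFamily.flowDeriv (hW : IsOpen W) (hS : PolyFamily W S) {f : ℝ → V × V → F}
    (hf : PolyFamily W f) : PolyFamily W fun s => ProjVar.flowDeriv (S s) (f s) := by
  have h1 : PolyFamily W fun s z => ((z.2, S s z) : V × V) := by
    have h := (PolyFamily.of_const (W := W)
      ((ContinuousLinearMap.inl ℝ V V).contDiff.comp contDiff_snd).contDiffOn).add
        (hS.clm (ContinuousLinearMap.inr ℝ V V))
    simpa using h
  exact (hf.fderiv hW).bilin (ContinuousLinearMap.id ℝ (V × V →L[ℝ] F)) h1

theorem PolyFamily.jacobiEndo (hW : IsOpen W) (hS : PolyFamily W S) (k : ℕ) :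
    PolyFamily W fun s => ProjVar.jacobiEndo (S s) k := by
  have hB : PolyFamily W fun s => velDeriv (S s) :=
    (hS.fderiv hW).clm ((ContinuousLinearMap.compL ℝ V (V × V) V).flip
      (ContinuousLinearMap.inr ℝ V V))
  have hC : PolyFamily W fun s => posDeriv (S s) :=
    (hS.fderiv hW).clm ((ContinuousLinearMap.compL ℝ V (V × V) V).flip
      (ContinuousLinearMap.inl ℝ V V))
  have hcomp : ∀ {f g : ℝ → V × V → V →L[ℝ] V}, PolyFamily W f → PolyFamily W g →
      PolyFamily W fun s z => (f s z).comp (g s z) := fun hf hg =>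
    hf.bilin (ContinuousLinearMap.compL ℝ V V V) hg
  have hsmul : ∀ (c : ℝ) {f : ℝ → V × V → V →L[ℝ] V}, PolyFamily W f →
      PolyFamily W fun s z => c • f s z := fun c f hf =>
    hf.clm (c • ContinuousLinearMap.id ℝ (V →L[ℝ] V))
  induction k with
  | zero =>
    have := (hC.add (hsmul (-(1 / 2)) (hS.flowDeriv hW hB))).add (hsmul (1 / 4) (hcomp hB hB))
    simpa only [ProjVar.jacobiEndo, neg_smul, ← sub_eq_add_neg] using this
  | succ k ih =>
    have := (hS.flowDeriv hW ih).add (hsmul (1 / 2)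
      ((hcomp ih hB).add (hsmul (-1) (hcomp hB ih))))
    simpa only [ProjVar.jacobiEndo, neg_smul, one_smul, ← sub_eq_add_neg] using this

end PolyJacobi

/-! ### Convergence of jets -/

section JetTendsto

variable {T Z F F' G : Type*} [NormedAddCommGroup Z] [NormedSpace ℝ Z] [NormedAddCommGroup F]
  [NormedSpace ℝ F] [NormedAddCommGroup F'] [NormedSpace ℝ F'] [NormedAddCommGroup G]
  [NormedSpace ℝ G] {W : Set Z} {z₀ : Z} {N : ℕ} {𝓕 : Filter T}

/-- The functions `f t`, smooth on `W`, converge along `𝓕` to `f₀` at `z₀` together with their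
derivatives up to order `N`. -/
structure JetTendsto (𝓕 : Filter T) (W : Set Z) (z₀ : Z) (N : ℕ) (f : T → Z → F) (f₀ : Z → F) :
    Prop where
  smooth : ∀ t, ContDiffOn ℝ ∞ (f t) W
  smooth_lim : ContDiffOn ℝ ∞ f₀ W
  tendsto : ∀ m ≤ N,
    Filter.Tendsto (fun t => ‖iteratedFDeriv ℝ m (fun z => f t z - f₀ z) z₀‖) 𝓕 (𝓝 0)

theorem JetTendsto.mono {N' : ℕ} (hN : N' ≤ N) {f : T → Z → F} {f₀ : Z → F}
    (h : JetTendsto 𝓕 W z₀ N f f₀) : JetTendsto 𝓕 W z₀ N' f f₀ :=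
  ⟨h.smooth, h.smooth_lim, fun m hm => h.tendsto m (hm.trans hN)⟩

theorem JetTendsto.of_const {f₀ : Z → F} (h : ContDiffOn ℝ ∞ f₀ W) :
    JetTendsto 𝓕 W z₀ N (fun _ => f₀) f₀ := by
  refine ⟨fun _ => h, h, fun m _ => ?_⟩
  have : (fun z => f₀ z - f₀ z) = fun _ => 0 := funext fun z => sub_self _
  simp only [this]
  have h0 : iteratedFDeriv ℝ m (fun _ : Z => (0 : F)) z₀ = 0 := by
    rw [iteratedFDeriv_fun_zero]; rfl
  simpa [h0] using tendsto_const_nhds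

theorem JetTendsto.value {f : T → Z → F} {f₀ : Z → F} (h : JetTendsto 𝓕 W z₀ N f f₀) :
    Filter.Tendsto (fun t => f t z₀) 𝓕 (𝓝 (f₀ z₀)) := by
  have := h.tendsto 0 (Nat.zero_le _)
  simp only [norm_iteratedFDeriv_zero] at this
  exact tendsto_iff_norm_sub_tendsto_zero.2 this

theorem contDiffAt_of_contDiffOn_isOpen (hW : IsOpen W) (hz : z₀ ∈ W) {f : Z → F}
    (hf : ContDiffOn ℝ ∞ f W) (m : ℕ) : ContDiffAt ℝ m f z₀ :=
  (hf.contDiffAt (hW.mem_nhds hz)).of_le (mod_cast le_top)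

theorem JetTendsto.add (hW : IsOpen W) (hz : z₀ ∈ W) {f g : T → Z → F} {f₀ g₀ : Z → F}
    (hf : JetTendsto 𝓕 W z₀ N f f₀) (hg : JetTendsto 𝓕 W z₀ N g g₀) :
    JetTendsto 𝓕 W z₀ N (fun t z => f t z + g t z) (fun z => f₀ z + g₀ z) := by
  refine ⟨fun t => (hf.smooth t).add (hg.smooth t), hf.smooth_lim.add hg.smooth_lim,
    fun m hm => ?_⟩
  refine squeeze_zero (fun _ => norm_nonneg _) (fun t => ?_)
    (by simpa using (hf.tendsto m hm).add (hg.tendsto m hm))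
  have he : (fun z => f t z + g t z - (f₀ z + g₀ z)) =
      (fun z => f t z - f₀ z) + fun z => g t z - g₀ z := by
    funext z; simp only [Pi.add_apply]; abel
  rw [he, iteratedFDeriv_add_apply
    (contDiffAt_of_contDiffOn_isOpen hW hz ((hf.smooth t).sub hf.smooth_lim) m)
    (contDiffAt_of_contDiffOn_isOpen hW hz ((hg.smooth t).sub hg.smooth_lim) m)]
  exact norm_add_le _ _

theorem JetTendsto.sum (hW : IsOpen W) (hz : z₀ ∈ W) {ι : Type*} (s : Finset ι)
    {f : ι → T → Z → F} {f₀ : ι → Z → F} (hf : ∀ i, JetTendsto 𝓕 W z₀ N (f i) (f₀ i)) :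
    JetTendsto 𝓕 W z₀ N (fun t z => ∑ i ∈ s, f i t z) (fun z => ∑ i ∈ s, f₀ i z) := by
  classical
  induction s using Finset.induction_on with
  | empty => simpa using JetTendsto.of_const (f₀ := fun _ : Z => (0 : F)) contDiffOn_const
  | insert i s hi ih =>
    simp only [Finset.sum_insert hi]
    exact (hf i).add hW hz ih

theorem JetTendsto.clm (hW : IsOpen W) (hz : z₀ ∈ W) (B : F →L[ℝ] G) {f : T → Z → F} {f₀ : Z → F}
    (hf : JetTendsto 𝓕 W z₀ N f f₀) :
    JetTendsto 𝓕 W z₀ N (fun t z => B (f t z)) (fun z => B (f₀ z)) := by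
  refine ⟨fun t => B.contDiff.comp_contDiffOn (hf.smooth t),
    B.contDiff.comp_contDiffOn hf.smooth_lim, fun m hm => ?_⟩
  refine squeeze_zero (fun _ => norm_nonneg _) (fun t => ?_)
    (by simpa using (hf.tendsto m hm).const_mul ‖B‖)
  have he : (fun z => B (f t z) - B (f₀ z)) = B ∘ fun z => f t z - f₀ z := by
    funext z; simp
  rw [he]
  exact B.norm_iteratedFDeriv_comp_left
    (contDiffAt_of_contDiffOn_isOpen hW hz ((hf.smooth t).sub hf.smooth_lim) m) le_rfl

/-- The Leibniz bound is a sum of products of norms of derivatives. The condition `α i * β j = 0`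
expresses that in each product one limit is zero, so that small times bounded and small times small
are treated together. -/
theorem tendsto_norm_iteratedFDeriv_bilin (hW : IsOpen W) (hz : z₀ ∈ W) (B : F →L[ℝ] F' →L[ℝ] G)
    {a : T → Z → F} {b : T → Z → F'} (ha : ∀ t, ContDiffOn ℝ ∞ (a t) W)
    (hb : ∀ t, ContDiffOn ℝ ∞ (b t) W) {α β : ℕ → ℝ} (hαβ : ∀ i j, α i * β j = 0)
    (hα : ∀ m ≤ N, Filter.Tendsto (fun t => ‖iteratedFDeriv ℝ m (a t) z₀‖) 𝓕 (𝓝 (α m)))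
    (hβ : ∀ m ≤ N, Filter.Tendsto (fun t => ‖iteratedFDeriv ℝ m (b t) z₀‖) 𝓕 (𝓝 (β m)))
    {m : ℕ} (hm : m ≤ N) :
    Filter.Tendsto (fun t => ‖iteratedFDeriv ℝ m (fun z => B (a t z) (b t z)) z₀‖) 𝓕 (𝓝 0) := by
  have hlim : Filter.Tendsto (fun t => ‖B‖ * ∑ i ∈ Finset.range (m + 1), (m.choose i : ℝ) *
      ‖iteratedFDeriv ℝ i (a t) z₀‖ * ‖iteratedFDeriv ℝ (m - i) (b t) z₀‖) 𝓕 (𝓝 0) := by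
    have h := (tendsto_finsetSum (Finset.range (m + 1)) fun i hi =>
      ((hα i (by have := Finset.mem_range.1 hi; omega)).const_mul (m.choose i : ℝ)).mul
        (hβ (m - i) (by omega))).const_mul ‖B‖
    simpa [mul_assoc, hαβ] using h
  refine squeeze_zero (fun _ => norm_nonneg _) (fun t => ?_) hlim
  have h := B.norm_iteratedFDerivWithin_le_of_bilinear (ha t) (hb t) hW.uniqueDiffOn hz
    (n := m) (mod_cast le_top)
  simpa only [iteratedFDerivWithin_of_isOpen _ hW hz] using h

theorem JetTendsto.bilin (hW : IsOpen W) (hz : z₀ ∈ W) (B : F →L[ℝ] F' →L[ℝ] G)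
    {f : T → Z → F} {f₀ : Z → F} {g : T → Z → F'} {g₀ : Z → F'}
    (hf : JetTendsto 𝓕 W z₀ N f f₀) (hg : JetTendsto 𝓕 W z₀ N g g₀) :
    JetTendsto 𝓕 W z₀ N (fun t z => B (f t z) (g t z)) (fun z => B (f₀ z) (g₀ z)) := by
  have hsm : ∀ {a : Z → F} {b : Z → F'}, ContDiffOn ℝ ∞ a W → ContDiffOn ℝ ∞ b W →
      ContDiffOn ℝ ∞ (fun z => B (a z) (b z)) W := fun ha hb =>
    (B.contDiff.comp_contDiffOn ha).clm_apply hb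
  have hdf := fun t => (hf.smooth t).sub hf.smooth_lim
  have hdg := fun t => (hg.smooth t).sub hg.smooth_lim
  refine ⟨fun t => hsm (hf.smooth t) (hg.smooth t), hsm hf.smooth_lim hg.smooth_lim,
    fun m hm => ?_⟩
  have h1 := tendsto_norm_iteratedFDeriv_bilin (α := fun _ => 0) (β := fun _ => 0) hW hz B hdf hdg
    (by simp) hf.tendsto hg.tendsto hm
  have h2 := tendsto_norm_iteratedFDeriv_bilin (𝓕 := 𝓕) (a := fun _ => f₀) (β := fun _ => 0) hW hz B
    (fun _ => hf.smooth_lim) hdg (by simp) (fun m _ => tendsto_const_nhds) hg.tendsto hm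
  have h3 := tendsto_norm_iteratedFDeriv_bilin (𝓕 := 𝓕) (b := fun _ => g₀) (α := fun _ => 0) hW hz B
    hdf (fun _ => hg.smooth_lim) (by simp) hf.tendsto (fun m _ => tendsto_const_nhds) hm
  refine squeeze_zero (fun _ => norm_nonneg _) (fun t => ?_) (by
    have := (h1.add h2).add h3
    rwa [add_zero, add_zero] at this)
  -- The difference of products is expanded as small times small, plus fixed times small, plus small
  -- times fixed.
  have he : (fun z => B (f t z) (g t z) - B (f₀ z) (g₀ z)) =
      ((fun z => B (f t z - f₀ z) (g t z - g₀ z)) + fun z => B (f₀ z) (g t z - g₀ z)) +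
        fun z => B (f t z - f₀ z) (g₀ z) := by
    funext z
    simp only [Pi.add_apply, map_sub, sub_apply]
    abel
  have c1 := contDiffAt_of_contDiffOn_isOpen hW hz (hsm (hdf t) (hdg t)) m
  have c2 := contDiffAt_of_contDiffOn_isOpen hW hz (hsm hf.smooth_lim (hdg t)) m
  have c3 := contDiffAt_of_contDiffOn_isOpen hW hz (hsm (hdf t) hg.smooth_lim) m
  have c12 : ContDiffAt ℝ m ((fun z => B (f t z - f₀ z) (g t z - g₀ z)) +
      fun z => B (f₀ z) (g t z - g₀ z)) z₀ := c1.add c2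
  rw [he, iteratedFDeriv_add_apply c12 c3, iteratedFDeriv_add_apply c1 c2]
  exact norm_add₃_le

theorem JetTendsto.fderiv (hW : IsOpen W) (hz : z₀ ∈ W) {f : T → Z → F} {f₀ : Z → F}
    (hf : JetTendsto 𝓕 W z₀ (N + 1) f f₀) :
    JetTendsto 𝓕 W z₀ N (fun t => fderiv ℝ (f t)) (fderiv ℝ f₀) := by
  refine ⟨fun t => contDiffOn_fderiv_of_isOpen hW (hf.smooth t),
    contDiffOn_fderiv_of_isOpen hW hf.smooth_lim, fun m hm => ?_⟩
  refine (hf.tendsto (m + 1) (by omega)).congr fun t => ?_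
  rw [← norm_iteratedFDeriv_fderiv]
  congr 1
  refine Filter.EventuallyEq.eq_of_nhds (Filter.EventuallyEq.iteratedFDeriv ℝ ?_ m)
  filter_upwards [hW.mem_nhds hz] with z hz'
  exact fderiv_fun_sub (ContDiffOn.differentiableAt_of_isOpen hW (hf.smooth t) hz')
    (ContDiffOn.differentiableAt_of_isOpen hW hf.smooth_lim hz')

/-- Jet convergence for functions of the first variable. -/
theorem JetTendsto.comp_clm {Z' : Type*} [NormedAddCommGroup Z'] [NormedSpace ℝ Z']
    (hW : IsOpen W) (L : Z' →L[ℝ] Z) {z₁ : Z'} (hz : L z₁ ∈ W) {f : T → Z → F} {f₀ : Z → F}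
    (hf : JetTendsto 𝓕 W (L z₁) N f f₀) :
    JetTendsto 𝓕 (L ⁻¹' W) z₁ N (fun t z => f t (L z)) (fun z => f₀ (L z)) := by
  have hc : ∀ {a : Z → F}, ContDiffOn ℝ ∞ a W → ContDiffOn ℝ ∞ (fun z => a (L z)) (L ⁻¹' W) :=
    fun ha => ha.comp L.contDiff.contDiffOn (mapsTo_preimage _ _)
  refine ⟨fun t => hc (hf.smooth t), hc hf.smooth_lim, fun m hm => ?_⟩
  have hW' : IsOpen (L ⁻¹' W) := hW.preimage L.continuous
  refine squeeze_zero (fun _ => norm_nonneg _) (fun t => ?_)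
    (by simpa using (hf.tendsto m hm).mul_const (∏ _i : Fin m, ‖L‖))
  have h := L.iteratedFDerivWithin_comp_right ((hf.smooth t).sub hf.smooth_lim) hW.uniqueDiffOn
    hW'.uniqueDiffOn hz (i := m) (mod_cast le_top)
  rw [iteratedFDerivWithin_of_isOpen _ hW hz, iteratedFDerivWithin_of_isOpen _ hW' hz] at h
  rw [show (fun z => f t (L z) - f₀ (L z)) = (fun z => f t z - f₀ z) ∘ L from rfl, h]
  exact (ContinuousMultilinearMap.norm_compContinuousLinearMap_le
    (iteratedFDeriv ℝ m (fun z => f t z - f₀ z) (L z₁)) fun _ => L).trans_eq (by simp)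

end JetTendsto

/-! ### Convergence of Jacobi endomorphisms -/

section JetJacobi

variable {T V F : Type*} [NormedAddCommGroup V] [NormedSpace ℝ V] [NormedAddCommGroup F]
  [NormedSpace ℝ F] {W : Set (V × V)} {z₀ : V × V} {N : ℕ} {𝓕 : Filter T}
  {S : T → V × V → V} {S₀ : V × V → V}

theorem JetTendsto.flowDeriv (hW : IsOpen W) (hz : z₀ ∈ W) (hS : JetTendsto 𝓕 W z₀ N S S₀)
    {f : T → V × V → F} {f₀ : V × V → F} (hf : JetTendsto 𝓕 W z₀ (N + 1) f f₀) :
    JetTendsto 𝓕 W z₀ N (fun t => ProjVar.flowDeriv (S t) (f t)) (ProjVar.flowDeriv S₀ f₀) := by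
  have h1 : JetTendsto 𝓕 W z₀ N (fun t z => ((z.2, S t z) : V × V)) fun z => (z.2, S₀ z) := by
    have h := (JetTendsto.of_const (𝓕 := 𝓕) (W := W) (z₀ := z₀) (N := N)
      ((ContinuousLinearMap.inl ℝ V V).contDiff.comp contDiff_snd).contDiffOn).add hW hz
        (hS.clm hW hz (ContinuousLinearMap.inr ℝ V V))
    simpa using h
  exact (hf.fderiv hW hz).bilin hW hz (ContinuousLinearMap.id ℝ (V × V →L[ℝ] F)) h1

/-- Two derivatives of `S` are lost at `k = 0`, one for `velDeriv` and one for its flow derivative,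
and one more with each further covariant derivative. This is the source of the order four. -/
theorem JetTendsto.jacobiEndo (hW : IsOpen W) (hz : z₀ ∈ W) (k : ℕ)
    (hS : JetTendsto 𝓕 W z₀ (N + k + 2) S S₀) :
    JetTendsto 𝓕 W z₀ N (fun t => ProjVar.jacobiEndo (S t) k) (ProjVar.jacobiEndo S₀ k) := by
  have hB : ∀ {N}, JetTendsto 𝓕 W z₀ (N + 1) S S₀ →
      JetTendsto 𝓕 W z₀ N (fun t => velDeriv (S t)) (velDeriv S₀) := fun h =>
    (h.fderiv hW hz).clm hW hz ((ContinuousLinearMap.compL ℝ V (V × V) V).flip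
      (ContinuousLinearMap.inr ℝ V V))
  have hC : ∀ {N}, JetTendsto 𝓕 W z₀ (N + 1) S S₀ →
      JetTendsto 𝓕 W z₀ N (fun t => posDeriv (S t)) (posDeriv S₀) := fun h =>
    (h.fderiv hW hz).clm hW hz ((ContinuousLinearMap.compL ℝ V (V × V) V).flip
      (ContinuousLinearMap.inl ℝ V V))
  have hcomp : ∀ {N : ℕ} {f g : T → V × V → V →L[ℝ] V} {f₀ g₀ : V × V → V →L[ℝ] V},
      JetTendsto 𝓕 W z₀ N f f₀ → JetTendsto 𝓕 W z₀ N g g₀ →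
      JetTendsto 𝓕 W z₀ N (fun t z => (f t z).comp (g t z)) (fun z => (f₀ z).comp (g₀ z)) :=
    fun hf hg => hf.bilin hW hz (ContinuousLinearMap.compL ℝ V V V) hg
  have hsmul : ∀ (c : ℝ) {N : ℕ} {f : T → V × V → V →L[ℝ] V} {f₀ : V × V → V →L[ℝ] V},
      JetTendsto 𝓕 W z₀ N f f₀ → JetTendsto 𝓕 W z₀ N (fun t z => c • f t z) (fun z => c • f₀ z) :=
    fun c _ f f₀ hf => hf.clm hW hz (c • ContinuousLinearMap.id ℝ (V →L[ℝ] V))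
  induction k generalizing N with
  | zero =>
    have h1 := hS.mono (N' := N + 1) (by omega)
    have := ((hC h1).add hW hz (hsmul (-(1 / 2)) ((hS.mono (N' := N) (by omega)).flowDeriv hW hz
      (hB hS)))).add hW hz (hsmul (1 / 4) (hcomp (hB h1) (hB h1)))
    simpa only [ProjVar.jacobiEndo, neg_smul, ← sub_eq_add_neg] using this
  | succ k ih =>
    have ih1 := ih (N := N + 1) (hS.mono (by omega))
    have ih0 := ih1.mono (N' := N) (by omega)
    have h1 := hB (hS.mono (N' := N + 1) (by omega))
    have := ((hS.mono (N' := N) (by omega)).flowDeriv hW hz ih1).add hW hz (hsmul (1 / 2)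
      ((hcomp ih0 h1).add hW hz (hsmul (-1) (hcomp h1 ih0))))
    simpa only [ProjVar.jacobiEndo, neg_smul, one_smul, ← sub_eq_add_neg] using this

end JetJacobi

/-! ### Christoffel symbols -/

section Christoffel

variable {n : ℕ} {M : Type*} [TopologicalSpace M] [ChartedSpace (Model n) M]
  [IsManifold 𝓘(ℝ, Model n) ∞ M]

theorem chartAt_mem_charts (p : M) : chartAt (Model n) p ∈ charts n M :=
  IsManifold.chart_mem_maximalAtlas p

variable {e : OpenPartialHomeomorph M (Model n)}

theorem charts_mdifferentiable (he : e ∈ charts n M) :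
    e.MDifferentiable 𝓘(ℝ, Model n) 𝓘(ℝ, Model n) :=
  ⟨(contMDiffOn_of_mem_maximalAtlas he).mdifferentiableOn (by simp),
    (contMDiffOn_symm_of_mem_maximalAtlas he).mdifferentiableOn (by simp)⟩

theorem isInvertible_mfderiv_chart (he : e ∈ charts n M) {q : M} (hq : q ∈ e.source) :
    (mfderiv 𝓘(ℝ, Model n) 𝓘(ℝ, Model n) e q).IsInvertible :=
  ⟨(charts_mdifferentiable he).mfderiv hq, rfl⟩

theorem inverse_mfderiv_chart (he : e ∈ charts n M) {q : M} (hq : q ∈ e.source) :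
    (mfderiv 𝓘(ℝ, Model n) 𝓘(ℝ, Model n) e q).inverse =
      mfderiv 𝓘(ℝ, Model n) 𝓘(ℝ, Model n) e.symm (e q) :=
  ContinuousLinearMap.inverse_equiv ((charts_mdifferentiable he).mfderiv hq)

theorem coordField_eq (he : e ∈ charts n M) {q : M} (hq : q ∈ e.source) (v : Model n) :
    coordField e v q = mfderiv 𝓘(ℝ, Model n) 𝓘(ℝ, Model n) e.symm (e q) v :=
  congrArg (fun L => L v) (inverse_mfderiv_chart he hq)

theorem mfderiv_coordField (he : e ∈ charts n M) {q : M} (hq : q ∈ e.source) (v : Model n) :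
    mfderiv 𝓘(ℝ, Model n) 𝓘(ℝ, Model n) e q (coordField e v q) = v := by
  rw [coordField_eq he hq]
  exact ((charts_mdifferentiable he).mfderiv hq).apply_symm_apply v

theorem coordField_mfderiv (he : e ∈ charts n M) {q : M} (hq : q ∈ e.source)
    (w : TangentSpace 𝓘(ℝ, Model n) q) :
    coordField e (mfderiv 𝓘(ℝ, Model n) 𝓘(ℝ, Model n) e q w) q = w := by
  exact (coordField_eq he hq _).trans (((charts_mdifferentiable he).mfderiv hq).symm_apply_apply w)

theorem coordField_add (v w : Model n) :
    coordField e (v + w) = coordField e v + coordField (M := M) e w := by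
  funext q; exact map_add _ _ _

theorem coordField_smul (a : ℝ) (v : Model n) :
    coordField e (a • v) = a • coordField (M := M) e v := by
  funext q; exact map_smul _ _ _

theorem contMDiffAt_coordField (he : e ∈ charts n M) {q : M} (hq : q ∈ e.source) (v : Model n) :
    ContMDiffAt 𝓘(ℝ, Model n) (𝓘(ℝ, Model n).prod 𝓘(ℝ, Model n)) ∞
      (fun p => (⟨p, coordField e v p⟩ : TangentBundle 𝓘(ℝ, Model n) M)) q :=
  ContMDiffAt.mpullback_vectorField_preimage (n := ∞)
    (contMDiffAt_vectorSpace_iff_contDiffAt.2 contDiffAt_const)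
    (contMDiffAt_of_mem_maximalAtlas he hq) (isInvertible_mfderiv_chart he hq) (by simp)

theorem mdifferentiableAt_coordField (he : e ∈ charts n M) {q : M} (hq : q ∈ e.source)
    (v : Model n) : MDifferentiableAt 𝓘(ℝ, Model n) (𝓘(ℝ, Model n).prod 𝓘(ℝ, Model n))
      (fun p => (⟨p, coordField e v p⟩ : TangentBundle 𝓘(ℝ, Model n) M)) q :=
  (contMDiffAt_coordField he hq v).mdifferentiableAt (by simp)

variable (D : AffineConnection n M)

theorem AffineConnection.christoffel_add_left (x u u' v : Model n) :
    D.christoffel e x (u + u') v = D.christoffel e x u v + D.christoffel e x u' v := by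
  unfold AffineConnection.christoffel
  rw [coordField_add, Pi.add_apply, map_add, map_add]
  rfl

theorem AffineConnection.christoffel_smul_left (x : Model n) (a : ℝ) (u v : Model n) :
    D.christoffel e x (a • u) v = a • D.christoffel e x u v := by
  unfold AffineConnection.christoffel
  rw [coordField_smul, Pi.smul_apply, map_smul, map_smul]
  rfl

theorem AffineConnection.christoffel_add_right (he : e ∈ charts n M) {x : Model n}
    (hx : x ∈ e.target) (u v v' : Model n) :
    D.christoffel e x u (v + v') = D.christoffel e x u v + D.christoffel e x u v' := by
  unfold AffineConnection.christoffel
  rw [coordField_add, D.cov.isCovariantDerivativeOnUniv.add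
    (mdifferentiableAt_coordField he (e.map_target hx) v)
    (mdifferentiableAt_coordField he (e.map_target hx) v'), add_apply, map_add]
  rfl

theorem AffineConnection.christoffel_smul_right (he : e ∈ charts n M) {x : Model n}
    (hx : x ∈ e.target) (a : ℝ) (u v : Model n) :
    D.christoffel e x u (a • v) = a • D.christoffel e x u v := by
  unfold AffineConnection.christoffel
  rw [coordField_smul, D.cov.isCovariantDerivativeOnUniv.smul_const a
    (mdifferentiableAt_coordField he (e.map_target hx) v), smul_apply, map_smul]
  rfl

/-- A section that is smooth near a point agrees near this point with a global smooth section. -/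
theorem exists_contMDiff_eventuallyEq [T2Space M] {σ : Π q : M, TangentSpace 𝓘(ℝ, Model n) q}
    {u : Set M} (hu : IsOpen u) {p : M} (hp : p ∈ u)
    (hσ : ContMDiffOn 𝓘(ℝ, Model n) (𝓘(ℝ, Model n).prod 𝓘(ℝ, Model n)) ∞
      (fun q => (⟨q, σ q⟩ : TangentBundle 𝓘(ℝ, Model n) M)) u) :
    ∃ σ' : Π q : M, TangentSpace 𝓘(ℝ, Model n) q,
      ContMDiff 𝓘(ℝ, Model n) (𝓘(ℝ, Model n).prod 𝓘(ℝ, Model n)) ∞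
        (fun q => (⟨q, σ' q⟩ : TangentBundle 𝓘(ℝ, Model n) M)) ∧ ∀ᶠ q in 𝓝 p, σ q = σ' q := by
  obtain ⟨ψ, -, hψ⟩ := (SmoothBumpFunction.nhds_basis_tsupport (I := 𝓘(ℝ, Model n)) p).mem_iff.1
    (hu.mem_nhds hp)
  refine ⟨(ψ : M → ℝ) • σ, ContMDiffOn.smul_section_of_tsupport ψ.contMDiff.contMDiffOn hu hψ hσ, ?_⟩
  filter_upwards [ψ.eventuallyEq_one] with q hq
  simp [hq]

/-- Smoothness of `D` is applied to global smooth sections, so the local section is first replaced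
by a global one with the same germ; the covariant derivative depends only on the germ. -/
theorem AffineConnection.contMDiffAt_cov [T2Space M] {σ : Π q : M, TangentSpace 𝓘(ℝ, Model n) q}
    {u : Set M} (hu : IsOpen u) {p : M} (hp : p ∈ u)
    (hσ : ContMDiffOn 𝓘(ℝ, Model n) (𝓘(ℝ, Model n).prod 𝓘(ℝ, Model n)) ∞
      (fun q => (⟨q, σ q⟩ : TangentBundle 𝓘(ℝ, Model n) M)) u) :
    ContMDiffAt 𝓘(ℝ, Model n) (𝓘(ℝ, Model n).prod 𝓘(ℝ, Model n →L[ℝ] Model n)) ∞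
      (fun q => TotalSpace.mk' (Model n →L[ℝ] Model n)
        (E := fun q : M => TangentSpace 𝓘(ℝ, Model n) q →L[ℝ] TangentSpace 𝓘(ℝ, Model n) q)
        q (D.cov σ q)) p := by
  obtain ⟨σ', hσ', he⟩ := exists_contMDiff_eventuallyEq hu hp hσ
  have h1 := (D.smooth.contMDiff.contMDiff (σ := σ') (by simpa using hσ'.contMDiffOn)).contMDiffAt
    (Filter.univ_mem : univ ∈ 𝓝 p)
  refine h1.congr_of_eventuallyEq ?_
  filter_upwards [he.eventually_nhds, hu.mem_nhds hp] with q hq hqu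
  have : D.cov σ q = D.cov σ' q :=
    D.cov.isCovariantDerivativeOnUniv.congr_of_eventuallyEq
      ((hσ.contMDiffAt (hu.mem_nhds hqu)).mdifferentiableAt (by simp))
      (hσ'.contMDiffAt.mdifferentiableAt (by simp)) Filter.univ_mem hq
  simp only [this]

theorem AffineConnection.contDiffOn_christoffel [T2Space M] (he : e ∈ charts n M) (u v : Model n) :
    ContDiffOn ℝ ∞ (fun x => D.christoffel e x u v) e.target := by
  intro x hx
  refine ContDiffAt.contDiffWithinAt ?_
  have hp := e.map_target hx
  have hY := (D.contMDiffAt_cov e.open_source hp fun q hq =>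
    (contMDiffAt_coordField he hq v).contMDiffWithinAt).clm_bundle_apply
      (contMDiffAt_coordField he hp u)
  have h := ContMDiffAt.mpullback_vectorField_preimage (n := ∞) (f := e.symm)
    (I := 𝓘(ℝ, Model n)) hY
    (contMDiffAt_symm_of_mem_maximalAtlas he hx)
    ⟨(charts_mdifferentiable he).symm.mfderiv hx, rfl⟩ (by simp)
  refine (contMDiffAt_vectorSpace_iff_contDiffAt.1 h).congr_of_eventuallyEq ?_
  filter_upwards [e.open_target.mem_nhds hx] with y hy
  have hi : (mfderiv 𝓘(ℝ, Model n) 𝓘(ℝ, Model n) e.symm y).inverse =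
      mfderiv 𝓘(ℝ, Model n) 𝓘(ℝ, Model n) e (e.symm y) :=
    ContinuousLinearMap.inverse_equiv ((charts_mdifferentiable he).symm.mfderiv hy)
  exact (congrArg (fun L => L (D.cov (coordField e v) (e.symm y) (coordField e u (e.symm y)))) hi).symm

end Christoffel

/-! ### Constructions of connections -/

section Constructions

variable {n : ℕ} {M : Type*} [TopologicalSpace M] [ChartedSpace (Model n) M]
  [IsManifold 𝓘(ℝ, Model n) ∞ M] {e : OpenPartialHomeomorph M (Model n)}

theorem sum_stdVec (u : Model n) : ∑ i, u i • stdVec i = u := by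
  simpa using (EuclideanSpace.basisFun (Fin (n + 1)) ℝ).sum_repr u

theorem AffineConnection.christoffel_eq_sum (D : AffineConnection n M) (he : e ∈ charts n M)
    {x : Model n} (hx : x ∈ e.target) (u v : Model n) :
    D.christoffel e x u v =
      ∑ i, ∑ j, (u i * v j) • D.christoffel e x (stdVec i) (stdVec j) := by
  let b : Model n →ₗ[ℝ] Model n →ₗ[ℝ] Model n := LinearMap.mk₂ ℝ (D.christoffel e x)
    (D.christoffel_add_left x) (D.christoffel_smul_left x) (D.christoffel_add_right he hx)
    fun a u v => D.christoffel_smul_right he hx a u v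
  show b u v = ∑ i, ∑ j, (u i * v j) • b (stdVec i) (stdVec j)
  conv_lhs => rw [← sum_stdVec u, ← sum_stdVec v]
  simp only [map_sum, map_smul, LinearMap.sum_apply, LinearMap.smul_apply, Finset.smul_sum,
    smul_smul]
  rw [Finset.sum_comm]
  simp only [mul_comm]

/-- The affine combination `c D + (1 - c) D'` of two connections. -/
def AffineConnection.lerp (D D' : AffineConnection n M) (c : ℝ) : AffineConnection n M :=
  ⟨D.cov.affineCombination D'.cov fun _ => c,
    CovariantDerivative.ContMDiffCovariantDerivative.affineCombination _ _ contMDiff_const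
      D.smooth D'.smooth⟩

theorem AffineConnection.christoffel_lerp (D D' : AffineConnection n M) (c : ℝ) (x u v : Model n) :
    (D.lerp D' c).christoffel e x u v =
      c • D.christoffel e x u v + (1 - c) • D'.christoffel e x u v := by
  have h : ∀ w, (D.lerp D' c).cov (coordField e v) (e.symm x) w =
      c • D.cov (coordField e v) (e.symm x) w + (1 - c) • D'.cov (coordField e v) (e.symm x) w :=
    fun w => rfl
  unfold AffineConnection.christoffel
  rw [h, map_add, map_smul, map_smul]
  rfl

/-- The translate of `D` by the difference of `D₂` and `D₁`. -/
def AffineConnection.translate (D D₁ D₂ : AffineConnection n M) : AffineConnection n M :=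
  -- The weights give `2 ((D + D₂) / 2) - D₁ = D + D₂ - D₁`.
  (D.lerp D₂ (1 / 2)).lerp D₁ 2

theorem AffineConnection.christoffel_translate (D D₁ D₂ : AffineConnection n M) (x u v : Model n) :
    (D.translate D₁ D₂).christoffel e x u v =
      D.christoffel e x u v + (D₂.christoffel e x u v - D₁.christoffel e x u v) := by
  rw [AffineConnection.translate, christoffel_lerp, christoffel_lerp]
  module

/-- Adding to a connection a smooth one-form with values in the endomorphisms. -/
def AffineConnection.addTensor (D : AffineConnection n M)
    (A : Π p : M, TangentSpace 𝓘(ℝ, Model n) p →L[ℝ] TangentSpace 𝓘(ℝ, Model n) p →L[ℝ]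
      TangentSpace 𝓘(ℝ, Model n) p)
    (hA : ContMDiff 𝓘(ℝ, Model n)
      (𝓘(ℝ, Model n).prod 𝓘(ℝ, Model n →L[ℝ] Model n →L[ℝ] Model n)) ∞
      (fun p : M => TotalSpace.mk' (Model n →L[ℝ] Model n →L[ℝ] Model n)
        (E := fun p : M => TangentSpace 𝓘(ℝ, Model n) p →L[ℝ] TangentSpace 𝓘(ℝ, Model n) p →L[ℝ]
          TangentSpace 𝓘(ℝ, Model n) p) p (A p))) : AffineConnection n M where
  cov := D.cov.addOneForm A
  smooth := ⟨⟨fun {σ} hσ => by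
    have hσ' : ContMDiffOn 𝓘(ℝ, Model n) (𝓘(ℝ, Model n).prod 𝓘(ℝ, Model n)) ∞
        (fun q => (⟨q, σ q⟩ : TangentBundle 𝓘(ℝ, Model n) M)) univ := by simpa using hσ
    have h1 := D.smooth.contMDiff.contMDiff hσ
    have h2 := hA.contMDiffOn.clm_bundle_apply hσ'
    exact ContMDiffOn.add_section h1 h2⟩⟩

theorem contMDiffOn_trivialization_symm {F : Type*} [NormedAddCommGroup F] [NormedSpace ℝ F]
    {E : M → Type*} [TopologicalSpace (TotalSpace F E)] [∀ x, TopologicalSpace (E x)]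
    [∀ x, AddCommGroup (E x)] [∀ x, Module ℝ (E x)] [FiberBundle F E] [VectorBundle ℝ F E]
    [ContMDiffVectorBundle ∞ F E 𝓘(ℝ, Model n)] (T : Trivialization F (TotalSpace.proj (E := E)))
    [MemTrivializationAtlas T] {f : M → F} (hf : ContMDiffOn 𝓘(ℝ, Model n) 𝓘(ℝ, F) ∞ f T.baseSet) :
    ContMDiffOn 𝓘(ℝ, Model n) (𝓘(ℝ, Model n).prod 𝓘(ℝ, F)) ∞
      (fun p => TotalSpace.mk' F p (T.symm p (f p))) T.baseSet := by
  rw [T.contMDiffOn_section_baseSet_iff]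
  exact hf.congr fun p hp => by rw [T.apply_mk_symm hp]

-- The tensor with coefficients `B` in the chart is multiplied by a bump function at `p₀` and added
-- to `D`; the compact set `Q` is the support of the bump function. The arguments occur as `B x v u`
-- because a connection takes the differentiated field first and the direction second.
set_option synthInstance.maxHeartbeats 400000 in
set_option maxHeartbeats 1000000 in
theorem AffineConnection.exists_local_perturbation [T2Space M] (D : AffineConnection n M) (p₀ : M)
    {B : Model n → Model n →L[ℝ] Model n →L[ℝ] Model n}
    (hB : ContDiffOn ℝ ∞ B (chartAt (Model n) p₀).target) :
    ∃ (D' : AffineConnection n M) (Q : Set M), IsCompact Q ∧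
      (∀ (e' : OpenPartialHomeomorph M (Model n)) (x : Model n), e'.symm x ∉ Q →
        ∀ u v, D'.christoffel e' x u v = D.christoffel e' x u v) ∧
      ∀ᶠ x in 𝓝 (chartAt (Model n) p₀ p₀), ∀ u v,
        D'.christoffel (chartAt (Model n) p₀) x u v =
          D.christoffel (chartAt (Model n) p₀) x u v + B x v u := by
  obtain ⟨e, he⟩ : ∃ e, e = chartAt (Model n) p₀ := ⟨_, rfl⟩
  have hec : e ∈ charts n M := he ▸ chartAt_mem_charts p₀
  obtain ⟨ψ, -⟩ := (SmoothBumpFunction.nhds_basis_tsupport (I := 𝓘(ℝ, Model n)) p₀).ex_mem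
  let T := trivializationAt (Model n →L[ℝ] Model n →L[ℝ] Model n)
    (fun p : M => TangentSpace 𝓘(ℝ, Model n) p →L[ℝ] TangentSpace 𝓘(ℝ, Model n) p →L[ℝ]
          TangentSpace 𝓘(ℝ, Model n) p) p₀
  have hbase : T.baseSet = e.source := by simp [T, he]
  let A₀ : Π p : M, TangentSpace 𝓘(ℝ, Model n) p →L[ℝ] TangentSpace 𝓘(ℝ, Model n) p →L[ℝ]
      TangentSpace 𝓘(ℝ, Model n) p := fun p => T.symm p (B (e p))
  have hT : ∀ p ∈ e.source, T ⟨p, A₀ p⟩ = (p, B (e p)) := fun p hp =>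
    T.apply_mk_symm (hbase ▸ hp) _
  have hA₀ : ContMDiffOn 𝓘(ℝ, Model n)
      (𝓘(ℝ, Model n).prod 𝓘(ℝ, Model n →L[ℝ] Model n →L[ℝ] Model n)) ∞
      (fun p : M => TotalSpace.mk' (Model n →L[ℝ] Model n →L[ℝ] Model n)
        (E := fun p : M => TangentSpace 𝓘(ℝ, Model n) p →L[ℝ] TangentSpace 𝓘(ℝ, Model n) p →L[ℝ]
          TangentSpace 𝓘(ℝ, Model n) p) p (A₀ p)) e.source := by
    have h1 : ContMDiffOn 𝓘(ℝ, Model n) 𝓘(ℝ, Model n →L[ℝ] Model n →L[ℝ] Model n) ∞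
        (fun p => B (e p)) e.source :=
      ContMDiffOn.comp (t := e.target) (he ▸ hB).contMDiffOn
        (contMDiffOn_of_mem_maximalAtlas hec) fun p hp => e.map_source hp
    rw [← hbase] at h1 ⊢
    exact contMDiffOn_trivialization_symm (n := n) (F := Model n →L[ℝ] Model n →L[ℝ] Model n)
      (E := fun p : M => TangentSpace 𝓘(ℝ, Model n) p →L[ℝ] TangentSpace 𝓘(ℝ, Model n) p →L[ℝ]
        TangentSpace 𝓘(ℝ, Model n) p) T h1
  have hψ : tsupport ψ ⊆ e.source := he ▸ ψ.tsupport_subset_chartAt_source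
  have hA := ContMDiffOn.smul_section_of_tsupport ψ.contMDiff.contMDiffOn e.open_source hψ hA₀
  let K : OpenPartialHomeomorph M (Model n) → Model n → Model n → Model n → Model n :=
    fun e' x u v => mfderiv 𝓘(ℝ, Model n) 𝓘(ℝ, Model n) e' (e'.symm x)
      (A₀ (e'.symm x) (coordField e' v (e'.symm x)) (coordField e' u (e'.symm x)))
  have hcov : ∀ (e' : OpenPartialHomeomorph M (Model n)) (x u v : Model n),
      (D.addTensor _ hA).christoffel e' x u v = D.christoffel e' x u v + ψ (e'.symm x) • K e' x u v := by
    intro e' x u v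
    have h : (D.addTensor _ hA).cov (coordField e' v) (e'.symm x) (coordField e' u (e'.symm x)) =
      D.cov (coordField e' v) (e'.symm x) (coordField e' u (e'.symm x)) + ψ (e'.symm x) •
          (A₀ (e'.symm x) (coordField e' v (e'.symm x)) (coordField e' u (e'.symm x))) := rfl
    unfold AffineConnection.christoffel
    rw [h, map_add, map_smul]
    rfl
  refine ⟨D.addTensor _ hA, tsupport ψ, ψ.hasCompactSupport, fun e' x hx u v => ?_, ?_⟩
  · rw [hcov, image_eq_zero_of_notMem_tsupport hx, zero_smul, add_zero]
  · rw [← he]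
    have hcont : ContinuousAt e.symm (e p₀) :=
      e.continuousAt_symm (e.map_source (he ▸ mem_chart_source _ p₀))
    have h1 : ∀ᶠ x in 𝓝 (e p₀), ψ (e.symm x) = 1 :=
      hcont.eventually (by
        rw [e.left_inv (he ▸ mem_chart_source _ p₀)]; exact ψ.eventuallyEq_one)
    filter_upwards [h1, e.open_target.mem_nhds (e.map_source (he ▸ mem_chart_source _ p₀))]
      with x hx hxt u v
    rw [hcov, hx, one_smul]
    congr 1
    have hp := e.map_target hxt
    have hp' : e.symm x ∈ (trivializationAt (Model n) (TangentSpace 𝓘(ℝ, Model n)) p₀).baseSet := by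
      simpa [he] using hp
    have h2 := congrArg Prod.snd (hT _ hp)
    rw [e.right_inv hxt] at h2
    have h3 := congrArg (fun L : Model n →L[ℝ] Model n →L[ℝ] Model n => L v u) h2
    have h4 := inCoordinates_apply_eq₂ (E₁ := fun p : M => TangentSpace 𝓘(ℝ, Model n) p)
      (E₂ := fun p : M => TangentSpace 𝓘(ℝ, Model n) p)
      (E₃ := fun p : M => TangentSpace 𝓘(ℝ, Model n) p) (ϕ := A₀ (e.symm x)) (v := v) (w := u)
      hp' hp' hp'
    -- Over the chart domain the trivialization of the tangent bundle is the derivative of the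
    -- chart, and its inverse produces the coordinate fields. Thus the coefficients in the
    -- trivialization are the coordinate components.
    have hlin : ∀ w, (trivializationAt (Model n) (TangentSpace 𝓘(ℝ, Model n)) p₀).linearMapAt ℝ
        (e.symm x) w = mfderiv 𝓘(ℝ, Model n) 𝓘(ℝ, Model n) e (e.symm x) w := fun w => by
      have := TangentBundle.continuousLinearMapAt_trivializationAt (I := 𝓘(ℝ, Model n)) (x₀ := p₀)
        (x := e.symm x) (he ▸ hp)
      rw [he] at this ⊢
      exact congrArg (fun L => L w) this
    have hsym : ∀ w : Model n, (trivializationAt (Model n) (TangentSpace 𝓘(ℝ, Model n)) p₀).symm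
        (e.symm x) w = coordField e w (e.symm x) := fun w => by
      rw [← coordField_mfderiv hec hp
        ((trivializationAt (Model n) (TangentSpace 𝓘(ℝ, Model n)) p₀).symm (e.symm x) w)]
      congr 1
      rw [← hlin]
      have h5 := (trivializationAt (Model n) (TangentSpace 𝓘(ℝ, Model n)) p₀).linearMapAt_symmₗ
        (R := ℝ) hp' w
      rw [Trivialization.coe_symmₗ] at h5
      exacts [h5, hp']
    rw [hlin, hsym, hsym] at h4
    exact h4.symm.trans h3

end Constructions

/-! ### The geodesic equation in a chart -/

/-- The Jacobi endomorphisms at a point depend only on the germ of `S`, so a geodesic equation that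
agrees with the model near one tangent vector has the prescribed endomorphisms there. -/
theorem jacobiEndo_eventuallyEq {V : Type*} [NormedAddCommGroup V] [NormedSpace ℝ V]
    {S S' : V × V → V} {z : V × V} (h : S =ᶠ[𝓝 z] S') (k : ℕ) :
    jacobiEndo S k =ᶠ[𝓝 z] jacobiEndo S' k := by
  have hB : velDeriv S =ᶠ[𝓝 z] velDeriv S' := by
    filter_upwards [h.eventuallyEq_nhds] with y hy
    simp only [velDeriv, hy.fderiv_eq]
  have hflow : ∀ {f f' : V × V → V →L[ℝ] V}, f =ᶠ[𝓝 z] f' →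
      flowDeriv S f =ᶠ[𝓝 z] flowDeriv S' f' := fun {f f'} hf => by
    filter_upwards [h, hf.eventuallyEq_nhds] with y hy hfy
    simp only [flowDeriv, hfy.fderiv_eq, hy]
  induction k with
  | zero =>
    filter_upwards [h.eventuallyEq_nhds, hB, hflow hB] with y hy hBy hf
    simp only [jacobiEndo, posDeriv, hy.fderiv_eq, hBy, hf]
  | succ k ih =>
    filter_upwards [ih, hB, hflow ih] with y hy hBy hf
    simp only [jacobiEndo, hy, hBy, hf]

section GeodesicSpray

variable {n : ℕ} {M : Type*} [TopologicalSpace M] [ChartedSpace (Model n) M]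
  [IsManifold 𝓘(ℝ, Model n) ∞ M] {e : OpenPartialHomeomorph M (Model n)}

/-- The right hand side of the geodesic equation `x_tt = -Γ(x)(x_t, x_t)` in the chart `e`. -/
def AffineConnection.geodesicSpray (D : AffineConnection n M)
    (e : OpenPartialHomeomorph M (Model n)) (z : Model n × Model n) : Model n :=
  ∑ i, ∑ j, (-(z.2 i * z.2 j)) • D.christoffel e z.1 (stdVec i) (stdVec j)

theorem AffineConnection.geodesicSpray_eq (D : AffineConnection n M) (he : e ∈ charts n M)
    {z : Model n × Model n} (hz : z.1 ∈ e.target) :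
    D.geodesicSpray e z = -D.christoffel e z.1 z.2 z.2 := by
  rw [D.christoffel_eq_sum he hz, geodesicSpray]
  simp only [neg_smul, Finset.sum_neg_distrib]

theorem isOpen_fst_preimage_target :
    IsOpen ((ContinuousLinearMap.fst ℝ (Model n) (Model n)) ⁻¹' e.target) :=
  e.open_target.preimage (ContinuousLinearMap.continuous _)

theorem contDiff_velocity_coeff (i j : Fin (n + 1)) :
    ContDiff ℝ ∞ fun z : Model n × Model n => -(z.2 i * z.2 j) := by
  have h : ∀ i : Fin (n + 1), ContDiff ℝ ∞ fun z : Model n × Model n => z.2 i := fun i =>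
    (EuclideanSpace.proj (𝕜 := ℝ) i).contDiff.comp contDiff_snd
  exact ((h i).mul (h j)).neg

theorem AffineConnection.jetTendsto_geodesicSpray [T2Space M] {T : Type*} {𝓕 : Filter T}
    (he : e ∈ charts n M) {D : T → AffineConnection n M} {D₀ : AffineConnection n M} {N : ℕ}
    {x₀ : Model n} (hx₀ : x₀ ∈ e.target) (v₀ : Model n)
    (h : ∀ i j, ∀ m ≤ N, Filter.Tendsto (fun t => ‖iteratedFDeriv ℝ m (fun x =>
      (D t).christoffel e x (stdVec i) (stdVec j) - D₀.christoffel e x (stdVec i) (stdVec j)) x₀‖)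
      𝓕 (𝓝 0)) :
    JetTendsto 𝓕 ((ContinuousLinearMap.fst ℝ (Model n) (Model n)) ⁻¹' e.target) (x₀, v₀) N
      (fun t => (D t).geodesicSpray e) (D₀.geodesicSpray e) := by
  have hj : ∀ i j, JetTendsto 𝓕 e.target (ContinuousLinearMap.fst ℝ (Model n) (Model n) (x₀, v₀)) N
      (fun t x => (D t).christoffel e x (stdVec i) (stdVec j))
      fun x => D₀.christoffel e x (stdVec i) (stdVec j) := fun i j =>
    ⟨fun t => (D t).contDiffOn_christoffel he _ _, D₀.contDiffOn_christoffel he _ _, h i j⟩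
  have hW := isOpen_fst_preimage_target (e := e)
  have hz : ((x₀, v₀) : Model n × Model n) ∈
    (ContinuousLinearMap.fst ℝ (Model n) (Model n)) ⁻¹' e.target := hx₀
  exact JetTendsto.sum hW hz _ fun i => JetTendsto.sum hW hz _ fun j =>
    (JetTendsto.of_const (contDiff_velocity_coeff i j).contDiffOn).bilin hW hz
      (ContinuousLinearMap.lsmul ℝ ℝ) ((hj i j).comp_clm e.open_target
        (ContinuousLinearMap.fst ℝ (Model n) (Model n)) hx₀)

theorem AffineConnection.contDiffOn_geodesicSpray [T2Space M] (D : AffineConnection n M)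
    (he : e ∈ charts n M) :
    ContDiffOn ℝ ∞ (D.geodesicSpray e)
      ((ContinuousLinearMap.fst ℝ (Model n) (Model n)) ⁻¹' e.target) :=
  ContDiffOn.sum fun i _ => ContDiffOn.sum fun j _ =>
    (contDiff_velocity_coeff i j).contDiffOn.smul ((D.contDiffOn_christoffel he _ _).comp
      contDiff_fst.contDiffOn (mapsTo_preimage _ _))

theorem AffineConnection.geodesicSpray_lerp (D D' : AffineConnection n M) (c : ℝ)
    (z : Model n × Model n) : (D.lerp D' c).geodesicSpray e z =
      D'.geodesicSpray e z + c • (D.geodesicSpray e z - D'.geodesicSpray e z) := by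
  unfold AffineConnection.geodesicSpray
  rw [← Finset.sum_sub_distrib, Finset.smul_sum, ← Finset.sum_add_distrib]
  refine Finset.sum_congr rfl fun i _ => ?_
  rw [← Finset.sum_sub_distrib, Finset.smul_sum, ← Finset.sum_add_distrib]
  refine Finset.sum_congr rfl fun j _ => ?_
  rw [D.christoffel_lerp]
  module

/-- The initial velocity together with the Jacobi endomorphisms of the geodesic equation. -/
def AffineConnection.jacobiData (D : AffineConnection n M)
    (e : OpenPartialHomeomorph M (Model n)) (z : Model n × Model n) :
    Model n × (Fin 3 → Model n →L[ℝ] Model n) :=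
  (z.2, fun k => jacobiEndo (D.geodesicSpray e) k z)

/-- The last endomorphism has index `2` and uses `2 + 2` derivatives of the right hand side, whence
the bound `4 ≤ N`. -/
theorem AffineConnection.tendsto_jacobiData [T2Space M] {T : Type*} {𝓕 : Filter T}
    (he : e ∈ charts n M) {D : T → AffineConnection n M} {D₀ : AffineConnection n M} {N : ℕ}
    (hN : 4 ≤ N) {x₀ : Model n} (hx₀ : x₀ ∈ e.target) (v₀ : Model n)
    (h : ∀ i j, ∀ m ≤ N, Filter.Tendsto (fun t => ‖iteratedFDeriv ℝ m (fun x =>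
      (D t).christoffel e x (stdVec i) (stdVec j) - D₀.christoffel e x (stdVec i) (stdVec j)) x₀‖)
      𝓕 (𝓝 0)) :
    Filter.Tendsto (fun t => (D t).jacobiData e (x₀, v₀)) 𝓕 (𝓝 (D₀.jacobiData e (x₀, v₀))) := by
  have hJ := AffineConnection.jetTendsto_geodesicSpray he hx₀ v₀ h
  have hz : ((x₀, v₀) : Model n × Model n) ∈
    (ContinuousLinearMap.fst ℝ (Model n) (Model n)) ⁻¹' e.target := hx₀
  refine tendsto_const_nhds.prodMk_nhds (tendsto_pi_nhds.2 fun k => ?_)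
  exact (JetTendsto.jacobiEndo (N := 0) isOpen_fst_preimage_target hz k
    (hJ.mono (by have := k.isLt; omega))).value

theorem AffineConnection.continuousOn_jacobiData [T2Space M] (D : AffineConnection n M)
    (he : e ∈ charts n M) :
    ContinuousOn (D.jacobiData e)
      ((ContinuousLinearMap.fst ℝ (Model n) (Model n)) ⁻¹' e.target) :=
  continuous_snd.continuousOn.prodMk (continuousOn_pi.2 fun _ =>
    (contDiffOn_jacobiEndo isOpen_fst_preimage_target (D.contDiffOn_geodesicSpray he) _).continuousOn)

/-- The geodesic equation is affine in the parameter `s`, and the Jacobi endomorphisms are built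
from it by derivatives and products. At a fixed tangent vector they are polynomials in `s`. -/
theorem AffineConnection.contDiff_jacobiData_lerp [T2Space M] (D D' : AffineConnection n M)
    (he : e ∈ charts n M) {z : Model n × Model n} (hz : z.1 ∈ e.target) :
    ContDiff ℝ ω fun s : ℝ => (D.lerp D' s).jacobiData e z := by
  have hS := D.contDiffOn_geodesicSpray he
  have hS' := D'.contDiffOn_geodesicSpray he
  have hP : PolyFamily ((ContinuousLinearMap.fst ℝ (Model n) (Model n)) ⁻¹' e.target)
      fun s => (D.lerp D' s).geodesicSpray e := by
    refine ⟨2, ![0, 1], ![D'.geodesicSpray e, fun z => D.geodesicSpray e z - D'.geodesicSpray e z],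
      ?_, fun s z _ => ?_⟩
    · rw [Fin.forall_fin_two]
      exact ⟨hS', hS.sub hS'⟩
    · rw [Fin.sum_univ_two]
      refine (AffineConnection.geodesicSpray_lerp D D' s z).trans ?_
      simp
  exact contDiff_const.prodMk (contDiff_pi.2 fun k =>
    (hP.jacobiEndo isOpen_fst_preimage_target k).contDiff hz)

/-- Every connection can be modified near a point so that its geodesic equation has prescribed
Jacobi endomorphisms there. -/
theorem AffineConnection.exists_jacobiData_eq [T2Space M] (D : AffineConnection n M) (p₀ : M)
    {A : Fin 3 → Model n →L[ℝ] Model n} (hA : ∀ k, A k (stdVec 0) = 0) :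
    ∃ (D' : AffineConnection n M) (Q : Set M), IsCompact Q ∧
      (∀ (e' : OpenPartialHomeomorph M (Model n)) (x : Model n), e'.symm x ∉ Q →
        ∀ u v, D'.christoffel e' x u v = D.christoffel e' x u v) ∧
      D'.jacobiData (chartAt (Model n) p₀) (chartAt (Model n) p₀ p₀, stdVec 0) =
        (stdVec 0, A) := by
  obtain ⟨e, he⟩ : ∃ e, e = chartAt (Model n) p₀ := ⟨_, rfl⟩
  have hec : e ∈ charts n M := he ▸ chartAt_mem_charts p₀
  have hx₀ : e p₀ ∈ e.target := e.map_source (he ▸ mem_chart_source _ p₀)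
  let pr : Fin (n + 1) → Model n →L[ℝ] ℝ := fun i => EuclideanSpace.proj i
  -- `C` is the difference between the desired Christoffel symbols and those of `D`. The desired
  -- ones have the single nonzero component `-modelField`, at `i = j = 0`, so that the new geodesic
  -- equation is `modelSpray`.
  let C : Model n → Fin (n + 1) → Fin (n + 1) → Model n := fun x i j =>
    -(pr 0 (stdVec i) * pr 0 (stdVec j)) • modelField (pr 0) A (e p₀) x -
      D.christoffel e x (stdVec i) (stdVec j)
  let B : Model n → Model n →L[ℝ] Model n →L[ℝ] Model n := fun x =>
    ∑ i, ∑ j, ContinuousLinearMap.smulRightL ℝ (Model n) (Model n →L[ℝ] Model n) (pr j)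
      (ContinuousLinearMap.smulRightL ℝ (Model n) (Model n) (pr i) (C x i j))
  have hC : ∀ i j, ContDiffOn ℝ ∞ (fun x => C x i j) e.target := fun i j =>
    ((contDiff_modelField _ _ _).const_smul _).contDiffOn.sub (D.contDiffOn_christoffel hec _ _)
  have hB : ContDiffOn ℝ ∞ B e.target := ContDiffOn.sum fun i _ => ContDiffOn.sum fun j _ =>
    (ContinuousLinearMap.contDiff _).comp_contDiffOn
      ((ContinuousLinearMap.contDiff _).comp_contDiffOn (hC i j))
  have hBv : ∀ x u v, B x v u = ∑ i, ∑ j, (u i * v j) • C x i j := fun x u v => by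
    simp only [B, sum_apply]
    refine Finset.sum_congr rfl fun i _ => Finset.sum_congr rfl fun j _ => ?_
    show v j • u i • C x i j = _
    rw [smul_smul, mul_comm]
  obtain ⟨D', Q, hQ, hoff, hnear⟩ := D.exists_local_perturbation p₀ (he ▸ hB)
  refine ⟨D', Q, hQ, hoff, ?_⟩
  rw [← he] at hnear ⊢
  have hS : D'.geodesicSpray e =ᶠ[𝓝 (e p₀, stdVec 0)] modelSpray (pr 0) A (e p₀) := by
    have h0 : Filter.Tendsto (Prod.fst : Model n × Model n → Model n) (𝓝 (e p₀, stdVec 0))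
        (𝓝 (e p₀)) := continuousAt_fst
    filter_upwards [h0.eventually (e.open_target.eventually_mem hx₀), h0.eventually hnear]
      with z hz hz'
    rw [D'.geodesicSpray_eq hec hz, hz', D.christoffel_eq_sum hec hz, hBv,
      ← Finset.sum_add_distrib, modelSpray]
    have h2 : ∀ i, (∑ j, (z.2 i * z.2 j) • D.christoffel e z.1 (stdVec i) (stdVec j)) +
        ∑ j, (z.2 i * z.2 j) • C z.1 i j = (z.2 i * pr 0 (stdVec i)) •
          ∑ j, (z.2 j * pr 0 (stdVec j)) • -modelField (pr 0) A (e p₀) z.1 := fun i => by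
      rw [← Finset.sum_add_distrib, Finset.smul_sum]
      refine Finset.sum_congr rfl fun j _ => ?_
      simp only [C]
      module
    have h3 : ∑ j, z.2 j * pr 0 (stdVec j) = pr 0 z.2 := by
      conv_rhs => rw [← sum_stdVec z.2]
      simp only [map_sum, map_smul, smul_eq_mul]
    rw [Finset.sum_congr rfl fun i _ => h2 i, ← Finset.sum_smul, ← Finset.sum_smul, h3, smul_smul,
      smul_neg, neg_neg, sq]
  refine Prod.ext rfl (funext fun k => ?_)
  show jacobiEndo (D'.geodesicSpray e) k (e p₀, stdVec 0) = A k
  rw [(jacobiEndo_eventuallyEq hS k).eq_of_nhds]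
  exact jacobiEndo_modelSpray hA (by simp [pr]) _ k

end GeodesicSpray

/-! ### The weak and strong topologies -/

/-- The `m`-th derivative is jointly continuous in `(s, x)`, so the strict inequality persists near
each point of `{0} × K`; compactness of `K` makes the range of `s` uniform. -/
theorem eventually_norm_iteratedFDeriv_lt {E F : Type*} [NormedAddCommGroup E] [NormedSpace ℝ E]
    [NormedAddCommGroup F] [NormedSpace ℝ F] {f g : E → F} {O K : Set E} (hO : IsOpen O)
    (hf : ContDiffOn ℝ ∞ f O) (hg : ContDiffOn ℝ ∞ g O) (hK : IsCompact K) (hKO : K ⊆ O) {m : ℕ}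
    {ε : ℝ} (h : ∀ x ∈ K, ‖iteratedFDeriv ℝ m f x‖ < ε) :
    ∀ᶠ s : ℝ in 𝓝 0, ∀ x ∈ K, ‖iteratedFDeriv ℝ m (fun y => f y + s • g y) x‖ < ε := by
  refine hK.eventually_forall_of_forall_eventually fun x hx => ?_
  have hc : ∀ {a : E → F}, ContDiffOn ℝ ∞ a O → ∀ y ∈ O, ContDiffAt ℝ m a y := fun ha y hy =>
    contDiffAt_of_contDiffOn_isOpen hO hy ha m
  have hfc : ContinuousAt (fun z : ℝ × E => iteratedFDeriv ℝ m f z.2) (0, x) :=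
    ContinuousAt.comp (f := Prod.snd) (x := ((0 : ℝ), x))
      ((hc hf x (hKO hx)).continuousAt_iteratedFDeriv le_rfl) continuousAt_snd
  have hgc : ContinuousAt (fun z : ℝ × E => iteratedFDeriv ℝ m g z.2) (0, x) :=
    ContinuousAt.comp (f := Prod.snd) (x := ((0 : ℝ), x))
      ((hc hg x (hKO hx)).continuousAt_iteratedFDeriv le_rfl) continuousAt_snd
  have hs : ContinuousAt (fun z : ℝ × E =>
      ‖iteratedFDeriv ℝ m f z.2 + z.1 • iteratedFDeriv ℝ m g z.2‖) (0, x) :=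
    (hfc.add (continuousAt_fst.smul hgc)).norm
  have h0 : Filter.Tendsto (Prod.snd : ℝ × E → E) (𝓝 (0, x)) (𝓝 x) := continuousAt_snd
  filter_upwards [Filter.Tendsto.eventually_lt_const (u := ε) (by simpa using h x hx) hs,
    h0.eventually (hO.eventually_mem (hKO hx))] with z hz hzO
  have he : (fun y => f y + z.1 • g y) = f + z.1 • g := rfl
  have hg' : ContDiffAt ℝ m (z.1 • g) z.2 := (hc hg _ hzO).const_smul z.1
  rw [he, iteratedFDeriv_add_apply (hc hf _ hzO) hg',
    iteratedFDeriv_const_smul_apply (hc hg _ hzO)]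
  exact hz

section Topologies

variable {n : ℕ} {M : Type*} [TopologicalSpace M] [ChartedSpace (Model n) M]
  [IsManifold 𝓘(ℝ, Model n) ∞ M] {e : OpenPartialHomeomorph M (Model n)} {l : ℕ}

theorem AffineConnection.near_empty (D : AffineConnection n M) (ε : ℝ) :
    D.near l e ∅ ε = univ :=
  eq_univ_of_forall fun _ _ hx => absurd hx (notMem_empty _)

theorem strongTopology_le_weakTopology : strongTopology n M l ≤ weakTopology n M l := by
  refine le_generateFrom ?_
  rintro S ⟨D, e, K, ε, he, hK, hKe, hε, rfl⟩
  -- A single compact set becomes a locally finite sequence by putting it at index `0` and the empty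
  -- set at all other indices.
  refine TopologicalSpace.isOpen_generateFrom_of_mem
    ⟨D, fun _ => e, fun i => if i = 0 then K else ∅, fun _ => ε, fun i => ⟨he, ?_, ?_, hε⟩, ?_, ?_⟩
  · dsimp only
    split_ifs
    exacts [hK, isCompact_empty]
  · dsimp only
    split_ifs
    exacts [hKe, empty_subset _]
  · refine fun p => ⟨univ, Filter.univ_mem, (finite_singleton (0 : ℕ)).subset ?_⟩
    rintro i ⟨q, hq, -⟩
    by_contra hi
    have hi' : i ≠ 0 := hi
    dsimp only at hq
    rw [if_neg hi', image_empty] at hq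
    exact hq
  · refine (Subset.antisymm (subset_iInter fun i => ?_) (iInter_subset_of_subset 0 ?_))
    · dsimp only
      split_ifs
      · exact subset_rfl
      · rw [AffineConnection.near_empty]; exact subset_univ _
    · simp

theorem AffineConnection.tendsto_iteratedFDeriv_nhds (D : AffineConnection n M)
    (he : e ∈ charts n M) {x : Model n} (hx : x ∈ e.target) (i j : Fin (n + 1)) {m : ℕ}
    (hm : m ≤ l) :
    Filter.Tendsto (fun E : AffineConnection n M => ‖iteratedFDeriv ℝ m (fun y =>
      E.christoffel e y (stdVec i) (stdVec j) - D.christoffel e y (stdVec i) (stdVec j)) x‖)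
      (@nhds _ (weakTopology n M l) D) (𝓝 0) := by
  rw [Metric.tendsto_nhds]
  intro ε hε
  have hopen : @IsOpen _ (weakTopology n M l) (D.near l e {x} ε) :=
    TopologicalSpace.isOpen_generateFrom_of_mem
      ⟨D, e, {x}, ε, he, isCompact_singleton, singleton_subset_iff.2 hx, hε, rfl⟩
  have hmem : D ∈ D.near l e {x} ε := fun y _ i j m _ => by
    have h0 : iteratedFDeriv ℝ m (fun y : Model n =>
        D.christoffel e y (stdVec i) (stdVec j) - D.christoffel e y (stdVec i) (stdVec j)) y = 0 := by
      simp only [sub_self]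
      rw [iteratedFDeriv_fun_zero]; rfl
    rw [h0, norm_zero]
    exact hε
  let _ := weakTopology n M l
  filter_upwards [hopen.mem_nhds hmem] with E hE
  rw [Real.dist_eq, sub_zero, abs_of_nonneg (norm_nonneg _)]
  exact hE x rfl i j m hm

theorem AffineConnection.eventually_lerp_mem_near [T2Space M] {D D₀ D₁ : AffineConnection n M}
    (he : e ∈ charts n M) {K : Set (Model n)} (hK : IsCompact K) (hKe : K ⊆ e.target) {ε : ℝ}
    (h : D₀ ∈ D.near l e K ε) : ∀ᶠ s in 𝓝 (0 : ℝ), D₁.lerp D₀ s ∈ D.near l e K ε := by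
  have hall : ∀ i j : Fin (n + 1), ∀ m ∈ Finset.range (l + 1), ∀ᶠ s in 𝓝 (0 : ℝ), ∀ x ∈ K,
      ‖iteratedFDeriv ℝ m (fun y => (D₁.lerp D₀ s).christoffel e y (stdVec i) (stdVec j) -
        D.christoffel e y (stdVec i) (stdVec j)) x‖ < ε := fun i j m hm => by
    have hsm := fun D' : AffineConnection n M =>
      D'.contDiffOn_christoffel he (stdVec i) (stdVec j)
    have := eventually_norm_iteratedFDeriv_lt e.open_target ((hsm D₀).sub (hsm D))
      ((hsm D₁).sub (hsm D₀)) hK hKe (m := m) (ε := ε)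
      fun x hx => h x hx i j m (Nat.lt_succ_iff.1 (Finset.mem_range.1 hm))
    refine this.mono fun s hs x hx => ?_
    convert hs x hx using 4 with y
    rw [AffineConnection.christoffel_lerp]
    module
  have := Filter.eventually_all.2 fun i => Filter.eventually_all.2 fun j =>
    (Filter.eventually_all_finset (Finset.range (l + 1))).2 (hall i j)
  exact this.mono fun s hs x hx i j m hm =>
    hs i j m (Finset.mem_range.2 (Nat.lt_succ_iff.2 hm)) x hx

/-- A compactly supported deformation of a connection is continuous in the strong topology. -/
theorem AffineConnection.tendsto_lerp_strongTopology [T2Space M] {D₀ D₁ : AffineConnection n M}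
    {Q : Set M} (hQ : IsCompact Q)
    (hoff : ∀ (e' : OpenPartialHomeomorph M (Model n)) (x : Model n), e'.symm x ∉ Q →
        ∀ u v, D₁.christoffel e' x u v = D₀.christoffel e' x u v) :
    Filter.Tendsto (fun s : ℝ => D₁.lerp D₀ s) (𝓝 0) (@nhds _ (strongTopology n M l) D₀) := by
  rw [TopologicalSpace.tendsto_nhds_generateFrom_iff]
  rintro S ⟨D, e, K, ε, hK, hfin, rfl⟩ hD₀
  have hD₀' := fun i => mem_iInter.1 hD₀ i
  -- Only finitely many sets of the locally finite family meet `Q`, and these impose finitely many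
  -- conditions on `s`. On the remaining ones the deformed connection agrees with `D₀` near each
  -- point.
  have hF := hfin.finite_nonempty_inter_compact hQ
  have h1 := (Filter.eventually_all_finite hF).2 fun i _ =>
    AffineConnection.eventually_lerp_mem_near (D₁ := D₁) (hK i).1 (hK i).2.1 (hK i).2.2.1 (hD₀' i)
  refine h1.mono fun s hs => mem_iInter.2 fun i => ?_
  by_cases hi : ((e i).symm '' K i ∩ Q).Nonempty
  · exact hs i hi
  · intro x hx a b m hm
    have hxt := (hK i).2.2.1 hx
    have hxQ : (e i).symm x ∉ Q := fun hxQ => hi ⟨_, mem_image_of_mem _ hx, hxQ⟩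
    have hnear : ∀ᶠ y in 𝓝 x, (e i).symm y ∉ Q :=
      ((e i).continuousAt_symm hxt).eventually (hQ.isClosed.isOpen_compl.eventually_mem hxQ)
    have heq : (fun y => (D₁.lerp D₀ s).christoffel (e i) y (stdVec a) (stdVec b) -
        D.christoffel (e i) y (stdVec a) (stdVec b)) =ᶠ[𝓝 x] fun y =>
        D₀.christoffel (e i) y (stdVec a) (stdVec b) -
          D.christoffel (e i) y (stdVec a) (stdVec b) := by
      filter_upwards [hnear] with y hy
      rw [AffineConnection.christoffel_lerp, hoff _ _ hy]
      module
    show ‖iteratedFDeriv ℝ m _ x‖ < _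
    rw [(heq.iteratedFDeriv ℝ m).eq_of_nhds]
    exact hD₀' i x hx a b m hm

/-! ### The generic set -/

/-- The projective structures of the connections whose jet at a point satisfies the open
condition `F ≠ 0`. -/
def genericSet (F : Model n × (Fin 3 → Model n →L[ℝ] Model n) → ℝ) (p₀ : M) :
    Set (ProjectiveStructure n M) :=
  AffineConnection.proj '' {D | F (D.jacobiData (chartAt (Model n) p₀)
    (chartAt (Model n) p₀ p₀, stdVec 0)) ≠ 0}

/-- The function `F` need not be projectively invariant. If `D` has an equivalent representative
`D'` with `F ≠ 0`, then for `E` near `D` the translate `E + D' - D` is near `D'`, so that `F ≠ 0`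
persists, and it is equivalent to `E` because `D'` is equivalent to `D`. -/
theorem isOpen_genericSet [T2Space M] (hl : 4 ≤ l)
    {F : Model n × (Fin 3 → Model n →L[ℝ] Model n) → ℝ} (hF : Continuous F) (p₀ : M) :
    IsOpen[ProjectiveStructure.weakTopology n M l] (genericSet F p₀) := by
  refine isOpen_coinduced.2 ?_
  let _ := weakTopology n M l
  refine isOpen_iff_mem_nhds.2 fun D hD => ?_
  obtain ⟨D', hD', hDD'⟩ := hD
  have hr := Quotient.exact hDD'
  obtain ⟨e, he⟩ : ∃ e, e = chartAt (Model n) p₀ := ⟨_, rfl⟩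
  have hec : e ∈ charts n M := he ▸ chartAt_mem_charts p₀
  have hx₀ : e p₀ ∈ e.target := e.map_source (he ▸ mem_chart_source _ p₀)
  rw [mem_ofPred_eq, ← he] at hD'
  have ht := AffineConnection.tendsto_jacobiData (𝓕 := 𝓝 D) (D := fun E => E.translate D D')
    (D₀ := D') (N := l) hec hl hx₀ (stdVec 0) fun i j m hm => by
      refine (D.tendsto_iteratedFDeriv_nhds hec hx₀ i j hm).congr fun E => ?_
      congr 2
      funext y
      rw [AffineConnection.christoffel_translate]
      abel
  filter_upwards [((hF.tendsto _).comp ht).eventually_ne hD'] with E hE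
  refine ⟨E.translate D D', by rw [mem_ofPred_eq, ← he]; exact hE, Quotient.sound ?_⟩
  intro e' he' x hx u
  obtain ⟨a, ha⟩ := hr e' he' x hx u
  exact ⟨a, by rw [AffineConnection.christoffel_translate, ← ha]; abel⟩

/-- It suffices to prove density among connections, as the projection to classes is continuous and
onto. A given `D₀` is joined by an affine line to a compactly supported modification `D₁` with the
rigid triple as its data, and the line is continuous at `D₀` in the strong topology. -/
theorem dense_genericSet [T2Space M] (hn : 2 ≤ n)
    {F : Model n × (Fin 3 → Model n →L[ℝ] Model n) → ℝ} (hF : ContDiff ℝ ω F)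
    (hF1 : F (stdVec 0, rigidEndo n) = 1) (p₀ : M) :
    @Dense _ (ProjectiveStructure.strongTopology n M l) (genericSet F p₀) := by
  let _ := strongTopology n M l
  let _ := ProjectiveStructure.strongTopology n M l
  have hcont : Continuous (AffineConnection.proj : AffineConnection n M → _) := continuous_coinduced_rng
  have hsurj : Function.Surjective (AffineConnection.proj : AffineConnection n M → _) :=
    Quotient.mk_surjective
  refine hsurj.denseRange.dense_image hcont fun D₀ => ?_
  obtain ⟨D₁, Q, hQ, hoff, hjac⟩ := D₀.exists_jacobiData_eq p₀ (rigidEndo_stdVec_zero hn)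
  obtain ⟨e, he⟩ : ∃ e, e = chartAt (Model n) p₀ := ⟨_, rfl⟩
  have hec : e ∈ charts n M := he ▸ chartAt_mem_charts p₀
  have hx₀ : e p₀ ∈ e.target := e.map_source (he ▸ mem_chart_source _ p₀)
  rw [← he] at hjac ⊢
  have hlim := (AffineConnection.tendsto_lerp_strongTopology (l := l) hQ hoff).mono_left
    (nhdsWithin_le_nhds (s := {0}ᶜ))
  refine mem_closure_of_frequently_of_tendsto ?_ hlim
  have han : AnalyticOnNhd ℝ (fun s : ℝ => F ((D₁.lerp D₀ s).jacobiData e (e p₀, stdVec 0))) univ :=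
    fun s _ => (contDiff_omega_iff_analyticOnNhd.1
      (hF.comp (D₁.contDiff_jacobiData_lerp D₀ hec hx₀))) s (mem_univ s)
  -- If `F` vanished for all small `s ≠ 0`, it would vanish on the whole line by the identity
  -- theorem, contrary to its value `1` at `s = 1`.
  by_contra hfr
  have hev : ∀ᶠ s in 𝓝[≠] (0 : ℝ), F ((D₁.lerp D₀ s).jacobiData e (e p₀, stdVec 0)) = 0 := by
    refine (Filter.not_frequently.1 hfr).mono fun s hs => not_not.1 hs
  have h1 := han.eqOn_zero_of_preconnected_of_frequently_eq_zero isPreconnected_univ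
    (mem_univ (0 : ℝ)) hev.frequently (mem_univ (1 : ℝ))
  have h2 : (D₁.lerp D₀ 1).jacobiData e (e p₀, stdVec 0) = D₁.jacobiData e (e p₀, stdVec 0) := by
    have : (D₁.lerp D₀ 1).geodesicSpray e = D₁.geodesicSpray e := by
      funext z; rw [AffineConnection.geodesicSpray_lerp]; module
    simp only [AffineConnection.jacobiData, this]
  simp only [h2, hjac, hF1, Pi.zero_apply] at h1
  exact one_ne_zero h1

theorem dense_weakTopology_of_dense_strongTopology {G : Set (ProjectiveStructure n M)}
    (h : @Dense _ (ProjectiveStructure.strongTopology n M l) G) :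
    @Dense _ (ProjectiveStructure.weakTopology n M l) G := by
  have hle : ProjectiveStructure.strongTopology n M l ≤ ProjectiveStructure.weakTopology n M l :=
    coinduced_mono strongTopology_le_weakTopology
  exact (@dense_iff_inter_open _ (ProjectiveStructure.weakTopology n M l) _).2 fun U hU hne =>
    (@dense_iff_inter_open _ (ProjectiveStructure.strongTopology n M l) _).1 h U (hle U hU) hne

theorem isOpen_strongTopology_of_isOpen_weakTopology {G : Set (ProjectiveStructure n M)}
    (h : IsOpen[ProjectiveStructure.weakTopology n M l] G) :
    IsOpen[ProjectiveStructure.strongTopology n M l] G :=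
  (coinduced_mono strongTopology_le_weakTopology :
    ProjectiveStructure.strongTopology n M l ≤ ProjectiveStructure.weakTopology n M l) G h

end Topologies

/-! ### Generic projective structures are not variational -/

section NotVariational

variable {n : ℕ} {M : Type*} [TopologicalSpace M] [ChartedSpace (Model n) M]
  [IsManifold 𝓘(ℝ, Model n) ∞ M] {e : OpenPartialHomeomorph M (Model n)}

/-- The function `F` detects the absence of compatible bilinear forms. -/
def DetectsRigidity (F : Model n × (Fin 3 → Model n →L[ℝ] Model n) → ℝ) : Prop :=
  ∀ p, F p ≠ 0 → ∀ G : Model n →L[ℝ] Model n →L[ℝ] ℝ, (∀ u w, G u w = G w u) → G p.1 = 0 →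
    (∀ k u w, G (p.2 k u) w = G (p.2 k w) u) → G = 0

/-- The points of the tangent bundle, in a chart, where the function `F` of the jet of the
connection does not vanish. -/
def AffineConnection.rigidRegion (D : AffineConnection n M)
    (F : Model n × (Fin 3 → Model n →L[ℝ] Model n) → ℝ)
    (e : OpenPartialHomeomorph M (Model n)) : Set (Model n × Model n) :=
  {z | z.1 ∈ e.target ∧ F (D.jacobiData e z) ≠ 0}

variable {F : Model n × (Fin 3 → Model n →L[ℝ] Model n) → ℝ}

theorem AffineConnection.isOpen_rigidRegion [T2Space M] (D : AffineConnection n M)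
    (he : e ∈ charts n M) (hF : Continuous F) : IsOpen (D.rigidRegion F e) :=
  (hF.comp_continuousOn (D.continuousOn_jacobiData he)).isOpen_inter_preimage
    isOpen_fst_preimage_target isOpen_ne

theorem iteratedDeriv_two_eq (c : ℝ → Model n) : iteratedDeriv 2 c = deriv (deriv c) := by
  rw [iteratedDeriv_succ, iteratedDeriv_one]

/-- In the rigid region, a Lagrangian with second order Euler-Lagrange equations whose extremals
include the paths is trivial. -/
theorem AffineConnection.elJet_eq_zero [T2Space M] (D : AffineConnection n M) (he : e ∈ charts n M)
    (hF : DetectsRigidity F) {r : ℕ} {L : (Fin (r + 2) → Model n) → ℝ}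
    {W : Set (Model n × Model n)} (hW : IsOpen W) (hWF : W ⊆ D.rigidRegion F e)
    (hL : ContDiffOn ℝ ∞ L (jetsOver r W)) (h2 : SecondOrderOver L W)
    (hext : ∀ (ε : ℝ) (c : ℝ → Model n), 0 < ε → ContDiffOn ℝ ∞ c (Ioo (-ε) ε) →
      (∀ t ∈ Ioo (-ε) ε, (c t, deriv c t) ∈ W) → (∀ t ∈ Ioo (-ε) ε, D.PathEqAt e c t) →
      ∀ w, eulerLagrange L c 0 w = 0)
    {z : Model n × Model n} (hz : z ∈ W) (a : Model n) : elJet L (z.1, z.2, a) = 0 := by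
  refine elJet_eq_zero_of_extremal hW hL h2
    ((D.contDiffOn_geodesicSpray he).mono fun z hz => (hWF hz).1) (fun ν ε c hε hc hsol =>
      hext ε c hε hc (fun t ht => (hsol t ht).1) fun t ht => ⟨ν, ?_⟩) (fun z hz G hs h0 hk => ?_) hz a
  · rw [iteratedDeriv_two_eq, (hsol t ht).2, D.geodesicSpray_eq he (hWF (hsol t ht).1).1]
    abel
  · exact hF _ (hWF hz).2 G hs h0 fun k u w => hk k k.isLt u w

/-- On coordinates, `tangentVec` is the inverse of the induced chart of the tangent bundle. Hence it
is continuous and maps `O` onto an open set, which the dense set `U` must meet. -/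
theorem isOpen_and_nonempty_inter_tangentVec (p₀ : M) {O : Set (Model n × Model n)}
    (hO : IsOpen O) (hOe : ∀ z ∈ O, z.1 ∈ (chartAt (Model n) p₀).target) (hne : O.Nonempty)
    {U : Set (TangentBundle 𝓘(ℝ, Model n) M)} (hU : IsOpen U) (hUd : Dense U) :
    IsOpen {z ∈ O | tangentVec (chartAt (Model n) p₀) z.1 z.2 ∈ U} ∧
      {z ∈ O | tangentVec (chartAt (Model n) p₀) z.1 z.2 ∈ U}.Nonempty := by
  let χ := chartAt (ModelProd (Model n) (Model n))
    (⟨p₀, (0 : Model n)⟩ : TangentBundle 𝓘(ℝ, Model n) M)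
  have hχ : ∀ z ∈ O, tangentVec (chartAt (Model n) p₀) z.1 z.2 = χ.symm z := fun z hz =>
    tangentMap_chart_symm (p := (⟨p₀, (0 : Model n)⟩ : TangentBundle 𝓘(ℝ, Model n) M))
      (q := (⟨z.1, z.2⟩ : TangentBundle 𝓘(ℝ, Model n) (Model n))) (hOe z hz)
  have hOχ : O ⊆ χ.target := fun z hz =>
    (TangentBundle.mem_chart_target_iff z _).2 (hOe z hz)
  have heq : {z ∈ O | tangentVec (chartAt (Model n) p₀) z.1 z.2 ∈ U} = O ∩ χ.symm ⁻¹' U := by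
    ext z
    refine and_congr_right fun hz => ?_
    rw [hχ z hz, mem_preimage]
  rw [heq]
  refine ⟨(χ.continuousOn_symm.mono hOχ).isOpen_inter_preimage hO hU, ?_⟩
  obtain ⟨_, ⟨z, hz, rfl⟩, hyU⟩ := hUd.inter_open_nonempty (χ.symm '' O)
    (χ.isOpen_image_symm_of_subset_target hO hOχ) (hne.image _)
  exact ⟨z, hz, hyU⟩

theorem exists_notMem_span_singleton (hn : 2 ≤ n) (v : Model n) :
    ∃ b : Model n, ∀ a : ℝ, b ≠ a • v := by
  by_contra! h
  have := finrank_le_one v fun w => ⟨(h w).choose, (h w).choose_spec.symm⟩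
  rw [finrank_euclideanSpace_fin] at this
  omega

theorem exists_interval_cubicCurve {W : Set (Model n × Model n)} (hW : IsOpen W)
    {z : Model n × Model n} (hz : z ∈ W) (a : Model n) : ∃ ε > 0, ∀ t ∈ Ioo (-ε) ε,
      (cubicCurve (z.1, z.2, a, 0) t, deriv (cubicCurve (z.1, z.2, a, 0)) t) ∈ W := by
  have hcont : Continuous fun t : ℝ =>
      (cubicCurve (z.1, z.2, a, 0) t, deriv (cubicCurve (z.1, z.2, a, 0)) t) := by
    rw [deriv_cubicCurve]; unfold cubicCurve; fun_prop
  have h0 : (0 : ℝ) ∈ (fun t : ℝ =>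
      (cubicCurve (z.1, z.2, a, 0) t, deriv (cubicCurve (z.1, z.2, a, 0)) t)) ⁻¹' W := by
    rw [mem_preimage, deriv_cubicCurve]
    simpa [cubicCurve] using hz
  obtain ⟨ε, hε, h⟩ := Metric.isOpen_iff.1 (hW.preimage hcont) 0 h0
  exact ⟨ε, hε, fun t ht => h (by rwa [Real.ball_eq_Ioo, zero_sub, zero_add])⟩

/-- Both directions of the hypothesis on extremals are used. Paths being extremals forces the
Euler-Lagrange expressions to vanish over a nonempty open set of velocities; then all curves there
are extremals, so all would have to be paths. -/
theorem AffineConnection.not_isVariational [T2Space M] (hn : 2 ≤ n) (D : AffineConnection n M)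
    (p₀ : M) (hFc : Continuous F) (hF : DetectsRigidity F)
    (hne : (D.rigidRegion F (chartAt (Model n) p₀)).Nonempty) : ¬ D.proj.IsVariational := by
  rintro ⟨U, hU, hUd, -, r, L, hL2, hiff⟩
  have he := chartAt_mem_charts (n := n) p₀
  obtain ⟨hW, z, hz⟩ := isOpen_and_nonempty_inter_tangentVec p₀ (D.isOpen_rigidRegion he hFc)
    (fun z hz => hz.1) hne hU hUd
  obtain ⟨e, hee⟩ : ∃ e, e = chartAt (Model n) p₀ := ⟨_, rfl⟩
  rw [← hee] at he hW hz
  obtain ⟨W, hWdef⟩ : ∃ W, W = {z ∈ D.rigidRegion F e | tangentVec e z.1 z.2 ∈ U} := ⟨_, rfl⟩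
  rw [← hWdef] at hW hz
  have hWF : W ⊆ D.rigidRegion F e := fun z hz => by rw [hWdef] at hz; exact hz.1
  have hWU : ∀ z ∈ W, z.1 ∈ e.target ∧ tangentVec e z.1 z.2 ∈ U := fun z hz => by
    rw [hWdef] at hz; exact ⟨hz.1.1, hz.2⟩
  have hLs : ContDiffOn ℝ ∞ (L.toFun e) (jetsOver r W) :=
    (L.smooth e he).mono fun j hj => hWU _ hj
  have h2 : SecondOrderOver (L.toFun e) W := fun c c' t hc hc' hcW hk w =>
    hL2 e he c c' t hc hc' (by
      have := hWU _ (jet_mem_jetsOver.2 hcW : jet r c t ∈ jetsOver r W)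
      exact this) hk w
  have hzero := fun {z} hz a => D.elJet_eq_zero (z := z) he hF hW hWF hLs h2
    (fun ε c hε hc hcW hpath w => (hiff e he (-ε) ε c (by linarith) hc fun t ht => hWU _ (hcW t ht)).2
      (fun t ht => ⟨D, rfl, hpath t ht⟩) 0 ⟨by linarith, hε⟩ w) hz a
  -- The acceleration `a` is chosen with `a + Γ(v, v) = b` not proportional to the velocity `v`,
  -- which is possible since the dimension exceeds one. Another representative of the class changes
  -- this vector only by a multiple of `v`.
  obtain ⟨b, hb⟩ := exists_notMem_span_singleton hn z.2
  let a := b - D.christoffel e z.1 z.2 z.2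
  obtain ⟨ε, hε, hcW⟩ := exists_interval_cubicCurve hW hz a
  have hcs := contDiff_cubicCurve (z.1, z.2, a, 0)
  have hpath := (hiff e he (-ε) ε _ (by linarith) hcs.contDiffOn fun t ht => hWU _ (hcW t ht)).1
    (fun t ht w => by
      rw [← elJet_jet2 hW hLs h2 hcs.contDiffAt (hcW t ht) w, jet2, hzero (hcW t ht)]
      rfl) 0 ⟨by linarith, hε⟩
  obtain ⟨D', hD', ν, hν⟩ := hpath
  have hjet := jet2_cubicCurve_zero (z.1, z.2, a, (0 : Model n))
  simp only [jet2, Prod.mk.injEq] at hjet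
  rw [iteratedDeriv_two_eq, hjet.1, hjet.2.1, hjet.2.2] at hν
  obtain ⟨α, hα⟩ := Quotient.exact hD' e he z.1 (hWU z hz).1 z.2
  refine hb (ν - α) ?_
  rw [sub_smul, ← hν, ← hα]
  simp only [a]
  abel

end NotVariational

/-! ### The length Lagrangian of a metric -/

section Length

variable {V : Type*} [NormedAddCommGroup V] [NormedSpace ℝ V]
  {T : Set V} {B : V → V →L[ℝ] V →L[ℝ] ℝ} {Γ : V → V → V → V} {σ : ℝ} {W : Set (V × V)}

/-- The length Lagrangian `√(σ B(x_t, x_t))` of a field `B` of bilinear forms. -/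
def lengthLagrangian (σ : ℝ) (B : V → V →L[ℝ] V →L[ℝ] ℝ) (j : Fin (0 + 2) → V) : ℝ :=
  √(σ * B (j 0) (j 1) (j 1))

/-- `B` is a field of symmetric bilinear forms on `T`, parallel for the symmetric Christoffel
symbols `Γ`. -/
structure IsParallelForm (T : Set V) (B : V → V →L[ℝ] V →L[ℝ] ℝ) (Γ : V → V → V → V) : Prop where
  isOpen : IsOpen T
  contDiffOn : ContDiffOn ℝ ∞ B T
  symm : ∀ x ∈ T, ∀ u v, B x u v = B x v u
  fderiv_eq : ∀ x ∈ T, ∀ u v w, fderiv ℝ B x u v w = B x (Γ x u v) w + B x v (Γ x u w)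
  torsion_free : ∀ x ∈ T, ∀ u v, Γ x u v = Γ x v u

theorem contDiffOn_lengthLagrangian (hB : ContDiffOn ℝ ∞ B T) {J : Set (Fin (0 + 2) → V)}
    (hJ : ∀ j ∈ J, j 0 ∈ T ∧ 0 < σ * B (j 0) (j 1) (j 1)) :
    ContDiffOn ℝ ∞ (lengthLagrangian σ B) J := by
  have h1 : ContDiffOn ℝ ∞ (fun j : Fin (0 + 2) → V => j 1) J :=
    (contDiff_apply ℝ V 1).contDiffOn
  have hB' : ContDiffOn ℝ ∞ (fun j : Fin (0 + 2) → V => B (j 0)) J :=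
    hB.comp (contDiff_apply ℝ V 0).contDiffOn fun j hj => (hJ j hj).1
  exact (contDiffOn_const.mul ((hB'.clm_apply h1).clm_apply h1)).sqrt fun j hj => (hJ j hj).2.ne'

set_option synthInstance.maxHeartbeats 200000 in
theorem fderiv_lengthLagrangian {j : Fin (0 + 2) → V}
    (hB : DifferentiableAt ℝ B (j 0)) (hj : 0 < σ * B (j 0) (j 1) (j 1)) (w : Fin (0 + 2) → V) :
    fderiv ℝ (lengthLagrangian σ B) j w =
      σ * (fderiv ℝ B (j 0) (w 0) (j 1) (j 1) + B (j 0) (w 1) (j 1) + B (j 0) (j 1) (w 1)) /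
        (2 * √(σ * B (j 0) (j 1) (j 1))) := by
  have h0 : HasFDerivAt (fun j : Fin (0 + 2) → V => j 0)
    (ContinuousLinearMap.proj (R := ℝ) (φ := fun _ : Fin (0 + 2) => V) 0) j :=
    hasFDerivAt_apply 0 j
  have h1 : HasFDerivAt (fun j : Fin (0 + 2) → V => j 1)
    (ContinuousLinearMap.proj (R := ℝ) (φ := fun _ : Fin (0 + 2) => V) 1) j :=
    hasFDerivAt_apply 1 j
  have hB0 : HasFDerivAt (fun j : Fin (0 + 2) → V => B (j 0))
      ((fderiv ℝ B (j 0)).comp (ContinuousLinearMap.proj (R := ℝ) (φ := fun _ : Fin (0 + 2) => V) 0))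
      j :=
    HasFDerivAt.comp (E := Fin (0 + 2) → V) (F := V) (G := V →L[ℝ] V →L[ℝ] ℝ) (g := B) j hB.hasFDerivAt h0
  have h2 := (((hB0.clm_apply h1).clm_apply h1).const_mul σ).sqrt hj.ne'
  have h3 : HasFDerivAt (lengthLagrangian σ B) _ j := h2
  rw [h3.fderiv]
  simp
  ring

-- Parallelism turns every derivative of `B` into Christoffel symbols. The terms with `Γ x w v` from
-- the position derivative cancel against those with `Γ x v w` from the momentum because `Γ` is
-- symmetric. What remains is the covariant acceleration without its component along the velocity,
-- the latter removed by differentiating the square root.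
set_option synthInstance.maxHeartbeats 200000 in
theorem IsParallelForm.euler_expression (hB : IsParallelForm T B Γ) {j : ℝ → Fin (0 + 2) → V}
    {a : V} {t : ℝ} (hj0 : HasDerivAt (fun s => j s 0) (j t 1) t)
    (hj1 : HasDerivAt (fun s => j s 1) a t)
    (hq : 0 < σ * B (j t 0) (j t 1) (j t 1)) (hT : j t 0 ∈ T) (w : V) :
    fderiv ℝ (lengthLagrangian σ B) (j t) (Pi.single 0 w) -
        deriv (fun s => fderiv ℝ (lengthLagrangian σ B) (j s) (Pi.single 1 w)) t =
      -(σ * (B (j t 0) (a + Γ (j t 0) (j t 1) (j t 1)) w -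
        B (j t 0) (j t 1) w * B (j t 0) (a + Γ (j t 0) (j t 1) (j t 1)) (j t 1) /
            B (j t 0) (j t 1) (j t 1)) / √(σ * B (j t 0) (j t 1) (j t 1))) := by
  have hBd : ∀ x ∈ T, DifferentiableAt ℝ B x := fun x hx =>
    (hB.contDiffOn.contDiffAt (hB.isOpen.mem_nhds hx)).differentiableAt (by simp)
  have hBc : HasDerivAt (fun s => B (j s 0)) (fderiv ℝ B (j t 0) (j t 1)) t :=
    HasFDerivAt.comp_hasDerivAt (F := V) (E := V →L[ℝ] V →L[ℝ] ℝ) (l := B) t (hBd _ hT).hasFDerivAt hj0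
  have hnum := (hBc.clm_apply hj1).clm_apply (hasDerivAt_const t w)
  have hqd := ((hBc.clm_apply hj1).clm_apply hj1).const_mul σ
  have hden := hqd.sqrt hq.ne'
  have hquot := (hnum.const_mul σ).div hden (Real.sqrt_pos.2 hq).ne'
  have hmom : (fun s => fderiv ℝ (lengthLagrangian σ B) (j s) (Pi.single 1 w)) =ᶠ[𝓝 t]
      fun s => σ * B (j s 0) (j s 1) w / √(σ * B (j s 0) (j s 1) (j s 1)) := by
    filter_upwards [hj0.continuousAt.eventually (hB.isOpen.mem_nhds hT),
      hqd.continuousAt.eventually (lt_mem_nhds hq)] with s hsT hsq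
    rw [fderiv_lengthLagrangian (hBd _ hsT) hsq]
    have hp := (Real.sqrt_pos.2 hsq).ne'
    simp [hB.symm _ hsT w]
    field_simp
    ring
  have hquot' : HasDerivAt
      (fun s => σ * B (j s 0) (j s 1) w / √(σ * B (j s 0) (j s 1) (j s 1))) _ t := hquot
  rw [hmom.deriv_eq, fderiv_lengthLagrangian (hBd _ hT) hq, hquot'.deriv]
  have hp := (Real.sqrt_pos.2 hq).ne'
  have hp2 := Real.sq_sqrt hq.le
  have hBq : B (j t 0) (j t 1) (j t 1) ≠ 0 := right_ne_zero_of_mul hq.ne'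
  have e1 := hB.symm _ hT (j t 1) (Γ (j t 0) (j t 1) (j t 1))
  have e2 := hB.symm _ hT (j t 1) (Γ (j t 0) (j t 1) w)
  have e3 := hB.symm _ hT (j t 1) a
  simp only [hB.fderiv_eq _ hT, Pi.single_eq_same, add_apply, map_add,
    hB.torsion_free _ hT w, e1, e2, e3, Pi.single_eq_of_ne (show (1 : Fin (0 + 2)) ≠ 0 by decide),
    map_zero, zero_apply, add_zero]
  -- Only `ρ ≠ 0` and `ρ² = σ q` matter for the square root, so the identity becomes one of rational
  -- functions.
  generalize √(σ * B (j t 0) (j t 1) (j t 1)) = ρ at hp hp2 ⊢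
  generalize B (j t 0) (j t 1) (j t 1) = q at hp2 hBq ⊢
  field_simp
  rw [hp2]
  ring

end Length

/-! ### Metrics in coordinates -/

section MetricCoordinates

variable {n : ℕ} {M : Type*} [TopologicalSpace M] [ChartedSpace (Model n) M]
  [IsManifold 𝓘(ℝ, Model n) ∞ M] {e : OpenPartialHomeomorph M (Model n)}

/-- The coefficients of the metric `g` in the chart `e`. -/
def PseudoRiemannianMetric.coordForm (g : PseudoRiemannianMetric n M)
    (e : OpenPartialHomeomorph M (Model n)) (x : Model n) : Model n →L[ℝ] Model n →L[ℝ] ℝ :=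
  ContinuousLinearMap.bilinearComp (E := Model n) (F := Model n) (G := ℝ) (E' := Model n)
    (F' := Model n) (g.val (e.symm x))
    (mfderiv 𝓘(ℝ, Model n) 𝓘(ℝ, Model n) e.symm x) (mfderiv 𝓘(ℝ, Model n) 𝓘(ℝ, Model n) e.symm x)

variable (g : PseudoRiemannianMetric n M)

theorem PseudoRiemannianMetric.coordForm_apply (he : e ∈ charts n M) {x : Model n}
    (hx : x ∈ e.target) (u v : Model n) : g.coordForm e x u v =
      g.val (e.symm x) (coordField e u (e.symm x)) (coordField e v (e.symm x)) := by
  rw [coordField_eq he (e.map_target hx), coordField_eq he (e.map_target hx), e.right_inv hx]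
  rfl

theorem PseudoRiemannianMetric.coordForm_symm (x u v : Model n) :
    g.coordForm e x u v = g.coordForm e x v u :=
  g.symm _ _ _

theorem PseudoRiemannianMetric.coordForm_nondegenerate (he : e ∈ charts n M) {x : Model n}
    (hx : x ∈ e.target) {u : Model n} (hu : ∀ v, g.coordForm e x u v = 0) : u = 0 := by
  have hp := e.map_target hx
  have h0 : coordField e u (e.symm x) = 0 := g.nondegenerate _ _ fun w => by
    rw [← coordField_mfderiv he hp w]
    exact (g.coordForm_apply he hx u _).symm.trans (hu _)
  rw [← mfderiv_coordField he hp u, h0]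
  exact map_zero _

theorem PseudoRiemannianMetric.contMDiffAt_coordField (he : e ∈ charts n M) {q : M}
    (hq : q ∈ e.source) (u v : Model n) : ContMDiffAt 𝓘(ℝ, Model n) 𝓘(ℝ, ℝ) ∞
      (fun q => g.val q (coordField e u q) (coordField e v q)) q := by
  have : ContMDiffAt 𝓘(ℝ, Model n) (𝓘(ℝ, Model n).prod 𝓘(ℝ, ℝ)) ∞
      (fun q => TotalSpace.mk' ℝ (E := Bundle.Trivial M ℝ) q
        (g.val q (coordField e u q) (coordField e v q))) q := by
    apply ContMDiffAt.clm_bundle_apply₂ (F₁ := Model n) (F₂ := Model n)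
    · exact g.contMDiff.contMDiffAt
    · exact ProjVar.contMDiffAt_coordField he hq u
    · exact ProjVar.contMDiffAt_coordField he hq v
  simp only [contMDiffAt_totalSpace] at this
  exact this.2

theorem PseudoRiemannianMetric.contDiffOn_coordForm (he : e ∈ charts n M) :
    ContDiffOn ℝ ∞ (g.coordForm e) e.target := by
  refine contDiffOn_clm_apply.2 fun u => contDiffOn_clm_apply.2 fun v => ?_
  intro x hx
  refine ContDiffAt.contDiffWithinAt ?_
  have h := (g.contMDiffAt_coordField he (e.map_target hx) u v).comp x
    (contMDiffAt_symm_of_mem_maximalAtlas he hx)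
  refine (contMDiffAt_iff_contDiffAt.1 h).congr_of_eventuallyEq ?_
  filter_upwards [e.open_target.mem_nhds hx] with y hy
  exact g.coordForm_apply he hy u v

/-- Pullback commutes with the Lie bracket, and constant fields have bracket zero. This translates
vanishing torsion into symmetry of the Christoffel symbols. -/
theorem mlieBracket_coordField (he : e ∈ charts n M) {q : M} (hq : q ∈ e.source) (u v : Model n) :
    VectorField.mlieBracket 𝓘(ℝ, Model n) (coordField e u) (coordField e v) q = 0 := by
  have hconst : ∀ w : Model n, MDifferentiableAt 𝓘(ℝ, Model n) (𝓘(ℝ, Model n).prod 𝓘(ℝ, Model n))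
      (fun x : Model n => (⟨x, w⟩ : TangentBundle 𝓘(ℝ, Model n) (Model n))) (e q) := fun w =>
    (contMDiffAt_vectorSpace_iff_contDiffAt (n := ∞).2 contDiffAt_const).mdifferentiableAt (by simp)
  have : IsManifold 𝓘(ℝ, Model n) (minSmoothness ℝ 3) M :=
    IsManifold.of_le (n := ∞) (by
      rw [minSmoothness_of_isRCLikeNormedField]
      exact WithTop.coe_le_coe.2 le_top)
  have h := VectorField.mpullback_mlieBracket (I := 𝓘(ℝ, Model n)) (I' := 𝓘(ℝ, Model n))
    (n := ∞) (f := e) (x₀ := q) (V := fun _ => u) (W := fun _ => v) (hconst u) (hconst v)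
    (contMDiffAt_of_mem_maximalAtlas he hq) (by simpa using two_le_infty)
  have h0 : VectorField.lieBracketWithin ℝ (fun _ : Model n => u) (fun _ => v) univ (e q) = 0 := by
    simp [VectorField.lieBracket]
  have h1 := congrFun (VectorField.mlieBracketWithin_eq_lieBracketWithin (𝕜 := ℝ)
    (V := fun _ : Model n => u) (W := fun _ => v) (s := univ)) (e q)
  exact h.symm.trans ((congrArg (fun w => (mfderiv 𝓘(ℝ, Model n) 𝓘(ℝ, Model n) e q).inverse w)
    (h1.trans h0)).trans (map_zero _))

variable {g} {D : AffineConnection n M}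

theorem AffineConnection.IsLeviCivita.christoffel_symm (hD : D.IsLeviCivita g)
    (he : e ∈ charts n M) {x : Model n} (hx : x ∈ e.target) (u v : Model n) :
    D.christoffel e x u v = D.christoffel e x v u := by
  have hp := e.map_target hx
  have h := D.cov.torsion_eq_zero_iff.1 hD.1 (mdifferentiableAt_coordField he hp u)
    (mdifferentiableAt_coordField he hp v)
  rw [mlieBracket_coordField he hp, sub_eq_zero] at h
  unfold AffineConnection.christoffel
  rw [h]

theorem AffineConnection.coordField_christoffel (he : e ∈ charts n M) {x : Model n}
    (hx : x ∈ e.target) (u v : Model n) : coordField e (D.christoffel e x u v) (e.symm x) =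
      D.cov (coordField e v) (e.symm x) (coordField e u (e.symm x)) :=
  coordField_mfderiv he (e.map_target hx) _

theorem AffineConnection.IsLeviCivita.isParallelForm [T2Space M] (hD : D.IsLeviCivita g)
    (he : e ∈ charts n M) : IsParallelForm e.target (g.coordForm e) (D.christoffel e) where
  isOpen := e.open_target
  contDiffOn := g.contDiffOn_coordForm he
  symm x _ u v := g.coordForm_symm x u v
  torsion_free x hx u v := hD.christoffel_symm he hx u v
  fderiv_eq x hx u v w := by
    have hp := e.map_target hx
    have h := hD.2 (e.symm x) (coordField e v) (coordField e w)
      (mdifferentiableAt_coordField he hp v) (mdifferentiableAt_coordField he hp w)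
      (coordField e u (e.symm x))
    rw [← AffineConnection.coordField_christoffel he hx,
      ← AffineConnection.coordField_christoffel he hx, ← g.coordForm_apply he hx,
      ← g.coordForm_apply he hx] at h
    rw [← h]
    have hB := ((g.contDiffOn_coordForm he).contDiffAt
      (e.open_target.mem_nhds hx)).differentiableAt (by simp)
    have h1 : fderiv ℝ (fun y => g.coordForm e y v w) x u = fderiv ℝ (g.coordForm e) x u v w := by
      rw [(((hB.hasFDerivAt.clm_apply (hasFDerivAt_const v x)).clm_apply
        (hasFDerivAt_const w x))).fderiv]
      simp
    rw [← h1]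
    have h2 : (fun y => g.coordForm e y v w) =ᶠ[𝓝 x]
        (fun q => g.val q (coordField e v q) (coordField e w q)) ∘ e.symm := by
      filter_upwards [e.open_target.mem_nhds hx] with y hy
      exact g.coordForm_apply he hy v w
    have h3 := mfderiv_comp x (I := 𝓘(ℝ, Model n)) (I' := 𝓘(ℝ, Model n)) (I'' := 𝓘(ℝ, ℝ))
      ((g.contMDiffAt_coordField he hp v w).mdifferentiableAt (by simp))
      ((charts_mdifferentiable he).mdifferentiableAt_symm hx)
    have h4 := coordField_eq he hp u
    rw [e.right_inv hx] at h4
    rw [h2.fderiv_eq, ← mfderiv_eq_fderiv, h3, h4]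
    rfl

end MetricCoordinates

/-! ### Generic projective structures are not metrizable -/

section NotMetrizable

variable {n : ℕ} {M : Type*} [TopologicalSpace M] [ChartedSpace (Model n) M]
  [IsManifold 𝓘(ℝ, Model n) ∞ M] {e : OpenPartialHomeomorph M (Model n)}

theorem eulerLagrange_zero_eq (L : (Fin (0 + 2) → Model n) → ℝ) (c : ℝ → Model n) (t : ℝ)
    (w : Model n) : eulerLagrange L c t w = fderiv ℝ L (jet 0 c t) (Pi.single 0 w) -
      deriv (fun s => fderiv ℝ L (jet 0 c s) (Pi.single 1 w)) t := by
  simp [eulerLagrange, Fin.sum_univ_two, iteratedDeriv_one, sub_eq_add_neg]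

theorem IsParallelForm.eulerLagrange_eq {T : Set (Model n)}
    {B : Model n → Model n →L[ℝ] Model n →L[ℝ] ℝ} {Γ : Model n → Model n → Model n → Model n}
    (hB : IsParallelForm T B Γ) {σ : ℝ} {c : ℝ → Model n} {t : ℝ} (hc : ContDiffAt ℝ ∞ c t)
    (hT : c t ∈ T) (hq : 0 < σ * B (c t) (deriv c t) (deriv c t)) (w : Model n) :
    eulerLagrange (lengthLagrangian σ B) c t w =
      -(σ * (B (c t) (deriv (deriv c) t + Γ (c t) (deriv c t) (deriv c t)) w -
        B (c t) (deriv c t) w *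
          B (c t) (deriv (deriv c) t + Γ (c t) (deriv c t) (deriv c t)) (deriv c t) /
            B (c t) (deriv c t) (deriv c t)) / √(σ * B (c t) (deriv c t) (deriv c t))) := by
  have e0 : ∀ s, jet 0 c s 0 = c s := fun s => by simp [jet]
  have e1 : ∀ s, jet 0 c s 1 = deriv c s := fun s => by simp [jet, iteratedDeriv_one]
  have hc' : ContDiffAt ℝ ∞ (deriv c) t :=
    (hc.fderiv_right (m := ∞) (by simp)).clm_apply contDiffAt_const
  have h := hB.euler_expression (j := jet 0 c) (a := deriv (deriv c) t) (t := t) (σ := σ)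
    (by simpa only [e0, e1] using (hc.differentiableAt (by simp)).hasDerivAt)
    (by simpa only [e1] using (hc'.differentiableAt (by simp)).hasDerivAt)
    (by simpa only [e0, e1] using hq) (by simpa only [e0] using hT) w
  rw [eulerLagrange_zero_eq, h, e0, e1]

theorem exists_ne_zero_apply_eq_zero (hn : 2 ≤ n) (φ : Model n →L[ℝ] ℝ) :
    ∃ w, w ≠ 0 ∧ φ w = 0 := by
  have h := LinearMap.ker_ne_bot_of_finrank_lt (f := (φ : Model n →ₗ[ℝ] ℝ)) (by
    rw [finrank_euclideanSpace_fin, Module.finrank_self]; omega)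
  obtain ⟨w, hw, h0⟩ := (Submodule.ne_bot_iff _).1 h
  exact ⟨w, h0, hw⟩

/-- A nonzero symmetric bilinear form is not identically isotropic on an open set. -/
theorem exists_mem_apply_self_ne_zero {V : Type*} [NormedAddCommGroup V] [NormedSpace ℝ V]
    {B : V →L[ℝ] V →L[ℝ] ℝ} (hs : ∀ u v, B u v = B v u) (hB : B ≠ 0) {O : Set V} (hO : IsOpen O)
    (hne : O.Nonempty) : ∃ v ∈ O, B v v ≠ 0 := by
  by_contra! h
  obtain ⟨v, hv⟩ := hne
  have hzero : ∀ u, B u u = 0 := fun u => by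
    have hcont : Continuous fun t : ℝ => v + t • u := by fun_prop
    obtain ⟨ε, hε, hb⟩ := Metric.isOpen_iff.1 (hO.preimage hcont) 0 (by simpa using hv)
    have hmem : ∀ t : ℝ, |t| < ε → B (v + t • u) (v + t • u) = 0 := fun t ht =>
      h _ (hb (by simpa [Metric.mem_ball, Real.dist_eq] using ht))
    have h1 := hmem (ε / 2) (by rw [abs_of_pos (by linarith)]; linarith)
    have h2 := hmem (-(ε / 2)) (by rw [abs_neg, abs_of_pos (by linarith)]; linarith)
    have h3 := h v hv
    simp only [map_add, map_smul, add_apply, smul_apply, smul_eq_mul] at h1 h2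
    -- The second difference of `B (v + t u) (v + t u)` at step `t = ε / 2` is `2 t² B u u`, in
    -- which the terms linear in `t` have cancelled.
    have h4 : ε ^ 2 * B u u = 0 := by linear_combination 2 * h1 + 2 * h2 - 4 * h3
    exact (mul_eq_zero.1 h4).resolve_left (by positivity)
  refine hB ?_
  ext u w
  have h1 := hzero (u + w)
  simp only [map_add, add_apply, hzero, hs w u] at h1
  simpa using by linarith

theorem PseudoRiemannianMetric.exists_mem_coordForm_ne_zero (g : PseudoRiemannianMetric n M)
    (he : e ∈ charts n M) {R : Set (Model n × Model n)} (hR : IsOpen R)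
    (hRe : ∀ z ∈ R, z.1 ∈ e.target) (hne : R.Nonempty) :
    ∃ z ∈ R, g.coordForm e z.1 z.2 z.2 ≠ 0 := by
  obtain ⟨z, hz⟩ := hne
  have hB : g.coordForm e z.1 ≠ 0 := fun h => by
    have h0 : stdVec (n := n) 0 = 0 :=
      g.coordForm_nondegenerate he (hRe z hz) fun v => by rw [h]; rfl
    simpa [stdVec] using congrArg (fun v : Model n => v 0) h0
  obtain ⟨v, hv, h⟩ := exists_mem_apply_self_ne_zero (fun u v => g.coordForm_symm z.1 u v) hB
    (hR.preimage (f := fun v => (z.1, v)) (by fun_prop)) ⟨z.2, hz⟩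
  exact ⟨(z.1, v), hv, h⟩

variable {F : Model n × (Fin 3 → Model n →L[ℝ] Model n) → ℝ}

/-- The obstruction is applied to the length Lagrangian in a single chart and near a single nonnull
vector, so no Lagrangian on all of `M` is needed. Vanishing of its Euler-Lagrange expressions
contradicts the nondegeneracy of the metric. -/
theorem AffineConnection.not_isMetrizable [T2Space M] (hn : 2 ≤ n) (D : AffineConnection n M)
    (he : e ∈ charts n M) (hFc : Continuous F) (hF : DetectsRigidity F)
    (hne : (D.rigidRegion F e).Nonempty) : ¬ D.proj.IsMetrizable := by
  rintro ⟨g, D₁, hLC, hproj⟩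
  have hB := hLC.isParallelForm he
  obtain ⟨z, hzR, hz⟩ := g.exists_mem_coordForm_ne_zero he
    (D.isOpen_rigidRegion he hFc) (fun z hz => hz.1) hne
  -- Only the sign of `σ` matters. Taking the value of the metric at `z` itself makes `σ g(v, v)`
  -- positive near `z` without distinguishing spacelike from timelike vectors.
  let σ := g.coordForm e z.1 z.2 z.2
  let W := {z ∈ D.rigidRegion F e | 0 < σ * g.coordForm e z.1 z.2 z.2}
  have hzW : z ∈ W := ⟨hzR, mul_self_pos.2 hz⟩
  have hWF : W ⊆ D.rigidRegion F e := fun z hz => hz.1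
  have hW : IsOpen W := by
    have h1 : ContinuousOn (fun z : Model n × Model n => g.coordForm e z.1) (D.rigidRegion F e) :=
      hB.contDiffOn.continuousOn.comp continuousOn_fst fun z hz => hz.1
    exact (continuousOn_const.mul ((h1.clm_apply continuousOn_snd).clm_apply
      continuousOn_snd)).isOpen_inter_preimage (D.isOpen_rigidRegion he hFc) isOpen_Ioi
  have hLs : ContDiffOn ℝ ∞ (lengthLagrangian σ (g.coordForm e)) (jetsOver 0 W) :=
    contDiffOn_lengthLagrangian hB.contDiffOn fun j hj => ⟨(hWF hj).1, hj.2⟩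
  have hEL : ∀ (c : ℝ → Model n) (t : ℝ), ContDiffAt ℝ ∞ c t → (c t, deriv c t) ∈ W → ∀ w, _ :=
    fun c t hc hcW w => hB.eulerLagrange_eq (σ := σ) hc hcW.1.1 hcW.2 w
  have h2 : SecondOrderOver (lengthLagrangian σ (g.coordForm e)) W :=
    fun c c' t hc hc' hcW hk w => by
      have k0 : c t = c' t := by simpa using hk 0 (by simp)
      have k1 : deriv c t = deriv c' t := by simpa [iteratedDeriv_one] using hk 1 (by simp)
      have k2 : deriv (deriv c) t = deriv (deriv c') t := by
        simpa only [iteratedDeriv_two_eq] using hk 2 le_rfl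
      have hcW' : (c' t, deriv c' t) ∈ W := by rwa [← k0, ← k1]
      rw [hEL c t hc hcW, hEL c' t hc' hcW', k0, k1, k2]
  have hext : ∀ (ε : ℝ) (c : ℝ → Model n), 0 < ε → ContDiffOn ℝ ∞ c (Ioo (-ε) ε) →
      (∀ t ∈ Ioo (-ε) ε, (c t, deriv c t) ∈ W) → (∀ t ∈ Ioo (-ε) ε, D.PathEqAt e c t) →
      ∀ w, eulerLagrange (lengthLagrangian σ (g.coordForm e)) c 0 w = 0 := by
    intro ε c hε hc hcW hpath w
    have h0 : (0 : ℝ) ∈ Ioo (-ε) ε := ⟨by linarith, hε⟩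
    obtain ⟨ν, hν⟩ := hpath 0 h0
    obtain ⟨α, hα⟩ := Quotient.exact hproj e he (c 0) (hcW 0 h0).1.1 (deriv c 0)
    -- Along a path the covariant acceleration is proportional to the velocity, also for the
    -- equivalent connection `D₁`. The Euler-Lagrange expression discards exactly this component.
    have hb : deriv (deriv c) 0 + D₁.christoffel e (c 0) (deriv c 0) (deriv c 0) =
        (ν + α) • deriv c 0 := by
      rw [add_smul, ← hν, ← hα, iteratedDeriv_two_eq]
      abel
    rw [hEL c 0 (hc.contDiffAt (Ioo_mem_nhds h0.1 h0.2)) (hcW 0 h0), hb]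
    have hq := right_ne_zero_of_mul (hcW 0 h0).2.ne'
    simp only [map_smul, smul_apply, smul_eq_mul] at hq ⊢
    field_simp
    ring
  -- With `w` orthogonal to the velocity, the projection term drops out and the Euler-Lagrange
  -- expression reduces to a nonzero multiple of `g(b, w)`, where `b` is the covariant acceleration.
  -- Nondegeneracy supplies `b` with `g(b, w) ≠ 0`.
  obtain ⟨w, hw0, hw⟩ := exists_ne_zero_apply_eq_zero hn (g.coordForm e z.1 z.2)
  obtain ⟨b, hb⟩ : ∃ b, g.coordForm e z.1 b w ≠ 0 := by
    by_contra! h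
    exact hw0 (g.coordForm_nondegenerate he hzR.1 fun v => by rw [g.coordForm_symm]; exact h v)
  let a := b - D₁.christoffel e z.1 z.2 z.2
  have hjet := jet2_cubicCurve_zero (z.1, z.2, a, (0 : Model n))
  have hjet' := hjet
  simp only [jet2, Prod.mk.injEq] at hjet'
  have hcs := contDiff_cubicCurve (z.1, z.2, a, 0)
  have hcW : (cubicCurve (z.1, z.2, a, 0) 0, deriv (cubicCurve (z.1, z.2, a, 0)) 0) ∈ W := by
    rw [hjet'.1, hjet'.2.1]; exact hzW
  have h := elJet_jet2 hW hLs h2 hcs.contDiffAt hcW w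
  rw [hjet, D.elJet_eq_zero he hF hW hWF hLs h2 hext hzW a, hEL _ _ hcs.contDiffAt hcW,
    hjet'.1, hjet'.2.1, hjet'.2.2, hw, zero_mul, zero_div, sub_zero, sub_add_cancel] at h
  exact neg_ne_zero.2 (div_ne_zero (mul_ne_zero hz hb) (Real.sqrt_pos.2 hzW.2).ne') h.symm

end NotMetrizable

end ProjVar

end

/-! ### The main theorem -/

theorem mainTheorem3 (n : ℕ) (hn : 2 ≤ n) (M : Type*) [TopologicalSpace M] [T2Space M]
    [SecondCountableTopology M] [Nonempty M] [ChartedSpace (ProjVar.Model n) M]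
    [IsManifold 𝓘(ℝ, ProjVar.Model n) ∞ M] (l : ℕ) (hl : l = if n = 2 then 5 else 4) :
    ∃ G : Set (ProjVar.ProjectiveStructure n M),
      (IsOpen[ProjVar.ProjectiveStructure.weakTopology n M l] G ∧
        @Dense _ (ProjVar.ProjectiveStructure.weakTopology n M l) G) ∧
      (IsOpen[ProjVar.ProjectiveStructure.strongTopology n M l] G ∧
        @Dense _ (ProjVar.ProjectiveStructure.strongTopology n M l) G) ∧
      ∀ P ∈ G, ¬ P.IsVariational ∧ ¬ P.IsMetrizable := by
  obtain ⟨p₀⟩ := ‹Nonempty M›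
  -- Order four suffices in all dimensions `n ≥ 2`, so both prescribed values of `l` are covered.
  have hl4 : 4 ≤ l := by split_ifs at hl <;> omega
  obtain ⟨F, hFω, hF1, hF⟩ := ProjVar.exists_genericity_function
    (p₀ := (ProjVar.stdVec (n := n) 0, ProjVar.rigidEndo n)) fun G hs h0 h =>
      ProjVar.eq_zero_of_compatible_rigidEndo hn hs h0 h
  have hopen := ProjVar.isOpen_genericSet (n := n) (M := M) hl4 hFω.continuous p₀
  have hdense := ProjVar.dense_genericSet (l := l) hn hFω hF1 p₀
  refine ⟨ProjVar.genericSet F p₀,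
    ⟨hopen, ProjVar.dense_weakTopology_of_dense_strongTopology hdense⟩,
    ⟨ProjVar.isOpen_strongTopology_of_isOpen_weakTopology hopen, hdense⟩, ?_⟩
  rintro _ ⟨D, hD, rfl⟩
  -- Membership in the generic set says that the tangent vector `stdVec 0` at `p₀` lies in the rigid
  -- region of the chosen representative.
  have hne : (D.rigidRegion F (chartAt (ProjVar.Model n) p₀)).Nonempty :=
    ⟨_, mem_chart_target _ p₀, hD⟩
  exact ⟨D.not_isVariational hn p₀ hFω.continuous hF hne,
    D.not_isMetrizable hn (ProjVar.chartAt_mem_charts p₀) hFω.continuous hF hne⟩
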